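/- Conventions. Programs are finite bit strings, and finite objects are identified with natural numbers by a fixed effective coding. Let $U$ be a universal Turing machine with a one-way read-only program tape, an auxiliary input and a one-way output tape: for every such machine $T$ there is a string $r$ such that, for all auxiliary inputs $y$ and all programs $p$, $U$ on $(y, rp)$ behaves as $T$ on $(y,p)$. Write $U_y(p)=x$ if $U$, with auxiliary input $y$, halts with output $x$ after reading exactly the $\|p\|$ bits of $p$. Put $K(x/y)=\min\{\|p\| : U_y(p)=x\}$ and $m(x/y)=\sum_{p:\,U_y(p)=x}2^{-\|p\|}$. A vector or matrix is elementary if the real and imaginary parts of its entries are rational. For $n\ge 0$ let $$\mu_n=\sum_{\varphi} m(\varphi/n)\,|\varphi\rangle\langle\varphi|,$$ the sum being over all elementary unit vectors $\varphi$ of the $2^n$-dimensional space of $n$ qubits. A program $q$ lower computes a matrix $A$ if $U$ on $q$ (with empty auxiliary input) reads at most $\|q\|$ bits and outputs, with or without halting, a non-empty sequence of elementary positive semidefinite matrices that is increasing in the Loewner order and has limit $A$ (the last matrix, if the sequence is finite). $A$ is lower computable if some $q$ lower computes it, and $\underline{m}(A/y)=\sum\{m(q/y) : q \text{ lower computes }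 A\}$. Let $\mathcal C_n$ be the set of all lower computable matrices of the form $A\otimes B$, with $A$, $B$ matrices on $n$ qubits, such that $\mathrm{Tr}\,(A\otimes B)(\mu_n\otimes\mu_n)\le 1$, and let $\mathfrak C_n=\sum_{X\in\mathcal C_n}\underline{m}(X/n)\,X$. For $n$-qubit density matrices $\sigma,\rho$ put $$I(\sigma:\rho)=\log_2 \mathrm{Tr}\,\mathfrak C_n(\sigma\otimes\rho).$$ Theorem. The series defining $\mu_n$ and $\mathfrak C_n$ converge for every $n$, and $\mathrm{Tr}\,\mathfrak C_n(\sigma\otimes\rho)>0$ for all $n$-qubit density matrices $\sigma,\rho$, so that $I(\sigma:\rho)$ is a well-defined real number. Moreover there is a constant $c$, depending only on $U$ and the coding, such that for all $n$, all density matrices $\sigma,\rho$ on $n$ qubits and all elementary density matrices $\nu,\xi$ on $n$ qubits, $$I(\sigma\otimes\nu:\rho\otimes\xi)\le I(\sigma:\rho)+2K(\nu/n)+2K(\xi/n)+c,$$ where the left-hand side is the information between two density matrices on $2n$ qubits. -/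

import Mathlib

namespace QInfo

open Filter Topology
open scoped Kronecker ComplexOrder

/-! ### Machines with a one-way program tape

Natural numbers stand for finite strings, in particular for configurations and for finite
objects; the empty string is `0`. -/

/-- What a machine does in its current control configuration: halt, move on silently, read the next
bit of the program tape and branch on it, or write an object on the output tape. -/
inductive Instr : Type
  | halt : Instr
  | goto (c : ℕ) : Instr
  | read (c₀ c₁ : ℕ) : Instr
  | write (x c : ℕ) : Instr

/-- Instructions as a sum type, used only to say that a function into `Instr` is computable. -/
def Instr.equivSum : Instr ≃ Unit ⊕ (ℕ ⊕ ((ℕ × ℕ) ⊕ (ℕ × ℕ))) where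
  toFun
    | .halt => .inl ()
    | .goto c => .inr (.inl c)
    | .read c₀ c₁ => .inr (.inr (.inl (c₀, c₁)))
    | .write x c => .inr (.inr (.inr (x, c)))
  invFun
    | .inl _ => .halt
    | .inr (.inl c) => .goto c
    | .inr (.inr (.inl (c₀, c₁))) => .read c₀ c₁
    | .inr (.inr (.inr (x, c))) => .write x c
  left_inv := by rintro (_ | _ | _ | _) <;> rfl
  right_inv := by rintro (_ | _ | ⟨_, _⟩ | ⟨_, _⟩) <;> rfl

instance : Primcodable Instr := Primcodable.ofEquiv _ Instr.equivSum

/-- A (Turing) machine with a one-way read-only program tape, an auxiliary input and a one-way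
output tape. The contents of the work tapes, the auxiliary tape and the finite control together
form the control configuration, a number; the transition rule is a computable function of it. -/
structure Machine where
  /-- The initial control configuration, when the auxiliary input is `y`. -/
  init : ℕ → ℕ
  /-- The transition rule. -/
  next : ℕ → Instr
  init_computable : Computable init
  next_computable : Computable next

/-- A full configuration: control, unread part of the program, objects written so far. -/
structure Config where
  ctrl : ℕ
  input : List Bool
  out : List ℕ

namespace Machine

/-- One step. It fails if the machine tries to read beyond the end of the program. -/
def step (M : Machine) (s : Config) : Option Config :=
  match M.next s.ctrl, s.input with
  | .halt, _ => some s
  | .goto c, _ => some { s with ctrl := c }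
  | .read _ _, [] => none
  | .read c₀ _, false :: rest => some { s with ctrl := c₀, input := rest }
  | .read _ c₁, true :: rest => some { s with ctrl := c₁, input := rest }
  | .write x c, _ => some { s with ctrl := c, out := s.out ++ [x] }

/-- The configuration after `t` steps, with auxiliary input `y` and program `p`; `none` if the
machine has tried to read more than `p.length` bits. -/
def run (M : Machine) (y : ℕ) (p : List Bool) : ℕ → Option Config
  | 0 => some ⟨M.init y, p, []⟩
  | t + 1 => (M.run y p t).bind M.step

/-- The machine tries to read more than `p.length` bits. -/
def Overreads (M : Machine) (y : ℕ) (p : List Bool) : Prop :=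
  ∃ t, M.run y p t = none

/-- At some time the list of objects on the output tape is `l`. -/
def Emits (M : Machine) (y : ℕ) (p : List Bool) (l : List ℕ) : Prop :=
  ∃ t s, M.run y p t = some s ∧ s.out = l

/-- The machine halts, leaving the part `rest` of the program unread, with output tape `l`. -/
def HaltsWith (M : Machine) (y : ℕ) (p rest : List Bool) (l : List ℕ) : Prop :=
  ∃ t s, M.run y p t = some s ∧ M.next s.ctrl = .halt ∧ s.input = rest ∧ s.out = l

/-- `M_y(p) = x`: the machine halts after reading exactly the `p.length` bits of `p`, and its output
is `x`. -/
def Outputs (M : Machine) (y : ℕ) (p : List Bool) (x : ℕ) : Prop :=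
  M.HaltsWith y p [] [x]

/-- `U` is universal: for each machine `T` there is a string `r` such that `U`, on program `rp`,
behaves as `T` does on program `p`, for all programs `p` and all auxiliary inputs `y`. -/
def IsUniversal (U : Machine) : Prop :=
  ∀ T : Machine, ∃ r : List Bool, ∀ (y : ℕ) (p : List Bool),
    (U.Overreads y (r ++ p) ↔ T.Overreads y p) ∧
    (∀ l, U.Emits y (r ++ p) l ↔ T.Emits y p l) ∧
    (∀ rest l, U.HaltsWith y (r ++ p) rest l ↔ T.HaltsWith y p rest l)

end Machine

/-- Conditional prefix complexity `K(x/y)`. -/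
noncomputable def K (U : Machine) (x y : ℕ) : ℕ :=
  sInf {k | ∃ p : List Bool, p.length = k ∧ U.Outputs y p x}

open Classical in
/-- The universal probability `m(x/y)`. -/
noncomputable def m (U : Machine) (x y : ℕ) : ℝ :=
  ∑' p : List Bool, if U.Outputs y p x then (2 : ℝ)⁻¹ ^ p.length else 0

/-! ### Matrices on qubits, elementary objects -/

/-- Complex matrices on the space of `n` qubits. -/
abbrev QMat (n : ℕ) : Type := Matrix (Fin (2 ^ n)) (Fin (2 ^ n)) ℂ

/-- The tensor (Kronecker) product of a matrix on `m` qubits and one on `n` qubits. -/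
def tensor {m n : ℕ} (A : QMat m) (B : QMat n) : QMat (m + n) :=
  Matrix.reindex (finProdFinEquiv.trans (finCongr (pow_add 2 m n).symm))
    (finProdFinEquiv.trans (finCongr (pow_add 2 m n).symm)) (A ⊗ₖ B)

/-- Density matrices: positive semidefinite (hence self-adjoint) of trace one. -/
def IsDensity {n : ℕ} (A : QMat n) : Prop := A.PosSemidef ∧ A.trace = 1

/-- Complex numbers with rational real and imaginary part. -/
structure GaussRat where
  re : ℚ
  im : ℚ

/-- The complex number given by a `GaussRat`. -/
noncomputable def GaussRat.toComplex (z : GaussRat) : ℂ := ⟨(z.re : ℝ), (z.im : ℝ)⟩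

/-- The code of a `GaussRat`. -/
def GaussRat.code (z : GaussRat) : ℕ :=
  Nat.pair (Nat.pair (Encodable.encode z.re.num) z.re.den)
    (Nat.pair (Encodable.encode z.im.num) z.im.den)

/-- Vectors on `n` qubits with rational components. -/
abbrev EVec (n : ℕ) : Type := Fin (2 ^ n) → GaussRat

/-- The complex vector given by an elementary one. -/
noncomputable def EVec.toVec {n : ℕ} (v : EVec n) : Fin (2 ^ n) → ℂ := fun i => (v i).toComplex

/-- The code of an elementary vector. -/
def EVec.code {n : ℕ} (v : EVec n) : ℕ := Encodable.encode (List.ofFn fun i => (v i).code)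

/-- Matrices on `n` qubits with rational components. -/
abbrev EMat (n : ℕ) : Type := Matrix (Fin (2 ^ n)) (Fin (2 ^ n)) GaussRat

/-- The complex matrix given by an elementary one. -/
noncomputable def EMat.toMat {n : ℕ} (A : EMat n) : QMat n := Matrix.map A GaussRat.toComplex

/-- The code of an elementary matrix, row by row. -/
def EMat.code {n : ℕ} (A : EMat n) : ℕ :=
  Encodable.encode (List.ofFn fun i => Encodable.encode (List.ofFn fun j => (A i j).code))

/-- Elementary pure states of `n` qubits: unit vectors with rational components. -/
abbrev EPure (n : ℕ) : Type := {v : EVec n // ∑ i, ‖v.toVec i‖ ^ 2 = 1}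

/-- The summand `m(φ/n) |φ⟩⟨φ|` of the universal matrix. -/
noncomputable def muTerm (U : Machine) (n : ℕ) (φ : EPure n) : QMat n :=
  m U φ.1.code n • Matrix.vecMulVec φ.1.toVec (star φ.1.toVec)

/-- The universal semi-density matrix on `n` qubits. -/
noncomputable def mu (U : Machine) (n : ℕ) : QMat n := ∑' φ : EPure n, muTerm U n φ

/-! ### Lower computable matrices and information -/

/-- The program `q` lower computes `A`: without reading more than `q.length` bits, `U` outputs, with
or without halting, an increasing sequence of elementary positive semidefinite matrices with
limit `A`. The sequence is `s`; if there are only finitely many (but at least one) outputs, then the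
last one is repeated for ever in `s`. -/
def LowerComputes (U : Machine) {n : ℕ} (q : List Bool) (A : QMat n) : Prop :=
  ¬ U.Overreads 0 q ∧
  ∃ s : ℕ → EMat n,
    (∀ k, (∃ l, U.Emits 0 q l ∧ l[k]? = some (s k).code) ∨
      (0 < k ∧ (∀ l, U.Emits 0 q l → l.length ≤ k) ∧ s k = s (k - 1))) ∧
    (∀ k, (s k).toMat.PosSemidef) ∧
    (∀ k, ((s (k + 1)).toMat - (s k).toMat).PosSemidef) ∧
    Tendsto (fun k => (s k).toMat) atTop (𝓝 A)

/-- The matrix is lower computed by some program. -/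
def LowerComputable (U : Machine) {n : ℕ} (A : QMat n) : Prop := ∃ q, LowerComputes U q A

open Classical in
/-- The lower algorithmic probability of a matrix, relative to `y`. -/
noncomputable def lowerProb (U : Machine) {n : ℕ} (A : QMat n) (y : ℕ) : ℝ :=
  ∑' q : List Bool, if LowerComputes U q A then m U (Encodable.encode q) y else 0

/-- The product tests with respect to `C ⊗ D`: all lower computable matrices `X = A ⊗ B` such
that `Tr X (C ⊗ D) ≤ 1`. -/
def productTests (U : Machine) {n : ℕ} (C D : QMat n) : Set (QMat (n + n)) :=
  {X | (∃ A B : QMat n, X = tensor A B) ∧ LowerComputable U X ∧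
    (X * tensor C D).trace.re ≤ 1}

/-- The summand of the universal product test with respect to `mu ⊗ mu`. -/
noncomputable def testTerm (U : Machine) (n : ℕ) (X : productTests U (mu U n) (mu U n)) :
    QMat (n + n) :=
  lowerProb U X.1 n • X.1

/-- The universal product test with respect to `mu ⊗ mu`. -/
noncomputable def universalTest (U : Machine) (n : ℕ) : QMat (n + n) :=
  ∑' X : productTests U (mu U n) (mu U n), testTerm U n X

/-- `Tr 𝔠 (σ ⊗ ρ)`, where `𝔠` is the universal product test; a nonnegative real number. -/
noncomputable def testTrace (U : Machine) {n : ℕ} (σ ρ : QMat n) : ℝ :=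
  (universalTest U n * tensor σ ρ).trace.re

/-- The mutual information `I(σ : ρ)` of two matrices on `n` qubits. -/
noncomputable def info (U : Machine) {n : ℕ} (σ ρ : QMat n) : ℝ :=
  Real.logb 2 (testTrace U σ ρ)

end QInfo

open QInfo

namespace QInfo

open Filter Topology
open scoped Kronecker ComplexOrder

/-! ### Primitive recursive arithmetic on codes of Gaussian rationals -/

/-! Adjoining `ν` and `ξ` cannot create much information, because a test for the larger system
becomes a test for the smaller one when `ν` and `ξ` are contracted into it. Let `X` be a product
test with respect to `mu U (n + n)` in both places, and let `contract ν ξ X` be its partial trace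
against `ν` in the second and `ξ` in the fourth tensor factor. This is again a product
(`contract_tensor`), and its trace against `σ ⊗ ρ` is the trace of `X` against `(σ ⊗ ν) ⊗ (ρ ⊗ ξ)`
(`trace_contract_mul`).

Two costs arise. By `exists_mu_dominates`, `μₙ ⊗ ν ≤ 2 ^ (K(ν/n) + c) μ₂ₙ`, so the contraction
becomes a test after division by `2 ^ (K(ν/n) + K(ξ/n) + 2c)` (`contract_mem_productTests`). A
program that lower computes it can be found from programs for `ν`, `ξ` and a program lower computing
`X` (`exists_contract_program`, `exists_contractMachine_program`), so its probability drops by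
another `2 ^ (K(ν/n) + K(ξ/n) + O(1))`. Hence the coefficients 2.

For the domination, eigenvectors of `ν` need not be rational, so `ν` is not decomposed exactly. A
search finds `2 ^ k` elementary unit vectors `ψ i` whose mean projector `S` is so close to `(ν + 2⁻ⁿ
1) / 2` that `ν ≤ 2 S`. The vector `φ ⊗ ψ i` is described by a program for `φ`, a shortest program
for `ν` and `k` bits selecting `i`; summing over `i` recovers `S` up to the factor `2 ^ (-K(ν/n) -
O(1))`. Such ensembles exist since reflections of a basis vector along rational vectors are rational
unit vectors and form a dense set up to phase, and since dyadic mixtures approximate all convex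
combinations.

The series are handled in `ℝ≥0∞` as sums over pairs of a program and its output (`tsum_probE`); an
inequality between two of them is an injection of index sets with a comparison of terms. Their
convergence rests on the Kraft inequality and, for the universal test, on a lower bound `ε 1 ≤ μₙ`,
which bounds the traces of all tests. Positivity holds because the identity is a test. Effectivity
is obtained from primitive recursive functions on codes and a few explicit machines, combined by
`Machine.seq` and `Machine.transduce`. -/

/-- Greatest common divisors are primitive recursive. -/
theorem primrec_gcd {α : Type*} [Primcodable α] {f g : α → ℕ} (hf : Primrec f) (hg : Primrec g) :
    Primrec fun a => Nat.gcd (f a) (g a) := by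
  have hdvd : ∀ {β : Type _} [Primcodable β] {u v : β → ℕ}, Primrec u → Primrec v →
      PrimrecPred fun b => u b ∣ v b := by
    intro β _ u v hu hv
    refine PrimrecPred.of_eq (Primrec.eq.comp (Primrec.nat_mod.comp hv hu) (Primrec.const 0)) ?_
    intro b
    exact (Nat.dvd_iff_mod_eq_zero).symm
  -- The bound `f a + g a` is large enough even if one argument is 0, when the gcd is the other
  -- argument. If both are 0 the search returns 0, as does `Nat.gcd`.
  have key : Primrec fun a => Nat.findGreatest (fun d => d ∣ f a ∧ d ∣ g a) (f a + g a) := by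
    refine Primrec.nat_findGreatest (Primrec.nat_add.comp hf hg) ?_
    exact PrimrecPred.and (hdvd Primrec.snd (hf.comp Primrec.fst))
      (hdvd Primrec.snd (hg.comp Primrec.fst))
  refine key.of_eq fun a => ?_
  rcases Nat.eq_zero_or_pos (f a + g a) with h | h
  · have h1 : f a = 0 := by omega
    have h2 : g a = 0 := by omega
    simp [h1, h2]
  · rw [Nat.findGreatest_eq_iff]
    have hpos : 0 < Nat.gcd (f a) (g a) := by
      rcases Nat.eq_zero_or_pos (f a) with h1 | h1
      · exact Nat.gcd_pos_of_pos_right _ (by omega)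
      · exact Nat.gcd_pos_of_pos_left _ h1
    refine ⟨?_, fun _ => ⟨Nat.gcd_dvd_left _ _, Nat.gcd_dvd_right _ _⟩, ?_⟩
    · rcases Nat.eq_zero_or_pos (f a) with h1 | h1
      · have := Nat.gcd_le_right (f a) (show 0 < g a by omega)
        omega
      · have := Nat.gcd_le_left (g a) h1
        omega
    · rintro n hn - ⟨h1, h2⟩
      exact absurd (Nat.le_of_dvd hpos (Nat.dvd_gcd h1 h2)) (by omega)

/-- The code of the integer `a - b`. -/
def subCode (a b : ℕ) : ℕ := if b ≤ a then 2 * (a - b) else 2 * (b - a - 1) + 1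

/-- The positive part of the integer with code `e`. -/
def posPart (e : ℕ) : ℕ := if e % 2 = 0 then e / 2 else 0

/-- The negative part of the integer with code `e`. -/
def negPart (e : ℕ) : ℕ := if e % 2 = 0 then 0 else e / 2 + 1

theorem encode_ofNat (n : ℕ) : Encodable.encode (n : ℤ) = 2 * n := rfl

theorem encode_negSucc (n : ℕ) : Encodable.encode (Int.negSucc n) = 2 * n + 1 := rfl

theorem subCode_eq (a b : ℕ) : subCode a b = Encodable.encode ((a : ℤ) - b) := by
  unfold subCode
  split_ifs with h
  · rw [← Nat.cast_sub h, encode_ofNat]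
  · rw [show (a : ℤ) - b = Int.negSucc (b - a - 1) by omega, encode_negSucc]

theorem posPart_encode (z : ℤ) : (posPart (Encodable.encode z) : ℤ) = max z 0 := by
  cases z with
  | ofNat n => simp [posPart, encode_ofNat]
  | negSucc n => rw [encode_negSucc]; simp [posPart]

theorem negPart_encode (z : ℤ) : (negPart (Encodable.encode z) : ℤ) = max (-z) 0 := by
  cases z with
  | ofNat n => simp [negPart, encode_ofNat]
  | negSucc n => rw [encode_negSucc]; simp [negPart]; omega

theorem posPart_sub_negPart (z : ℤ) :
    (posPart (Encodable.encode z) : ℤ) - negPart (Encodable.encode z) = z := by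
  rw [posPart_encode, negPart_encode]; omega

/-- The code of a rational number. -/
def ratCode (q : ℚ) : ℕ := Nat.pair (Encodable.encode q.num) q.den

/-- The code of the rational number `(a - b) / d`. -/
def fracCode (a b d : ℕ) : ℕ :=
  Nat.pair (subCode ((a - b) / Nat.gcd (a - b + (b - a)) d) ((b - a) / Nat.gcd (a - b + (b - a)) d))
    (d / Nat.gcd (a - b + (b - a)) d)

/-- One of the truncated differences `a - b` and `b - a` vanishes, so their sum is the absolute
value of the numerator, and division by the gcd gives lowest terms. Codes are thus unique, and
equality of numbers can be tested on codes. -/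
theorem fracCode_eq (a b d : ℕ) (hd : d ≠ 0) :
    fracCode a b d = ratCode (((a : ℚ) - b) / d) := by
  have h1 : ((a : ℚ) - b) / d = Rat.normalize ((a : ℤ) - b) d hd := by
    rw [Rat.normalize_eq_mkRat, Rat.mkRat_eq_div]; push_cast; rfl
  have hg : Nat.gcd (((a : ℤ) - b).natAbs) d = Nat.gcd (a - b + (b - a)) d := by
    congr 1; omega
  rw [h1, ratCode, Rat.normalize_eq, fracCode, subCode_eq]
  simp only [hg]
  congr 2
  set g := Nat.gcd (a - b + (b - a)) d with hgdef
  rcases le_total b a with h | h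
  · rw [show (a : ℤ) - b = ((a - b : ℕ) : ℤ) by omega, show b - a = 0 by omega]
    simp
  · rw [show (a : ℤ) - b = -((b - a : ℕ) : ℤ) by omega, show a - b = 0 by omega]
    have : (g : ℤ) ∣ ((b - a : ℕ) : ℤ) := by
      rw [Int.natCast_dvd_natCast, hgdef, show a - b = 0 by omega, zero_add]
      exact Nat.gcd_dvd_left _ _
    rw [Int.neg_ediv_of_dvd this]
    simp

/-- Addition of codes of rational numbers. -/
def ratAdd (x y : ℕ) : ℕ :=
  fracCode (posPart x.unpair.1 * y.unpair.2 + posPart y.unpair.1 * x.unpair.2)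
    (negPart x.unpair.1 * y.unpair.2 + negPart y.unpair.1 * x.unpair.2) (x.unpair.2 * y.unpair.2)

/-- Multiplication of codes of rational numbers. -/
def ratMul (x y : ℕ) : ℕ :=
  fracCode (posPart x.unpair.1 * posPart y.unpair.1 + negPart x.unpair.1 * negPart y.unpair.1)
    (posPart x.unpair.1 * negPart y.unpair.1 + negPart x.unpair.1 * posPart y.unpair.1)
    (x.unpair.2 * y.unpair.2)

/-- Negation of codes of rational numbers. -/
def ratNeg (x : ℕ) : ℕ := fracCode (negPart x.unpair.1) (posPart x.unpair.1) x.unpair.2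

theorem ratCode_parts (q : ℚ) : q =
    ((posPart (ratCode q).unpair.1 : ℚ) - negPart (ratCode q).unpair.1) / (ratCode q).unpair.2 := by
  conv_lhs => rw [← Rat.num_div_den q]
  simp only [ratCode, Nat.unpair_pair]
  congr 1
  exact_mod_cast (posPart_sub_negPart q.num).symm

theorem ratCode_den_ne_zero (q : ℚ) : (ratCode q).unpair.2 ≠ 0 := by simp [ratCode]

theorem ratAdd_ratCode (p q : ℚ) : ratAdd (ratCode p) (ratCode q) = ratCode (p + q) := by
  have hp := ratCode_den_ne_zero p
  have hq := ratCode_den_ne_zero q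
  rw [ratAdd, fracCode_eq _ _ _ (mul_ne_zero hp hq)]
  congr 1
  conv_rhs => rw [ratCode_parts p, ratCode_parts q]
  push_cast
  field_simp
  ring

theorem ratMul_ratCode (p q : ℚ) : ratMul (ratCode p) (ratCode q) = ratCode (p * q) := by
  have hp := ratCode_den_ne_zero p
  have hq := ratCode_den_ne_zero q
  rw [ratMul, fracCode_eq _ _ _ (mul_ne_zero hp hq)]
  congr 1
  conv_rhs => rw [ratCode_parts p, ratCode_parts q]
  push_cast
  field_simp
  ring

theorem ratNeg_ratCode (p : ℚ) : ratNeg (ratCode p) = ratCode (-p) := by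
  have hp := ratCode_den_ne_zero p
  rw [ratNeg, fracCode_eq _ _ _ hp]
  congr 1
  conv_rhs => rw [ratCode_parts p]
  field_simp
  ring

theorem ratCode_injective : Function.Injective ratCode := by
  intro p q h
  rw [ratCode_parts p, ratCode_parts q, h]

/-- Addition of codes of Gaussian rationals. -/
def gAdd (z w : ℕ) : ℕ :=
  Nat.pair (ratAdd z.unpair.1 w.unpair.1) (ratAdd z.unpair.2 w.unpair.2)

/-- Multiplication of codes of Gaussian rationals. -/
def gMul (z w : ℕ) : ℕ :=
  Nat.pair (ratAdd (ratMul z.unpair.1 w.unpair.1) (ratNeg (ratMul z.unpair.2 w.unpair.2)))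
    (ratAdd (ratMul z.unpair.1 w.unpair.2) (ratMul z.unpair.2 w.unpair.1))

/-- Complex conjugation of codes of Gaussian rationals. -/
def gConj (z : ℕ) : ℕ := Nat.pair z.unpair.1 (ratNeg z.unpair.2)

/-- The code of the Gaussian rational `(a - b) / d`. -/
def gFrac (a b d : ℕ) : ℕ := Nat.pair (fracCode a b d) (fracCode 0 0 1)

/-- Sums of codes of Gaussian rationals. -/
def gSum (N : ℕ) (f : ℕ → ℕ) : ℕ := N.rec (gFrac 0 0 1) fun i s => gAdd s (f i)

/-- `c` is the code of a Gaussian rational with value `z`. -/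
def IsCode (c : ℕ) (z : ℂ) : Prop := ∃ g : GaussRat, g.code = c ∧ g.toComplex = z

theorem GaussRat.code_eq (g : GaussRat) : g.code = Nat.pair (ratCode g.re) (ratCode g.im) := rfl

theorem GaussRat.code_injective : Function.Injective GaussRat.code := by
  rintro ⟨a, b⟩ ⟨c, d⟩ h
  rw [GaussRat.code_eq, GaussRat.code_eq, Nat.pair_eq_pair] at h
  rw [GaussRat.mk.injEq]
  exact ⟨ratCode_injective h.1, ratCode_injective h.2⟩

theorem GaussRat.toComplex_injective : Function.Injective GaussRat.toComplex := by
  rintro ⟨a, b⟩ ⟨c, d⟩ h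
  have h1 := congrArg Complex.re h
  have h2 := congrArg Complex.im h
  simp only [GaussRat.toComplex] at h1 h2
  rw [GaussRat.mk.injEq]
  exact ⟨by exact_mod_cast h1, by exact_mod_cast h2⟩

theorem GaussRat.isCode (g : GaussRat) : IsCode g.code g.toComplex := ⟨g, rfl, rfl⟩

theorem IsCode.add {a b : ℕ} {z w : ℂ} (ha : IsCode a z) (hb : IsCode b w) :
    IsCode (gAdd a b) (z + w) := by
  obtain ⟨g, rfl, rfl⟩ := ha
  obtain ⟨h, rfl, rfl⟩ := hb
  refine ⟨⟨g.re + h.re, g.im + h.im⟩, ?_, ?_⟩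
  · simp [gAdd, GaussRat.code_eq, ratAdd_ratCode]
  · apply Complex.ext <;> simp [GaussRat.toComplex]

theorem IsCode.mul {a b : ℕ} {z w : ℂ} (ha : IsCode a z) (hb : IsCode b w) :
    IsCode (gMul a b) (z * w) := by
  obtain ⟨g, rfl, rfl⟩ := ha
  obtain ⟨h, rfl, rfl⟩ := hb
  refine ⟨⟨g.re * h.re + -(g.im * h.im), g.re * h.im + g.im * h.re⟩, ?_, ?_⟩
  · simp [gMul, GaussRat.code_eq, ratAdd_ratCode, ratMul_ratCode, ratNeg_ratCode]
  · apply Complex.ext <;> simp [GaussRat.toComplex, sub_eq_add_neg]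

theorem IsCode.conj {a : ℕ} {z : ℂ} (ha : IsCode a z) : IsCode (gConj a) (star z) := by
  obtain ⟨g, rfl, rfl⟩ := ha
  refine ⟨⟨g.re, -g.im⟩, ?_, ?_⟩
  · simp [gConj, GaussRat.code_eq, ratNeg_ratCode]
  · apply Complex.ext <;> simp [GaussRat.toComplex]

theorem isCode_gFrac (a b d : ℕ) (hd : d ≠ 0) : IsCode (gFrac a b d) (((a : ℂ) - b) / d) := by
  refine ⟨⟨((a : ℚ) - b) / d, 0⟩, ?_, ?_⟩
  · rw [GaussRat.code_eq, gFrac, fracCode_eq _ _ _ hd, fracCode_eq _ _ _ one_ne_zero]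
    simp
  · have : (((a : ℂ) - b) / d) = (((((a : ℚ) - b) / d : ℚ) : ℝ) : ℂ) := by push_cast; rfl
    rw [this]
    apply Complex.ext <;> simp [GaussRat.toComplex]

theorem IsCode.sum {f : ℕ → ℕ} {F : ℕ → ℂ} {N : ℕ} (h : ∀ i < N, IsCode (f i) (F i)) :
    IsCode (gSum N f) (∑ i ∈ Finset.range N, F i) := by
  induction N with
  | zero =>
    have h0 : IsCode (gSum 0 f) _ := isCode_gFrac 0 0 1 one_ne_zero
    simpa using h0
  | succ N ih =>
    rw [Finset.sum_range_succ]
    exact (ih fun i hi => h i (by omega)).add (h N (by omega))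

theorem IsCode.eq_iff {a b : ℕ} {z w : ℂ} (ha : IsCode a z) (hb : IsCode b w) :
    a = b ↔ z = w := by
  obtain ⟨g, rfl, rfl⟩ := ha
  obtain ⟨h, rfl, rfl⟩ := hb
  rw [GaussRat.code_injective.eq_iff, GaussRat.toComplex_injective.eq_iff]

/-- The sign of a rational number is that of its numerator. Inequalities between elementary numbers
thereby become equations between natural numbers, which makes `GoodEns` primitive recursive. -/
theorem IsCode.re_nonpos_iff {a : ℕ} {z : ℂ} (ha : IsCode a z) :
    posPart a.unpair.1.unpair.1 = 0 ↔ z.re ≤ 0 := by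
  obtain ⟨g, rfl, rfl⟩ := ha
  simp only [GaussRat.code_eq, ratCode, Nat.unpair_pair, GaussRat.toComplex]
  rw [← Int.natCast_inj, posPart_encode]
  norm_cast
  rw [← Rat.num_nonpos]
  omega

section Primrec

variable {α : Type*} [Primcodable α]

theorem primrec_unpair_fst {f : α → ℕ} (hf : Primrec f) : Primrec fun a => (f a).unpair.1 :=
  Primrec.fst.comp (Primrec.unpair.comp hf)

theorem primrec_unpair_snd {f : α → ℕ} (hf : Primrec f) : Primrec fun a => (f a).unpair.2 :=
  Primrec.snd.comp (Primrec.unpair.comp hf)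

theorem primrec_posPart : Primrec posPart :=
  Primrec.ite (Primrec.eq.comp (Primrec.nat_mod.comp Primrec.id (Primrec.const 2))
    (Primrec.const 0)) (Primrec.nat_div.comp Primrec.id (Primrec.const 2)) (Primrec.const 0)

theorem primrec_negPart : Primrec negPart :=
  Primrec.ite (Primrec.eq.comp (Primrec.nat_mod.comp Primrec.id (Primrec.const 2))
    (Primrec.const 0)) (Primrec.const 0)
    (Primrec.succ.comp (Primrec.nat_div.comp Primrec.id (Primrec.const 2)))

theorem primrec_subCode {f g : α → ℕ} (hf : Primrec f) (hg : Primrec g) :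
    Primrec fun a => subCode (f a) (g a) :=
  Primrec.ite (Primrec.nat_le.comp hg hf)
    (Primrec.nat_mul.comp (Primrec.const 2) (Primrec.nat_sub.comp hf hg))
    (Primrec.succ.comp (Primrec.nat_mul.comp (Primrec.const 2)
      (Primrec.nat_sub.comp (Primrec.nat_sub.comp hg hf) (Primrec.const 1))))

theorem primrec_fracCode {f g h : α → ℕ} (hf : Primrec f) (hg : Primrec g) (hh : Primrec h) :
    Primrec fun a => fracCode (f a) (g a) (h a) := by
  have h1 := Primrec.nat_sub.comp hf hg
  have h2 := Primrec.nat_sub.comp hg hf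
  have h3 := primrec_gcd (Primrec.nat_add.comp h1 h2) hh
  exact Primrec₂.natPair.comp (primrec_subCode (Primrec.nat_div.comp h1 h3)
    (Primrec.nat_div.comp h2 h3)) (Primrec.nat_div.comp hh h3)

theorem primrec_ratAdd {f g : α → ℕ} (hf : Primrec f) (hg : Primrec g) :
    Primrec fun a => ratAdd (f a) (g a) := by
  have h1 := primrec_unpair_fst hf
  have h2 := primrec_unpair_snd hf
  have h3 := primrec_unpair_fst hg
  have h4 := primrec_unpair_snd hg
  exact primrec_fracCode
    (Primrec.nat_add.comp (Primrec.nat_mul.comp (primrec_posPart.comp h1) h4)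
      (Primrec.nat_mul.comp (primrec_posPart.comp h3) h2))
    (Primrec.nat_add.comp (Primrec.nat_mul.comp (primrec_negPart.comp h1) h4)
      (Primrec.nat_mul.comp (primrec_negPart.comp h3) h2)) (Primrec.nat_mul.comp h2 h4)

theorem primrec_ratMul {f g : α → ℕ} (hf : Primrec f) (hg : Primrec g) :
    Primrec fun a => ratMul (f a) (g a) := by
  have h1 := primrec_unpair_fst hf
  have h2 := primrec_unpair_snd hf
  have h3 := primrec_unpair_fst hg
  have h4 := primrec_unpair_snd hg
  exact primrec_fracCode
    (Primrec.nat_add.comp (Primrec.nat_mul.comp (primrec_posPart.comp h1) (primrec_posPart.comp h3))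
      (Primrec.nat_mul.comp (primrec_negPart.comp h1) (primrec_negPart.comp h3)))
    (Primrec.nat_add.comp (Primrec.nat_mul.comp (primrec_posPart.comp h1) (primrec_negPart.comp h3))
      (Primrec.nat_mul.comp (primrec_negPart.comp h1) (primrec_posPart.comp h3)))
    (Primrec.nat_mul.comp h2 h4)

theorem primrec_ratNeg {f : α → ℕ} (hf : Primrec f) : Primrec fun a => ratNeg (f a) :=
  primrec_fracCode (primrec_negPart.comp (primrec_unpair_fst hf))
    (primrec_posPart.comp (primrec_unpair_fst hf)) (primrec_unpair_snd hf)

theorem primrec_gAdd {f g : α → ℕ} (hf : Primrec f) (hg : Primrec g) :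
    Primrec fun a => gAdd (f a) (g a) :=
  Primrec₂.natPair.comp (primrec_ratAdd (primrec_unpair_fst hf) (primrec_unpair_fst hg))
    (primrec_ratAdd (primrec_unpair_snd hf) (primrec_unpair_snd hg))

theorem primrec_gMul {f g : α → ℕ} (hf : Primrec f) (hg : Primrec g) :
    Primrec fun a => gMul (f a) (g a) := by
  have h1 := primrec_unpair_fst hf
  have h2 := primrec_unpair_snd hf
  have h3 := primrec_unpair_fst hg
  have h4 := primrec_unpair_snd hg
  exact Primrec₂.natPair.comp
    (primrec_ratAdd (primrec_ratMul h1 h3) (primrec_ratNeg (primrec_ratMul h2 h4)))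
    (primrec_ratAdd (primrec_ratMul h1 h4) (primrec_ratMul h2 h3))

theorem primrec_gConj {f : α → ℕ} (hf : Primrec f) : Primrec fun a => gConj (f a) :=
  Primrec₂.natPair.comp (primrec_unpair_fst hf) (primrec_ratNeg (primrec_unpair_snd hf))

theorem primrec_gFrac {f g h : α → ℕ} (hf : Primrec f) (hg : Primrec g) (hh : Primrec h) :
    Primrec fun a => gFrac (f a) (g a) (h a) :=
  Primrec₂.natPair.comp (primrec_fracCode hf hg hh) (Primrec.const _)

theorem primrec_gSum {N : α → ℕ} {f : α → ℕ → ℕ} (hN : Primrec N)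
    (hf : Primrec fun p : α × ℕ => f p.1 p.2) : Primrec fun a => gSum (N a) (f a) := by
  refine (Primrec.nat_rec' (h := fun a p => gAdd p.2 (f a p.1)) hN
    (Primrec.const (gFrac 0 0 1)) ?_).of_eq fun a => rfl
  exact primrec_gAdd (Primrec.snd.comp Primrec.snd)
    (hf.comp (Primrec.pair Primrec.fst (Primrec.fst.comp Primrec.snd)))

theorem primrec_pow {f g : α → ℕ} (hf : Primrec f) (hg : Primrec g) :
    Primrec fun a => f a ^ g a :=
  (Primrec₂.unpaired'.1 Nat.Primrec.pow : Primrec₂ fun m n : ℕ => m ^ n).comp hf hg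

end Primrec

end QInfo

/-! ### Effective linear algebra: codes of partial traces and of ensembles of pure states. -/

namespace QInfo

open Filter Topology
open scoped Kronecker ComplexOrder

/-! ### Vectors and matrices of codes -/

/-- The list of numbers coded by `c`. -/
def codeList (c : ℕ) : List ℕ := (Encodable.decode (α := List ℕ) c).getD []

/-- The entry `a` of the vector coded by `c`. -/
def vecEnt (c a : ℕ) : ℕ := (codeList c).getD a 0

/-- The entry `(a, b)` of the matrix coded by `c`. -/
def matEnt (c a b : ℕ) : ℕ := vecEnt (vecEnt c a) b

/-- The code of the vector with entries `f a`, for `a < N`. -/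
def mkVec (N : ℕ) (f : ℕ → ℕ) : ℕ := Encodable.encode ((List.range N).map f)

section Primrec

variable {α : Type*} [Primcodable α]

theorem primrec_vecEnt {f g : α → ℕ} (hf : Primrec f) (hg : Primrec g) :
    Primrec fun a => vecEnt (f a) (g a) :=
  (Primrec.list_getD 0).comp
    (Primrec.option_getD.comp (Primrec.decode.comp hf) (Primrec.const [])) hg

theorem primrec_matEnt {f g h : α → ℕ} (hf : Primrec f) (hg : Primrec g) (hh : Primrec h) :
    Primrec fun a => matEnt (f a) (g a) (h a) := primrec_vecEnt (primrec_vecEnt hf hg) hh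

theorem primrec_mkVec {N : α → ℕ} {f : α → ℕ → ℕ} (hN : Primrec N)
    (hf : Primrec fun p : α × ℕ => f p.1 p.2) : Primrec fun a => mkVec (N a) (f a) :=
  Primrec.encode.comp (Primrec.list_map (Primrec.list_range.comp hN) hf)

end Primrec

theorem vecEnt_encode (l : List ℕ) (a : ℕ) : vecEnt (Encodable.encode l) a = l.getD a 0 := by
  simp [vecEnt, codeList]

theorem mkVec_eq_encode_ofFn {N : ℕ} {f : ℕ → ℕ} :
    mkVec N f = Encodable.encode (List.ofFn fun i : Fin N => f i) := by
  rw [mkVec]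
  congr 1
  apply List.ext_getElem <;> simp

theorem vecEnt_ofFn {N : ℕ} (f : Fin N → ℕ) (i : Fin N) :
    vecEnt (Encodable.encode (List.ofFn f)) i = f i := by
  simp [vecEnt_encode]

theorem vecEnt_code {n : ℕ} (v : EVec n) (i : Fin (2 ^ n)) : vecEnt v.code i = (v i).code :=
  vecEnt_ofFn (fun i => (v i).code) i

theorem matEnt_code {n : ℕ} (A : EMat n) (i j : Fin (2 ^ n)) :
    matEnt A.code i j = (A i j).code := by
  rw [matEnt, EMat.code, vecEnt_ofFn, vecEnt_ofFn]

theorem isCode_vecEnt {n : ℕ} (v : EVec n) (i : Fin (2 ^ n)) :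
    IsCode (vecEnt v.code i) (v.toVec i) := by
  rw [vecEnt_code]; exact (v i).isCode

theorem isCode_matEnt {n : ℕ} (A : EMat n) (i j : Fin (2 ^ n)) :
    IsCode (matEnt A.code i j) (A.toMat i j) := by
  rw [matEnt_code]; exact (A i j).isCode

theorem EVec.code_injective {n : ℕ} : Function.Injective (EVec.code (n := n)) := by
  intro v w h
  funext i
  apply GaussRat.code_injective
  rw [← vecEnt_code, h, vecEnt_code]

theorem EMat.code_injective {n : ℕ} : Function.Injective (EMat.code (n := n)) := by
  intro v w h
  funext i j
  apply GaussRat.code_injective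
  rw [← matEnt_code, h, matEnt_code]

/-- The functions on codes are total on `ℕ`; this lemma and `exists_emat` turn entrywise correctness
into an elementary object with the computed code. -/
theorem exists_evec {n : ℕ} {f : ℕ → ℕ} {z : Fin (2 ^ n) → ℂ} (h : ∀ i : Fin (2 ^ n), IsCode (f i) (z i)) :
    ∃ v : EVec n, v.code = mkVec (2 ^ n) f ∧ v.toVec = z := by
  choose g h1 h2 using h
  refine ⟨g, ?_, funext h2⟩
  rw [mkVec_eq_encode_ofFn, EVec.code]
  simp only [h1]

theorem exists_emat {n : ℕ} {f : ℕ → ℕ → ℕ} {z : QMat n} (h : ∀ i j : Fin (2 ^ n), IsCode (f i j) (z i j)) :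
    ∃ A : EMat n, A.code = mkVec (2 ^ n) (fun a => mkVec (2 ^ n) (f a)) ∧ A.toMat = z := by
  choose g h1 h2 using h
  refine ⟨g, ?_, Matrix.ext h2⟩
  simp only [mkVec_eq_encode_ofFn, EMat.code]
  simp only [h1]

/-! ### Tensor products and partial traces -/

/-- The index of a tensor product as a pair of indices. -/
def tensorIdx (m n : ℕ) : Fin (2 ^ m) × Fin (2 ^ n) ≃ Fin (2 ^ (m + n)) :=
  finProdFinEquiv.trans (finCongr (pow_add 2 m n).symm)

theorem tensorIdx_val {m n : ℕ} (i : Fin (2 ^ m)) (j : Fin (2 ^ n)) :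
    (tensorIdx m n (i, j) : ℕ) = i * 2 ^ n + j := by
  simp [tensorIdx, add_comm, mul_comm]

theorem tensorIdx_symm_fst_val {m n : ℕ} (a : Fin (2 ^ (m + n))) :
    (((tensorIdx m n).symm a).1 : ℕ) = a / 2 ^ n := by
  obtain ⟨⟨i, j⟩, rfl⟩ := (tensorIdx m n).surjective a
  rw [Equiv.symm_apply_apply, tensorIdx_val, add_comm, Nat.add_mul_div_right _ _ (by positivity),
    Nat.div_eq_of_lt j.2, zero_add]

theorem tensorIdx_symm_snd_val {m n : ℕ} (a : Fin (2 ^ (m + n))) :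
    (((tensorIdx m n).symm a).2 : ℕ) = a % 2 ^ n := by
  obtain ⟨⟨i, j⟩, rfl⟩ := (tensorIdx m n).surjective a
  rw [Equiv.symm_apply_apply, tensorIdx_val, add_comm, Nat.add_mul_mod_self_right,
    Nat.mod_eq_of_lt j.2]

theorem tensor_apply {m n : ℕ} (A : QMat m) (B : QMat n) (a b : Fin (2 ^ (m + n))) :
    tensor A B a b = A ((tensorIdx m n).symm a).1 ((tensorIdx m n).symm b).1 *
      B ((tensorIdx m n).symm a).2 ((tensorIdx m n).symm b).2 := rfl

theorem tensor_apply' {m n : ℕ} (A : QMat m) (B : QMat n) (i k : Fin (2 ^ m)) (j l : Fin (2 ^ n)) :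
    tensor A B (tensorIdx m n (i, j)) (tensorIdx m n (k, l)) = A i k * B j l := by
  simp [tensor_apply]

/-- Indices of four tensor factors, the two inner ones being exchanged. -/
def swapIdx (n : ℕ) :
    Fin (2 ^ (n + n)) × Fin (2 ^ (n + n)) ≃ Fin (2 ^ ((n + n) + (n + n))) :=
  (((tensorIdx n n).symm.prodCongr (tensorIdx n n).symm).trans
    (Equiv.prodProdProdComm _ _ _ _)).trans
    (((tensorIdx n n).prodCongr (tensorIdx n n)).trans (tensorIdx (n + n) (n + n)))

/-- The value of `swapIdx`, where `N` is the dimension of each factor. -/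
def swapNat (N a s : ℕ) : ℕ := (a / N * N + s / N) * (N * N) + (a % N * N + s % N)

theorem swapIdx_val {n : ℕ} (a s : Fin (2 ^ (n + n))) :
    (swapIdx n (a, s) : ℕ) = swapNat (2 ^ n) a s := by
  simp only [swapIdx, swapNat, Equiv.trans_apply, Equiv.prodCongr_apply, Prod.map_apply,
    Equiv.prodProdProdComm_apply, tensorIdx_val, tensorIdx_symm_fst_val, tensorIdx_symm_snd_val,
    pow_add]

/-- The partial trace over the second and the fourth factor, of `X` times `ν` in the second and `ξ`
in the fourth factor. -/
noncomputable def contract {n : ℕ} (ν ξ : QMat n) (X : QMat ((n + n) + (n + n))) : QMat (n + n) :=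
  fun a b => ∑ s, ∑ t, X (swapIdx n (a, s)) (swapIdx n (b, t)) * tensor ν ξ t s

/-- Codes of the entries of `2⁻¹ ^ k • contract ν ξ X`. -/
def contractEnt (N k ν ξ x a b : ℕ) : ℕ :=
  gMul (gFrac 1 0 (2 ^ k)) (gSum (N * N) fun s => gSum (N * N) fun t =>
    gMul (matEnt x (swapNat N a s) (swapNat N b t))
      (gMul (matEnt ν (t / N) (s / N)) (matEnt ξ (t % N) (s % N))))

/-- The code of `2⁻¹ ^ k • contract ν ξ X`. -/
def contractCode (N k ν ξ x : ℕ) : ℕ :=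
  mkVec (N * N) fun a => mkVec (N * N) fun b => contractEnt N k ν ξ x a b

/-- Only sums and products of entries occur, so rationality is preserved. The factor `2⁻¹ ^ k` is
the normalization that will make the contraction of a test a test. -/
theorem exists_contract_emat {n : ℕ} (k : ℕ) (ν ξ : EMat n) (x : EMat ((n + n) + (n + n))) :
    ∃ A : EMat (n + n), A.code = contractCode (2 ^ n) k ν.code ξ.code x.code ∧
      A.toMat = ((2 : ℂ)⁻¹ ^ k) • contract ν.toMat ξ.toMat x.toMat := by
  have h := exists_emat (n := n + n)
    (f := fun a b => contractEnt (2 ^ n) k ν.code ξ.code x.code a b)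
    (z := ((2 : ℂ)⁻¹ ^ k) • contract ν.toMat ξ.toMat x.toMat) ?_
  · simpa only [contractCode, pow_add] using h
  intro a b
  rw [Matrix.smul_apply, smul_eq_mul, contract, contractEnt]
  refine IsCode.mul ?_ ?_
  · simpa using isCode_gFrac 1 0 (2 ^ k) (by positivity)
  simp only [← pow_add]
  have key : ∀ s t : Fin (2 ^ (n + n)), IsCode
      (gMul (matEnt x.code (swapNat (2 ^ n) a s) (swapNat (2 ^ n) b t))
        (gMul (matEnt ν.code (t / 2 ^ n) (s / 2 ^ n)) (matEnt ξ.code (t % 2 ^ n) (s % 2 ^ n))))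
      (x.toMat (swapIdx n (a, s)) (swapIdx n (b, t)) * tensor ν.toMat ξ.toMat t s) := by
    intro s t
    refine IsCode.mul ?_ ?_
    · simpa only [swapIdx_val] using isCode_matEnt x (swapIdx n (a, s)) (swapIdx n (b, t))
    · rw [tensor_apply]
      refine IsCode.mul ?_ ?_
      · simpa only [tensorIdx_symm_fst_val] using
          isCode_matEnt ν ((tensorIdx n n).symm t).1 ((tensorIdx n n).symm s).1
      · simpa only [tensorIdx_symm_snd_val] using
          isCode_matEnt ξ ((tensorIdx n n).symm t).2 ((tensorIdx n n).symm s).2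
  rw [Finset.sum_fin_eq_sum_range]
  refine IsCode.sum fun s hs => ?_
  rw [dif_pos hs, Finset.sum_fin_eq_sum_range]
  refine IsCode.sum fun t ht => ?_
  rw [dif_pos ht]
  exact key ⟨s, hs⟩ ⟨t, ht⟩

section Primrec

variable {α : Type*} [Primcodable α]

theorem primrec_swapNat {N a s : α → ℕ} (hN : Primrec N) (ha : Primrec a) (hs : Primrec s) :
    Primrec fun x => swapNat (N x) (a x) (s x) :=
  Primrec.nat_add.comp
    (Primrec.nat_mul.comp
      (Primrec.nat_add.comp (Primrec.nat_mul.comp (Primrec.nat_div.comp ha hN) hN)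
        (Primrec.nat_div.comp hs hN)) (Primrec.nat_mul.comp hN hN))
    (Primrec.nat_add.comp (Primrec.nat_mul.comp (Primrec.nat_mod.comp ha hN) hN)
      (Primrec.nat_mod.comp hs hN))

theorem primrec_contractCode {N k ν ξ x : α → ℕ} (hN : Primrec N) (hk : Primrec k)
    (hν : Primrec ν) (hξ : Primrec ξ) (hx : Primrec x) :
    Primrec fun y => contractCode (N y) (k y) (ν y) (ξ y) (x y) := by
  have hNN := Primrec.nat_mul.comp hN hN
  refine primrec_mkVec hNN (primrec_mkVec (hNN.comp Primrec.fst) ?_)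
  refine primrec_gMul (primrec_gFrac (Primrec.const 1) (Primrec.const 0)
    (primrec_pow (Primrec.const 2) (hk.comp (Primrec.fst.comp Primrec.fst)))) ?_
  refine primrec_gSum (hNN.comp (Primrec.fst.comp Primrec.fst))
    (primrec_gSum (hNN.comp (Primrec.fst.comp (Primrec.fst.comp Primrec.fst))) ?_)
  have p3 : Primrec fun q : (((α × ℕ) × ℕ) × ℕ) × ℕ => q.1.1 := Primrec.fst.comp Primrec.fst
  have p4 : Primrec fun q : (((α × ℕ) × ℕ) × ℕ) × ℕ => q.1.1.1.1 :=
    Primrec.fst.comp (Primrec.fst.comp p3)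
  have pa : Primrec fun q : (((α × ℕ) × ℕ) × ℕ) × ℕ => q.1.1.1.2 :=
    Primrec.snd.comp (Primrec.fst.comp p3)
  have pb : Primrec fun q : (((α × ℕ) × ℕ) × ℕ) × ℕ => q.1.1.2 := Primrec.snd.comp p3
  have ps : Primrec fun q : (((α × ℕ) × ℕ) × ℕ) × ℕ => q.1.2 := Primrec.snd.comp Primrec.fst
  have pt : Primrec fun q : (((α × ℕ) × ℕ) × ℕ) × ℕ => q.2 := Primrec.snd
  have hN' := hN.comp p4
  exact primrec_gMul (primrec_matEnt (hx.comp p4) (primrec_swapNat hN' pa ps)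
      (primrec_swapNat hN' pb pt))
    (primrec_gMul
      (primrec_matEnt (hν.comp p4) (Primrec.nat_div.comp pt hN') (Primrec.nat_div.comp ps hN'))
      (primrec_matEnt (hξ.comp p4) (Primrec.nat_mod.comp pt hN') (Primrec.nat_mod.comp ps hN')))

end Primrec

/-! ### Ensembles of elementary unit vectors -/

/-- The code nearest to an arbitrary number that is the code of a Gaussian rational. -/
def gNorm (c : ℕ) : ℕ :=
  Nat.pair (fracCode (posPart c.unpair.1.unpair.1) (negPart c.unpair.1.unpair.1)
      (max c.unpair.1.unpair.2 1))
    (fracCode (posPart c.unpair.2.unpair.1) (negPart c.unpair.2.unpair.1)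
      (max c.unpair.2.unpair.2 1))

theorem exists_isCode_gNorm (c : ℕ) : ∃ g : GaussRat, g.code = gNorm c := by
  rw [gNorm, fracCode_eq _ _ _ (by omega), fracCode_eq _ _ _ (by omega)]
  exact ⟨⟨_, _⟩, rfl⟩

theorem gNorm_code (g : GaussRat) : gNorm g.code = g.code := by
  have h (q : ℚ) : fracCode (posPart (ratCode q).unpair.1) (negPart (ratCode q).unpair.1)
      (max (ratCode q).unpair.2 1) = ratCode q := by
    rw [max_eq_left (Nat.one_le_iff_ne_zero.2 (ratCode_den_ne_zero q)),
      fracCode_eq _ _ _ (ratCode_den_ne_zero q), ← ratCode_parts]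
  rw [gNorm, GaussRat.code_eq, Nat.unpair_pair, h, h]

/-- Codes of the entries of the members of the ensemble coded by `l`. -/
def ensEnt (l i a : ℕ) : ℕ := gNorm (vecEnt (vecEnt l i) a)

/-- The code of the entry `(a, b)` of `A + N⁻¹ • 1 - 2 • S`, where `S` is the mean of the projectors
to the `2 ^ k` members of the ensemble coded by `l`. -/
def defectEnt (N ν k l a b : ℕ) : ℕ :=
  gAdd (gAdd (matEnt ν a b) (gFrac (if a = b then 1 else 0) 0 N))
    (gMul (gFrac 0 2 (2 ^ k)) (gSum (2 ^ k) fun i => gMul (ensEnt l i a) (gConj (ensEnt l i b))))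

/-- The ensemble coded by `l` consists of `2 ^ k` unit vectors, and its mean approximates `ν`. -/
def GoodEns (N ν k l : ℕ) : Prop :=
  (∀ i < 2 ^ k, gSum N (fun a => gMul (ensEnt l i a) (gConj (ensEnt l i a))) = gFrac 1 0 1) ∧
  ∀ a < N, ∀ b < N, posPart (gAdd (gMul (gFrac (N ^ 4) 0 1)
    (gMul (defectEnt N ν k l a b) (gConj (defectEnt N ν k l a b)))) (gFrac 0 1 1)).unpair.1.unpair.1
    = 0

section Primrec

variable {α : Type*} [Primcodable α]

theorem primrec_ensEnt {l i a : α → ℕ} (hl : Primrec l) (hi : Primrec i) (ha : Primrec a) :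
    Primrec fun x => ensEnt (l x) (i x) (a x) := by
  have h := primrec_vecEnt (primrec_vecEnt hl hi) ha
  have hp {f : α → ℕ} (hf : Primrec f) : Primrec fun x =>
      fracCode (posPart (f x).unpair.1) (negPart (f x).unpair.1) (max (f x).unpair.2 1) :=
    primrec_fracCode (primrec_posPart.comp (primrec_unpair_fst hf))
      (primrec_negPart.comp (primrec_unpair_fst hf))
      (Primrec.nat_max.comp (primrec_unpair_snd hf) (Primrec.const 1))
  exact Primrec₂.natPair.comp (hp (primrec_unpair_fst h)) (hp (primrec_unpair_snd h))

theorem primrec_defectEnt {N ν k l a b : α → ℕ} (hN : Primrec N) (hν : Primrec ν)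
    (hk : Primrec k) (hl : Primrec l) (ha : Primrec a) (hb : Primrec b) :
    Primrec fun x => defectEnt (N x) (ν x) (k x) (l x) (a x) (b x) := by
  have hk2 := primrec_pow (Primrec.const 2) hk
  refine primrec_gAdd (primrec_gAdd (primrec_matEnt hν ha hb) (primrec_gFrac
    (Primrec.ite (Primrec.eq.comp ha hb) (Primrec.const 1) (Primrec.const 0)) (Primrec.const 0) hN))
    (primrec_gMul (primrec_gFrac (Primrec.const 0) (Primrec.const 2) hk2) (primrec_gSum hk2 ?_))
  exact primrec_gMul (primrec_ensEnt (hl.comp Primrec.fst) Primrec.snd (ha.comp Primrec.fst))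
    (primrec_gConj (primrec_ensEnt (hl.comp Primrec.fst) Primrec.snd (hb.comp Primrec.fst)))

theorem primrecPred_forall_lt {N : α → ℕ} {p : α → ℕ → Prop} (hN : Primrec N)
    (hp : PrimrecPred fun x : α × ℕ => p x.1 x.2) : PrimrecPred fun a => ∀ i < N a, p a i := by
  have h : PrimrecRel fun (i : ℕ) (a : α) => p a i :=
    hp.comp (Primrec.pair Primrec.snd Primrec.fst)
  exact ((PrimrecRel.forall_mem_list h).comp (Primrec.list_range.comp hN) Primrec.id).of_eq
    fun a => by simp

theorem primrecPred_goodEns {N ν k l : α → ℕ} (hN : Primrec N) (hν : Primrec ν)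
    (hk : Primrec k) (hl : Primrec l) : PrimrecPred fun x => GoodEns (N x) (ν x) (k x) (l x) := by
  refine PrimrecPred.and (primrecPred_forall_lt (primrec_pow (Primrec.const 2) hk) ?_)
    (primrecPred_forall_lt hN (primrecPred_forall_lt (hN.comp Primrec.fst) ?_))
  · have h : Primrec fun x : (α × ℕ) × ℕ => ensEnt (l x.1.1) x.1.2 x.2 :=
      primrec_ensEnt (hl.comp (Primrec.fst.comp Primrec.fst)) (Primrec.snd.comp Primrec.fst)
        Primrec.snd
    exact Primrec.eq.comp (primrec_gSum (hN.comp Primrec.fst) (primrec_gMul h (primrec_gConj h)))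
      (Primrec.const _)
  · have p1 : Primrec fun x : (α × ℕ) × ℕ => x.1.1 := Primrec.fst.comp Primrec.fst
    have h : Primrec fun x : (α × ℕ) × ℕ =>
        defectEnt (N x.1.1) (ν x.1.1) (k x.1.1) (l x.1.1) x.1.2 x.2 :=
      primrec_defectEnt (hN.comp p1) (hν.comp p1) (hk.comp p1) (hl.comp p1)
        (Primrec.snd.comp Primrec.fst) Primrec.snd
    refine Primrec.eq.comp (primrec_posPart.comp (primrec_unpair_fst (primrec_unpair_fst
      (primrec_gAdd (primrec_gMul (primrec_gFrac
        (primrec_pow (hN.comp p1) (Primrec.const 4)) (Primrec.const 0) (Primrec.const 1))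
        (primrec_gMul h (primrec_gConj h))) (Primrec.const _))))) (Primrec.const 0)

end Primrec

/-- The defect of an ensemble. -/
noncomputable def defect {n k : ℕ} (ν : QMat n) (ψ : Fin (2 ^ k) → Fin (2 ^ n) → ℂ) : QMat n :=
  fun a b => ν a b + (if a = b then 1 else 0) / (2 ^ n : ℂ) -
    2 / 2 ^ k * ∑ i, ψ i a * star (ψ i b)

/-- With `N = 2 ^ n`, the bound `N² ‖D a b‖ ≤ 1` on the defect is tested in the squared form `N⁴ ‖D
a b‖² - 1 ≤ 0`, which involves rational numbers only. -/
theorem goodEns_iff {n k : ℕ} (ν : EMat n) (ψ : Fin (2 ^ k) → EVec n) (l : ℕ)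
    (hl : ∀ (i : Fin (2 ^ k)) (a : Fin (2 ^ n)), ensEnt l i a = (ψ i a).code) :
    GoodEns (2 ^ n) ν.code k l ↔ (∀ i, ∑ a, ‖(ψ i).toVec a‖ ^ 2 = 1) ∧
      ∀ a b, ((2 : ℝ) ^ n) ^ 2 * ‖defect ν.toMat (fun i => (ψ i).toVec) a b‖ ≤ 1 := by
  have hent : ∀ (i : Fin (2 ^ k)) (a : Fin (2 ^ n)), IsCode (ensEnt l i a) ((ψ i).toVec a) := fun i a => by
    rw [hl]; exact (ψ i a).isCode
  have hdef : ∀ a b : Fin (2 ^ n), IsCode (defectEnt (2 ^ n) ν.code k l a b)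
      (defect ν.toMat (fun i => (ψ i).toVec) a b) := by
    intro a b
    rw [defect, sub_eq_add_neg, ← neg_mul]
    refine ((isCode_matEnt ν a b).add ?_).add (IsCode.mul ?_ ?_)
    · have := isCode_gFrac (if (a : ℕ) = b then 1 else 0) 0 (2 ^ n) (by positivity)
      simpa [Fin.ext_iff] using this
    · have := isCode_gFrac 0 2 (2 ^ k) (by positivity)
      simpa [neg_div] using this
    · rw [Finset.sum_fin_eq_sum_range]
      refine IsCode.sum fun i hi => ?_
      rw [dif_pos hi]
      exact (hent ⟨i, hi⟩ a).mul (hent ⟨i, hi⟩ b).conj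
  have hsq : ∀ z : ℂ, z * star z = ((‖z‖ ^ 2 : ℝ) : ℂ) := fun z => by
    rw [← Complex.normSq_eq_norm_sq]; exact Complex.mul_conj z
  refine and_congr ?_ ?_
  · rw [← Fin.forall_iff (p := fun i => gSum (2 ^ n)
      (fun a => gMul (ensEnt l i a) (gConj (ensEnt l i a))) = gFrac 1 0 1)]
    refine forall_congr' fun i => ?_
    have h1 : IsCode (gSum (2 ^ n) (fun a => gMul (ensEnt l i a) (gConj (ensEnt l i a))))
        (∑ a, (ψ i).toVec a * star ((ψ i).toVec a)) := by
      rw [Finset.sum_fin_eq_sum_range]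
      refine IsCode.sum fun a ha => ?_
      rw [dif_pos ha]
      exact (hent i ⟨a, ha⟩).mul (hent i ⟨a, ha⟩).conj
    rw [h1.eq_iff (isCode_gFrac 1 0 1 one_ne_zero)]
    simp only [hsq]
    rw [← Complex.ofReal_sum]
    norm_num
    norm_cast
  · have h2 (a b : Fin (2 ^ n)) : posPart (gAdd (gMul (gFrac ((2 ^ n) ^ 4) 0 1)
        (gMul (defectEnt (2 ^ n) ν.code k l a b) (gConj (defectEnt (2 ^ n) ν.code k l a b))))
        (gFrac 0 1 1)).unpair.1.unpair.1 = 0 ↔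
        ((2 : ℝ) ^ n) ^ 2 * ‖defect ν.toMat (fun i => (ψ i).toVec) a b‖ ≤ 1 := by
      rw [(((isCode_gFrac ((2 ^ n) ^ 4) 0 1 one_ne_zero).mul ((hdef a b).mul (hdef a b).conj)).add
        (isCode_gFrac 0 1 1 one_ne_zero)).re_nonpos_iff, hsq]
      set x := ‖defect ν.toMat (fun i => (ψ i).toVec) a b‖ with hx
      have e : (((((2 ^ n) ^ 4 : ℕ) : ℂ) - (0 : ℕ)) / (1 : ℕ) * ((x ^ 2 : ℝ) : ℂ) +
          (((0 : ℕ) : ℂ) - (1 : ℕ)) / (1 : ℕ)) =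
          ((((((2 : ℝ) ^ n) ^ 2 * x) ^ 2 - 1 : ℝ)) : ℂ) := by
        push_cast; ring
      rw [e, Complex.ofReal_re, sub_nonpos, sq_le_one_iff₀ (by positivity)]
    simp only [← h2, Fin.forall_iff]

/-- Because of `gNorm` in `ensEnt`, every natural number codes some ensemble, so an unbounded search
over `ℕ` can find only genuine ones. -/
theorem exists_ens_of_code {n : ℕ} (k l : ℕ) :
    ∃ ψ : Fin (2 ^ k) → EVec n, ∀ (i : Fin (2 ^ k)) (a : Fin (2 ^ n)), ensEnt l i a = (ψ i a).code := by
  choose g hg using exists_isCode_gNorm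
  exact ⟨fun i a => g (vecEnt (vecEnt l i) a), fun i a => (hg _).symm⟩

theorem exists_code_of_ens {n k : ℕ} (ψ : Fin (2 ^ k) → EVec n) :
    ∃ l, ∀ (i : Fin (2 ^ k)) (a : Fin (2 ^ n)), ensEnt l i a = (ψ i a).code := by
  refine ⟨Encodable.encode (List.ofFn fun i => (ψ i).code), fun i a => ?_⟩
  rw [ensEnt, vecEnt_ofFn, vecEnt_code, gNorm_code]

/-- The code of the tensor product of the vector coded by `φ` with a member of an ensemble. -/
def tensorEnsCode (N φ l i : ℕ) : ℕ :=
  mkVec (N * N) fun a => gMul (vecEnt φ (a / N)) (ensEnt l i (a % N))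

/-- The tensor product of two vectors. -/
def tensorVec {n : ℕ} (v w : Fin (2 ^ n) → ℂ) : Fin (2 ^ (n + n)) → ℂ := fun a =>
  v ((tensorIdx n n).symm a).1 * w ((tensorIdx n n).symm a).2

theorem exists_tensorEnsCode {n k : ℕ} (φ : EVec n) (ψ : Fin (2 ^ k) → EVec n) (l : ℕ)
    (hl : ∀ (i : Fin (2 ^ k)) (a : Fin (2 ^ n)), ensEnt l i a = (ψ i a).code) (i : Fin (2 ^ k)) :
    ∃ v : EVec (n + n), v.code = tensorEnsCode (2 ^ n) φ.code l i ∧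
      v.toVec = tensorVec φ.toVec (ψ i).toVec := by
  have h := exists_evec (n := n + n)
    (f := fun a => gMul (vecEnt φ.code (a / 2 ^ n)) (ensEnt l i (a % 2 ^ n)))
    (z := tensorVec φ.toVec (ψ i).toVec) ?_
  · simpa only [tensorEnsCode, pow_add] using h
  intro a
  refine IsCode.mul ?_ ?_
  · simpa only [tensorIdx_symm_fst_val] using isCode_vecEnt φ ((tensorIdx n n).symm a).1
  · rw [← tensorIdx_symm_snd_val, hl]
    exact (ψ i _).isCode

theorem primrec_tensorEnsCode {α : Type*} [Primcodable α] {N φ l i : α → ℕ} (hN : Primrec N)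
    (hφ : Primrec φ) (hl : Primrec l) (hi : Primrec i) :
    Primrec fun x => tensorEnsCode (N x) (φ x) (l x) (i x) := by
  have hN' := hN.comp (Primrec.fst (α := α) (β := ℕ))
  exact primrec_mkVec (Primrec.nat_mul.comp hN hN)
    (primrec_gMul (primrec_vecEnt (hφ.comp Primrec.fst) (Primrec.nat_div.comp Primrec.snd hN'))
      (primrec_ensEnt (hl.comp Primrec.fst) (hi.comp Primrec.fst)
        (Primrec.nat_mod.comp Primrec.snd hN')))

end QInfo

/-! ### The machine model: prefix-freeness, composition, and transformation of output sequences. -/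

namespace QInfo

open Filter Topology
open scoped Kronecker ComplexOrder

/-! ### Primitive recursive operations on instructions -/

section Primrec

variable {α : Type*} [Primcodable α] {β : Type*} [Primcodable β]

theorem primrec_goto {f : α → ℕ} (hf : Primrec f) : Primrec fun a => Instr.goto (f a) :=
  (Primrec.of_equiv_symm (e := Instr.equivSum)).comp (Primrec.sumInr.comp (Primrec.sumInl.comp hf))

theorem primrec_read {f g : α → ℕ} (hf : Primrec f) (hg : Primrec g) :
    Primrec fun a => Instr.read (f a) (g a) :=
  (Primrec.of_equiv_symm (e := Instr.equivSum)).comp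
    (Primrec.sumInr.comp (Primrec.sumInr.comp (Primrec.sumInl.comp (Primrec.pair hf hg))))

theorem primrec_write {f g : α → ℕ} (hf : Primrec f) (hg : Primrec g) :
    Primrec fun a => Instr.write (f a) (g a) :=
  (Primrec.of_equiv_symm (e := Instr.equivSum)).comp
    (Primrec.sumInr.comp (Primrec.sumInr.comp (Primrec.sumInr.comp (Primrec.pair hf hg))))

theorem primrec_sum_elim {γ : Type*} [Primcodable γ] {δ : Type*} [Primcodable δ] {f : α → γ ⊕ δ}
    {g : α → γ → β} {h : α → δ → β} (hf : Primrec f) (hg : Primrec fun x : α × γ => g x.1 x.2)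
    (hh : Primrec fun x : α × δ => h x.1 x.2) : Primrec fun a => Sum.elim (g a) (h a) (f a) :=
  (Primrec.sumCasesOn hf hg hh).of_eq fun a => by cases f a <;> rfl

/-- Case analysis on an instruction. -/
def Instr.elim {β : Type*} (h : β) (g : ℕ → β) (r w : ℕ → ℕ → β) : Instr → β
  | .halt => h
  | .goto c => g c
  | .read c₀ c₁ => r c₀ c₁
  | .write x c => w x c

theorem primrec_instr_elim {i : α → Instr} {h : α → β} {g : α → ℕ → β} {r w : α → ℕ → ℕ → β}
    (hi : Primrec i) (hh : Primrec h) (hg : Primrec fun x : α × ℕ => g x.1 x.2)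
    (hr : Primrec fun x : α × (ℕ × ℕ) => r x.1 x.2.1 x.2.2)
    (hw : Primrec fun x : α × (ℕ × ℕ) => w x.1 x.2.1 x.2.2) :
    Primrec fun a => (i a).elim (h a) (g a) (r a) (w a) := by
  have he : Primrec fun a => Instr.equivSum (i a) :=
    (Primrec.of_equiv (e := Instr.equivSum)).comp hi
  refine (primrec_sum_elim (g := fun a _ => h a) (h := fun a => Sum.elim (g a)
    (Sum.elim (fun y => r a y.1 y.2) (fun y => w a y.1 y.2))) he (hh.comp Primrec.fst)
    (primrec_sum_elim Primrec.snd (hg.comp (Primrec.pair (Primrec.fst.comp Primrec.fst) Primrec.snd))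
      (primrec_sum_elim Primrec.snd ?_ ?_))).of_eq fun a => ?_
  · exact hr.comp (Primrec.pair (Primrec.fst.comp (Primrec.fst.comp Primrec.fst)) Primrec.snd)
  · exact hw.comp (Primrec.pair (Primrec.fst.comp (Primrec.fst.comp Primrec.fst)) Primrec.snd)
  · cases i a <;> rfl

end Primrec

namespace Machine

/-! ### Runs -/

/-- The configuration `s'` is reached from `s`. -/
def Reaches (M : Machine) : Config → Config → Prop :=
  Relation.ReflTransGen fun s s' => M.step s = some s'

theorem exists_run_iff_reaches {M : Machine} {y : ℕ} {p : List Bool} {s : Config} :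
    (∃ t, M.run y p t = some s) ↔ M.Reaches ⟨M.init y, p, []⟩ s := by
  constructor
  · rintro ⟨t, ht⟩
    induction t generalizing s with
    | zero =>
      rw [run, Option.some_inj] at ht
      subst ht
      exact .refl
    | succ t ih =>
      rw [run, Option.bind_eq_some_iff] at ht
      obtain ⟨s', h1, h2⟩ := ht
      exact (ih h1).tail h2
  · intro h
    induction h with
    | refl => exact ⟨0, rfl⟩
    | tail _ h ih =>
      obtain ⟨t, ht⟩ := ih
      exact ⟨t + 1, by rw [run, ht, Option.bind_some, h]⟩

theorem haltsWith_iff {M : Machine} {y : ℕ} {p rest : List Bool} {l : List ℕ} :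
    M.HaltsWith y p rest l ↔
      ∃ c, M.Reaches ⟨M.init y, p, []⟩ ⟨c, rest, l⟩ ∧ M.next c = .halt := by
  constructor
  · rintro ⟨t, ⟨c, i, o⟩, h1, h2, rfl, rfl⟩
    exact ⟨c, exists_run_iff_reaches.1 ⟨t, h1⟩, h2⟩
  · rintro ⟨c, h1, h2⟩
    obtain ⟨t, ht⟩ := exists_run_iff_reaches.2 h1
    exact ⟨t, _, ht, h2, rfl, rfl⟩

theorem outputs_iff {M : Machine} {y : ℕ} {p : List Bool} {x : ℕ} :
    M.Outputs y p x ↔ ∃ c, M.Reaches ⟨M.init y, p, []⟩ ⟨c, [], [x]⟩ ∧ M.next c = .halt :=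
  haltsWith_iff

/-- A step looks at no more than the first unread bit, so bits appended to the program do not affect
it. -/
theorem step_append {M : Machine} {s s' : Config} (h : M.step s = some s') (r : List Bool) :
    M.step ⟨s.ctrl, s.input ++ r, s.out⟩ = some ⟨s'.ctrl, s'.input ++ r, s'.out⟩ := by
  rcases s with ⟨c, i, o⟩
  unfold step at h ⊢
  rcases hn : M.next c with _ | c' | ⟨c0, c1⟩ | ⟨x, c'⟩
  all_goals simp only [hn] at h ⊢
  · cases h; rfl
  · cases h; rfl
  · rcases i with _ | ⟨b, i⟩
    · simp at h
    · cases b <;> (simp at h ⊢; subst h; simp)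
  · cases h; rfl

theorem run_append {M : Machine} {y t : ℕ} {p : List Bool} {s : Config}
    (h : M.run y p t = some s) (r : List Bool) :
    M.run y (p ++ r) t = some ⟨s.ctrl, s.input ++ r, s.out⟩ := by
  induction t generalizing s with
  | zero => rw [run, Option.some_inj] at h; subst h; rfl
  | succ t ih =>
    rw [run, Option.bind_eq_some_iff] at h
    obtain ⟨s', h1, h2⟩ := h
    rw [run, ih h1, Option.bind_some]
    exact step_append h2 r

theorem run_of_halt {M : Machine} {y t u : ℕ} {p : List Bool} {s : Config}
    (h : M.run y p t = some s) (hs : M.next s.ctrl = .halt) (htu : t ≤ u) :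
    M.run y p u = some s := by
  induction u, htu using Nat.le_induction with
  | base => exact h
  | succ u _ ih => rw [run, ih, Option.bind_some, step, hs]

/-- A halting machine on a program and on an extension of it stops in the same state. -/
theorem HaltsWith.eq_of_append {M : Machine} {y : ℕ} {p r rest rest' : List Bool} {l l' : List ℕ}
    (h : M.HaltsWith y p rest l) (h' : M.HaltsWith y (p ++ r) rest' l') :
    rest ++ r = rest' ∧ l = l' := by
  obtain ⟨t, s, h1, h2, rfl, rfl⟩ := h
  obtain ⟨t', s', h1', h2', rfl, rfl⟩ := h'
  -- Halting configurations are fixed by `step`, so the two runs can be compared at the later of the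
  -- two halting times.
  have e1 := run_of_halt (run_append h1 r) h2 (le_max_left t t')
  have e2 := run_of_halt h1' h2' (le_max_right t t')
  rw [e1, Option.some_inj] at e2
  subst e2
  exact ⟨rfl, rfl⟩

theorem Outputs.unique {M : Machine} {y x x' : ℕ} {p : List Bool} (h : M.Outputs y p x)
    (h' : M.Outputs y p x') : x = x' := by
  have := HaltsWith.eq_of_append (r := []) h (by rw [List.append_nil]; exact h')
  simpa using this.2

/-- Halting with `p` exactly consumed leaves `r` unread on the tape. Thus the programs with an
output form a prefix-free set, to which the Kraft inequality applies. -/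
theorem Outputs.eq_of_append {M : Machine} {y x x' : ℕ} {p r : List Bool} (h : M.Outputs y p x)
    (h' : M.Outputs y (p ++ r) x') : r = [] := by
  simpa using (HaltsWith.eq_of_append h h').1

/-! ### Machines with structured control configurations -/

section OfState

variable {σ : Type*} [Primcodable σ]

/-- The machine with control configurations of type `σ`. -/
def ofState (init : ℕ → σ) (next : σ → Instr) (hi : Computable init) (hn : Computable next) :
    Machine where
  init y := Encodable.encode (init y)
  next c := ((Encodable.decode c : Option σ).map next).getD .halt
  init_computable := Computable.encode.comp hi
  next_computable := Computable.option_getD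
    (Computable.option_map Computable.decode (hn.comp Computable.snd).to₂) (Computable.const _)

variable {init : ℕ → σ} {next : σ → Instr} {hi : Computable init} {hn : Computable next}

@[simp] theorem ofState_init (y : ℕ) :
    (ofState init next hi hn).init y = Encodable.encode (init y) := rfl

@[simp] theorem ofState_next (s : σ) :
    (ofState init next hi hn).next (Encodable.encode s) = next s := by
  simp [ofState]

end OfState

/-- The machine `M` with transformed auxiliary input. -/
def comap (M : Machine) (g : ℕ → ℕ) (hg : Computable g) : Machine where
  init y := M.init (g y)
  next := M.next
  init_computable := M.init_computable.comp hg
  next_computable := M.next_computable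

theorem comap_outputs {M : Machine} {g : ℕ → ℕ} {hg : Computable g} {y x : ℕ} {p : List Bool}
    (h : M.Outputs (g y) p x) : (M.comap g hg).Outputs y p x := by
  rw [outputs_iff] at h ⊢
  exact h

/-- The machine that outputs `f y` and halts. -/
def output (f : ℕ → ℕ) (hf : Primrec f) : Machine :=
  ofState (σ := Option ℕ) some
    (fun s => Option.casesOn s .halt fun y => .write (f y) (Encodable.encode (none : Option ℕ)))
    Computable.option_some
    (Primrec.option_casesOn Primrec.id (Primrec.const _)
      (primrec_write (hf.comp Primrec.snd) (Primrec.const _)).to₂).to_comp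

theorem output_outputs {f : ℕ → ℕ} {hf : Primrec f} (y : ℕ) :
    (output f hf).Outputs y [] (f y) := by
  rw [outputs_iff]
  refine ⟨Encodable.encode (none : Option ℕ), Relation.ReflTransGen.single ?_, ?_⟩
  · simp only [output, step, ofState_init, ofState_next, List.nil_append]
  · simp only [output, ofState_next]

/-- The machine that searches for a number in a decidable relation to the auxiliary input. -/
def search (R : ℕ → ℕ → Prop) [DecidableRel R] (hR : PrimrecRel R) : Machine :=
  ofState (σ := Option (ℕ × ℕ)) (fun y => some (y, 0))
    (fun s => Option.casesOn s .halt fun u => if R u.1 u.2 then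
        .write u.2 (Encodable.encode (none : Option (ℕ × ℕ)))
      else .goto (Encodable.encode (some (u.1, u.2 + 1))))
    (Primrec.option_some.comp (Primrec.pair Primrec.id (Primrec.const 0))).to_comp
    (Primrec.option_casesOn Primrec.id (Primrec.const _)
      (Primrec.ite (hR.comp (Primrec.fst.comp Primrec.snd) (Primrec.snd.comp Primrec.snd))
        (primrec_write (Primrec.snd.comp Primrec.snd) (Primrec.const _))
        (primrec_goto (Primrec.encode.comp (Primrec.option_some.comp
          (Primrec.pair (Primrec.fst.comp Primrec.snd)
            (Primrec.succ.comp (Primrec.snd.comp Primrec.snd))))))).to₂).to_comp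

/-- Trying 0, 1, 2, … finds the least witness. It depends on `y` alone and costs no program bits. -/
theorem search_outputs {R : ℕ → ℕ → Prop} [DecidableRel R] {hR : PrimrecRel R} {y : ℕ}
    (h : ∃ x, R y x) : ∃ x, R y x ∧ (search R hR).Outputs y [] x := by
  refine ⟨Nat.find h, Nat.find_spec h, ?_⟩
  rw [outputs_iff]
  refine ⟨Encodable.encode (none : Option (ℕ × ℕ)), ?_, by simp only [search, ofState_next]⟩
  have key : ∀ i ≤ Nat.find h, (search R hR).Reaches ⟨(search R hR).init y, [], []⟩
      ⟨Encodable.encode (some (y, i)), [], []⟩ := by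
    intro i hi
    induction i with
    | zero => exact .refl
    | succ i ih =>
      refine (ih (by omega)).tail ?_
      simp only [search, step, ofState_next, if_neg (Nat.find_min h (show i < _ by omega))]
  refine (key _ le_rfl).tail ?_
  simp only [search, step, ofState_next, if_pos (Nat.find_spec h), List.nil_append]

/-- The machine that reads as many bits as the auxiliary input says and outputs the number with
these binary digits. -/
def sampler : Machine :=
  ofState (σ := Option (ℕ × ℕ)) (fun y => some (y, 0))
    (fun s => Option.casesOn s .halt fun u => if u.1 = 0 then
        .write u.2 (Encodable.encode (none : Option (ℕ × ℕ)))
      else .read (Encodable.encode (some (u.1 - 1, 2 * u.2)))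
        (Encodable.encode (some (u.1 - 1, 2 * u.2 + 1))))
    (Primrec.option_some.comp (Primrec.pair Primrec.id (Primrec.const 0))).to_comp
    (Primrec.option_casesOn Primrec.id (Primrec.const _)
      (have h1 : Primrec fun x : Option (ℕ × ℕ) × (ℕ × ℕ) => x.2.1 - 1 :=
        Primrec.pred.comp (Primrec.fst.comp Primrec.snd)
      have h2 : Primrec fun x : Option (ℕ × ℕ) × (ℕ × ℕ) => 2 * x.2.2 :=
        Primrec.nat_mul.comp (Primrec.const 2) (Primrec.snd.comp Primrec.snd)
      Primrec.ite (Primrec.eq.comp (Primrec.fst.comp Primrec.snd) (Primrec.const 0))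
        (primrec_write (Primrec.snd.comp Primrec.snd) (Primrec.const _))
        (primrec_read (Primrec.encode.comp (Primrec.option_some.comp (Primrec.pair h1 h2)))
          (Primrec.encode.comp (Primrec.option_some.comp
            (Primrec.pair h1 (Primrec.succ.comp h2)))))).to₂).to_comp

theorem sampler_outputs {k i : ℕ} (h : i < 2 ^ k) :
    ∃ p : List Bool, p.length = k ∧ sampler.Outputs k p i := by
  -- The induction needs an arbitrary accumulator `acc`, the number formed by the bits read so far,
  -- the most significant first.
  suffices H : ∀ k i acc, i < 2 ^ k → ∃ p : List Bool, p.length = k ∧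
      sampler.Reaches ⟨Encodable.encode (some (k, acc)), p, []⟩
        ⟨Encodable.encode (none : Option (ℕ × ℕ)), [], [acc * 2 ^ k + i]⟩ by
    obtain ⟨p, h1, h2⟩ := H k i 0 h
    refine ⟨p, h1, outputs_iff.2 ⟨Encodable.encode (none : Option (ℕ × ℕ)), ?_, ?_⟩⟩
    · rw [zero_mul, zero_add] at h2
      exact h2
    · simp only [sampler, ofState_next]
  intro k
  induction k with
  | zero =>
    intro i acc hi
    refine ⟨[], rfl, Relation.ReflTransGen.single ?_⟩
    have : i = 0 := by simpa using hi
    simp only [sampler, step, ofState_next, if_true, List.nil_append, this]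
    simp
  | succ k ih =>
    intro i acc hi
    rcases lt_or_ge i (2 ^ k) with h | h
    · obtain ⟨p, h1, h2⟩ := ih i (2 * acc) h
      refine ⟨false :: p, by simp [h1], Relation.ReflTransGen.head
        (b := ⟨Encodable.encode (some (k, 2 * acc)), p, []⟩) ?_ (?_ : sampler.Reaches _ _)⟩
      · simp only [sampler, step, ofState_next, Nat.add_eq_zero_iff, one_ne_zero, and_false, if_false,
          Nat.add_sub_cancel]
      · rw [show acc * 2 ^ (k + 1) + i = 2 * acc * 2 ^ k + i by ring]
        exact h2
    · obtain ⟨p, h1, h2⟩ := ih (i - 2 ^ k) (2 * acc + 1) (by rw [pow_succ] at hi; omega)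
      refine ⟨true :: p, by simp [h1], Relation.ReflTransGen.head
        (b := ⟨Encodable.encode (some (k, 2 * acc + 1)), p, []⟩) ?_ (?_ : sampler.Reaches _ _)⟩
      · simp only [sampler, step, ofState_next, Nat.add_eq_zero_iff, one_ne_zero, and_false, if_false,
          Nat.add_sub_cancel]
      · rw [show acc * 2 ^ (k + 1) + i = (2 * acc + 1) * 2 ^ k + (i - 2 ^ k) by
          have : (2 * acc + 1) * 2 ^ k = acc * 2 ^ (k + 1) + 2 ^ k := by ring
          omega]
        exact h2

/-! ### Sequential composition -/

/-- The transition rule of `seq`. -/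
def seqNext (M₁ M₂ : Machine) : (ℕ × ℕ × ℕ × ℕ) ⊕ ℕ → Instr
  | .inl (y, c, k, o) => (M₁.next c).elim
      (.goto (Encodable.encode
        (.inr (M₂.init (Nat.pair y (Nat.pair o k))) : (ℕ × ℕ × ℕ × ℕ) ⊕ ℕ)))
      (fun c' => .goto (Encodable.encode (.inl (y, c', k, o) : (ℕ × ℕ × ℕ × ℕ) ⊕ ℕ)))
      (fun c₀ c₁ => .read (Encodable.encode (.inl (y, c₀, k + 1, o) : (ℕ × ℕ × ℕ × ℕ) ⊕ ℕ))
        (Encodable.encode (.inl (y, c₁, k + 1, o) : (ℕ × ℕ × ℕ × ℕ) ⊕ ℕ)))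
      (fun x c' => .goto (Encodable.encode (.inl (y, c', k, x) : (ℕ × ℕ × ℕ × ℕ) ⊕ ℕ)))
  | .inr c => (M₂.next c).elim .halt
      (fun c' => .goto (Encodable.encode (.inr c' : (ℕ × ℕ × ℕ × ℕ) ⊕ ℕ)))
      (fun c₀ c₁ => .read (Encodable.encode (.inr c₀ : (ℕ × ℕ × ℕ × ℕ) ⊕ ℕ))
        (Encodable.encode (.inr c₁ : (ℕ × ℕ × ℕ × ℕ) ⊕ ℕ)))
      (fun x c' => .write x (Encodable.encode (.inr c' : (ℕ × ℕ × ℕ × ℕ) ⊕ ℕ)))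

theorem seqNext_computable (M₁ M₂ : Machine) : Computable (seqNext M₁ M₂) := by
  have hl : ∀ {α : Type} [Primcodable α] {f : α → ℕ × ℕ × ℕ × ℕ}, Primrec f →
      Primrec fun a => Encodable.encode (.inl (f a) : (ℕ × ℕ × ℕ × ℕ) ⊕ ℕ) := fun hf =>
    Primrec.encode.comp (Primrec.sumInl.comp hf)
  have hr : ∀ {α : Type} [Primcodable α] {f : α → ℕ}, Primrec f →
      Primrec fun a => Encodable.encode (.inr (f a) : (ℕ × ℕ × ℕ × ℕ) ⊕ ℕ) := fun hf =>
    Primrec.encode.comp (Primrec.sumInr.comp hf)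
  have h1 : Primrec fun u : (ℕ × ℕ × ℕ × ℕ) × (Instr × ℕ) => u.2.1.elim
      (.goto (Encodable.encode (.inr u.2.2 : (ℕ × ℕ × ℕ × ℕ) ⊕ ℕ)))
      (fun c' => .goto (Encodable.encode
        (.inl (u.1.1, c', u.1.2.2.1, u.1.2.2.2) : (ℕ × ℕ × ℕ × ℕ) ⊕ ℕ)))
      (fun c₀ c₁ => .read
        (Encodable.encode (.inl (u.1.1, c₀, u.1.2.2.1 + 1, u.1.2.2.2) : (ℕ × ℕ × ℕ × ℕ) ⊕ ℕ))
        (Encodable.encode (.inl (u.1.1, c₁, u.1.2.2.1 + 1, u.1.2.2.2) : (ℕ × ℕ × ℕ × ℕ) ⊕ ℕ)))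
      (fun x c' => Instr.goto (Encodable.encode
        (.inl (u.1.1, c', u.1.2.2.1, x) : (ℕ × ℕ × ℕ × ℕ) ⊕ ℕ))) := by
    have e1 : ∀ {β : Type} [Primcodable β], Primrec fun u : ((ℕ × ℕ × ℕ × ℕ) × (Instr × ℕ)) × β =>
      u.1.1.1 := Primrec.fst.comp (Primrec.fst.comp Primrec.fst)
    have e3 : ∀ {β : Type} [Primcodable β], Primrec fun u : ((ℕ × ℕ × ℕ × ℕ) × (Instr × ℕ)) × β =>
      u.1.1.2.2.1 := Primrec.fst.comp (Primrec.snd.comp (Primrec.snd.comp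
        (Primrec.fst.comp Primrec.fst)))
    have e4 : ∀ {β : Type} [Primcodable β], Primrec fun u : ((ℕ × ℕ × ℕ × ℕ) × (Instr × ℕ)) × β =>
      u.1.1.2.2.2 := Primrec.snd.comp (Primrec.snd.comp (Primrec.snd.comp
        (Primrec.fst.comp Primrec.fst)))
    have d1 : Primrec fun u : ((ℕ × ℕ × ℕ × ℕ) × (Instr × ℕ)) × (ℕ × ℕ) => u.2.1 :=
      Primrec.fst.comp Primrec.snd
    have d2 : Primrec fun u : ((ℕ × ℕ × ℕ × ℕ) × (Instr × ℕ)) × (ℕ × ℕ) => u.2.2 :=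
      Primrec.snd.comp Primrec.snd
    exact primrec_instr_elim (Primrec.fst.comp Primrec.snd)
      (primrec_goto (hr (Primrec.snd.comp Primrec.snd)))
      (primrec_goto (hl (Primrec.pair e1 (Primrec.pair Primrec.snd (Primrec.pair e3 e4)))))
      (primrec_read
        (hl (Primrec.pair e1 (Primrec.pair d1 (Primrec.pair (Primrec.succ.comp e3) e4))))
        (hl (Primrec.pair e1 (Primrec.pair d2 (Primrec.pair (Primrec.succ.comp e3) e4)))))
      (primrec_goto (hl (Primrec.pair e1 (Primrec.pair d2 (Primrec.pair e3 d1)))))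
  have h2 : Primrec fun i : Instr => i.elim Instr.halt
      (fun c' => .goto (Encodable.encode (.inr c' : (ℕ × ℕ × ℕ × ℕ) ⊕ ℕ)))
      (fun c₀ c₁ => .read (Encodable.encode (.inr c₀ : (ℕ × ℕ × ℕ × ℕ) ⊕ ℕ))
        (Encodable.encode (.inr c₁ : (ℕ × ℕ × ℕ × ℕ) ⊕ ℕ)))
      (fun x c' => .write x (Encodable.encode (.inr c' : (ℕ × ℕ × ℕ × ℕ) ⊕ ℕ))) :=
    primrec_instr_elim Primrec.id (Primrec.const _) (primrec_goto (hr Primrec.snd))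
      (primrec_read (hr (Primrec.fst.comp Primrec.snd)) (hr (Primrec.snd.comp Primrec.snd)))
      (primrec_write (Primrec.fst.comp Primrec.snd) (hr (Primrec.snd.comp Primrec.snd)))
  have n1 : Computable fun u : ℕ × ℕ × ℕ × ℕ => M₁.next u.2.1 :=
    M₁.next_computable.comp (Primrec.fst.comp Primrec.snd).to_comp
  have n2 : Computable fun u : ℕ × ℕ × ℕ × ℕ => M₂.init (Nat.pair u.1 (Nat.pair u.2.2.2 u.2.2.1)) :=
    M₂.init_computable.comp (Primrec₂.natPair.comp Primrec.fst (Primrec₂.natPair.comp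
      (Primrec.snd.comp (Primrec.snd.comp Primrec.snd))
      (Primrec.fst.comp (Primrec.snd.comp Primrec.snd)))).to_comp
  refine (Computable.sumCasesOn Computable.id
    ((h1.to_comp.comp (Computable.pair Computable.id (Computable.pair n1 n2))).comp
      Computable.snd).to₂
    ((h2.to_comp.comp M₂.next_computable).comp Computable.snd).to₂).of_eq ?_
  rintro (⟨y, c, k, o⟩ | c) <;> rfl

/-- Run `M₁`, then run `M₂`, giving it as auxiliary input the auxiliary input of `M₁`, the output of
`M₁` and the number of bits read by `M₁`. -/
def seq (M₁ M₂ : Machine) : Machine :=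
  ofState (fun y => .inl (y, M₁.init y, 0, 0)) (seqNext M₁ M₂)
    (Computable.sumInl.comp (Computable.pair Computable.id (Computable.pair M₁.init_computable
      (Computable.const (0, 0))))) (seqNext_computable M₁ M₂)

/-- During the first phase nothing is written: the last object emitted by `M₁` (0 if there is none)
and the number of bits read are kept in the control. -/
theorem seq_reaches_left {M₁ M₂ : Machine} {y : ℕ} {r : List Bool} {s s' : Config}
    (h : M₁.Reaches s s') (k : ℕ) : ∃ k', k' + s'.input.length = k + s.input.length ∧
      (seq M₁ M₂).Reaches
        ⟨Encodable.encode (.inl (y, s.ctrl, k, s.out.getLastD 0) : (ℕ × ℕ × ℕ × ℕ) ⊕ ℕ),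
          s.input ++ r, []⟩
        ⟨Encodable.encode (.inl (y, s'.ctrl, k', s'.out.getLastD 0) : (ℕ × ℕ × ℕ × ℕ) ⊕ ℕ),
          s'.input ++ r, []⟩ := by
  induction h with
  | refl => exact ⟨k, rfl, .refl⟩
  | @tail s₁ s₂ _ h ih =>
    obtain ⟨k₁, hk, ih⟩ := ih
    rcases s₁ with ⟨c, i, o⟩
    unfold step at h
    rcases hn : M₁.next c with _ | c' | ⟨c0, c1⟩ | ⟨x, c'⟩
    all_goals simp only [hn] at h
    · cases h; exact ⟨k₁, hk, ih⟩
    · cases h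
      refine ⟨k₁, hk, ih.tail ?_⟩
      simp only [seq, step, ofState_next, seqNext, hn, Instr.elim]
    · rcases i with _ | ⟨b, i⟩
      · simp at h
      · cases b
        · cases h
          refine ⟨k₁ + 1, by simp only [List.length_cons] at hk ⊢; omega, ih.tail ?_⟩
          simp only [seq, step, ofState_next, seqNext, hn, Instr.elim, List.cons_append]
        · cases h
          refine ⟨k₁ + 1, by simp only [List.length_cons] at hk ⊢; omega, ih.tail ?_⟩
          simp only [seq, step, ofState_next, seqNext, hn, Instr.elim, List.cons_append]
    · cases h
      refine ⟨k₁, hk, ih.tail ?_⟩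
      simp only [seq, step, ofState_next, seqNext, hn, Instr.elim, List.getLastD_concat]

theorem seq_reaches_right {M₁ M₂ : Machine} {s s' : Config} (h : M₂.Reaches s s') :
    (seq M₁ M₂).Reaches
        ⟨Encodable.encode (.inr s.ctrl : (ℕ × ℕ × ℕ × ℕ) ⊕ ℕ), s.input, s.out⟩
        ⟨Encodable.encode (.inr s'.ctrl : (ℕ × ℕ × ℕ × ℕ) ⊕ ℕ), s'.input, s'.out⟩ := by
  induction h with
  | refl => exact .refl
  | @tail s₁ s₂ _ h ih =>
    refine ih.tail ?_
    rcases s₁ with ⟨c, i, o⟩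
    unfold step at h
    rcases hn : M₂.next c with _ | c' | ⟨c0, c1⟩ | ⟨x, c'⟩
    all_goals simp only [hn] at h
    · cases h; simp only [seq, step, ofState_next, seqNext, hn, Instr.elim]
    · cases h; simp only [seq, step, ofState_next, seqNext, hn, Instr.elim]
    · rcases i with _ | ⟨b, i⟩
      · simp at h
      · cases b <;> cases h <;> simp only [seq, step, ofState_next, seqNext, hn, Instr.elim]
    · cases h; simp only [seq, step, ofState_next, seqNext, hn, Instr.elim]

/-- The number of bits read is handed on as well. When `p₁` is a shortest program this number is a
complexity, which could not be computed from `x₁`. -/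
theorem seq_outputs {M₁ M₂ : Machine} {y x₁ x₂ : ℕ} {p₁ p₂ : List Bool}
    (h₁ : M₁.Outputs y p₁ x₁) (h₂ : M₂.Outputs (Nat.pair y (Nat.pair x₁ p₁.length)) p₂ x₂) :
    (seq M₁ M₂).Outputs y (p₁ ++ p₂) x₂ := by
  rw [outputs_iff] at h₁ h₂ ⊢
  obtain ⟨c₁, h₁, e₁⟩ := h₁
  obtain ⟨c₂, h₂, e₂⟩ := h₂
  refine ⟨Encodable.encode (.inr c₂ : (ℕ × ℕ × ℕ × ℕ) ⊕ ℕ), ?_, ?_⟩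
  · obtain ⟨k', hk, h⟩ := seq_reaches_left (M₂ := M₂) (y := y) (r := p₂) h₁ 0
    have hk' : k' = p₁.length := by simpa using hk
    subst hk'
    refine (Relation.ReflTransGen.tail h ?_).trans (seq_reaches_right h₂)
    simp only [seq, step, ofState_next, seqNext, e₁, Instr.elim, List.nil_append,
      List.getLastD_cons, List.getLastD_nil]
  · simp only [seq, ofState_next, seqNext, e₂, Instr.elim]

/-! ### Transformation of the outputs of a program -/

/-- The self-delimiting program `1ᶻ0`. -/
def unary (z : ℕ) : List Bool := List.replicate z true ++ [false]

/-- The instruction executed by `transduce` when the simulated machine reads a bit. -/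
def transduceRead (z : ℕ) (c : ℕ) (q : List Bool) (c₀ c₁ : ℕ) : Instr :=
  .goto (Encodable.encode (.inr (List.casesOn q (z, c, q)
    (fun b q' => (z, cond b c₁ c₀, q')) : ℕ × ℕ × List Bool) : ℕ ⊕ (ℕ × ℕ × List Bool)))

/-- The transition rule of `transduce`. -/
def transduceNext (U : Machine) (f : ℕ → ℕ → ℕ) (g : ℕ → List Bool) :
    ℕ ⊕ (ℕ × ℕ × List Bool) → Instr
  | .inl k => .read (Encodable.encode (.inr (k, U.init 0, g k) : ℕ ⊕ (ℕ × ℕ × List Bool)))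
      (Encodable.encode (.inl (k + 1) : ℕ ⊕ (ℕ × ℕ × List Bool)))
  | .inr (z, c, q) => (U.next c).elim .halt
      (fun c' => .goto (Encodable.encode (.inr (z, c', q) : ℕ ⊕ (ℕ × ℕ × List Bool))))
      (transduceRead z c q)
      (fun x c' => .write (f z x) (Encodable.encode (.inr (z, c', q) : ℕ ⊕ (ℕ × ℕ × List Bool))))

theorem transduceNext_computable (U : Machine) {f : ℕ → ℕ → ℕ} {g : ℕ → List Bool}
    (hf : Primrec₂ f) (hg : Primrec g) : Computable (transduceNext U f g) := by
  have hl : ∀ {α : Type} [Primcodable α] {f : α → ℕ}, Primrec f →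
      Primrec fun a => Encodable.encode (.inl (f a) : ℕ ⊕ (ℕ × ℕ × List Bool)) := fun hf =>
    Primrec.encode.comp (Primrec.sumInl.comp hf)
  have hr : ∀ {α : Type} [Primcodable α] {f : α → ℕ × ℕ × List Bool}, Primrec f →
      Primrec fun a => Encodable.encode (.inr (f a) : ℕ ⊕ (ℕ × ℕ × List Bool)) := fun hf =>
    Primrec.encode.comp (Primrec.sumInr.comp hf)
  have h1 : Primrec fun k : ℕ =>
      Instr.read (Encodable.encode (.inr (k, U.init 0, g k) : ℕ ⊕ (ℕ × ℕ × List Bool)))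
      (Encodable.encode (.inl (k + 1) : ℕ ⊕ (ℕ × ℕ × List Bool))) :=
    primrec_read (hr (Primrec.pair Primrec.id (Primrec.pair (Primrec.const _) hg)))
      (hl Primrec.succ)
  have h2 : Primrec fun u : (ℕ × ℕ × List Bool) × Instr => u.2.elim .halt
      (fun c' => .goto (Encodable.encode (.inr (u.1.1, c', u.1.2.2) : ℕ ⊕ (ℕ × ℕ × List Bool))))
      (transduceRead u.1.1 u.1.2.1 u.1.2.2)
      (fun x c' => .write (f u.1.1 x)
        (Encodable.encode (.inr (u.1.1, c', u.1.2.2) : ℕ ⊕ (ℕ × ℕ × List Bool)))) := by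
    have e1 : ∀ {β : Type} [Primcodable β], Primrec fun u : ((ℕ × ℕ × List Bool) × Instr) × β =>
      u.1.1.1 := Primrec.fst.comp (Primrec.fst.comp Primrec.fst)
    have e2 : ∀ {β : Type} [Primcodable β], Primrec fun u : ((ℕ × ℕ × List Bool) × Instr) × β =>
      u.1.1.2.1 := Primrec.fst.comp (Primrec.snd.comp (Primrec.fst.comp Primrec.fst))
    have e3 : ∀ {β : Type} [Primcodable β], Primrec fun u : ((ℕ × ℕ × List Bool) × Instr) × β =>
      u.1.1.2.2 := Primrec.snd.comp (Primrec.snd.comp (Primrec.fst.comp Primrec.fst))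
    refine primrec_instr_elim Primrec.snd (Primrec.const _)
      (primrec_goto (hr (Primrec.pair e1 (Primrec.pair Primrec.snd e3)))) ?_
      (primrec_write (hf.comp e1 (Primrec.fst.comp Primrec.snd))
        (hr (Primrec.pair e1 (Primrec.pair (Primrec.snd.comp Primrec.snd) e3))))
    have h3 : Primrec₂ fun (v : ((ℕ × ℕ × List Bool) × Instr) × (ℕ × ℕ)) (p : Bool × List Bool) =>
        (v.1.1.1, cond p.1 v.2.2 v.2.1, p.2) :=
      Primrec.pair (e1.comp Primrec.fst) (Primrec.pair (Primrec.cond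
        (Primrec.fst.comp Primrec.snd) (Primrec.snd.comp (Primrec.snd.comp Primrec.fst))
        (Primrec.fst.comp (Primrec.snd.comp Primrec.fst))) (Primrec.snd.comp Primrec.snd))
    have h4 := Primrec.list_casesOn (e3 (β := ℕ × ℕ)) (Primrec.pair e1 (Primrec.pair e2 e3)) h3
    exact primrec_goto (hr h4)
  have n1 : Computable fun u : ℕ × ℕ × List Bool => U.next u.2.1 :=
    U.next_computable.comp (Primrec.fst.comp Primrec.snd).to_comp
  refine (Computable.sumCasesOn Computable.id (h1.to_comp.comp Computable.snd).to₂
    ((h2.to_comp.comp (Computable.pair Computable.id n1)).comp Computable.snd).to₂).of_eq ?_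
  rintro (k | ⟨z, c, q⟩) <;> rfl

/-- On the program `1ᶻ0`, simulate `U` on the program `g z` and apply `f z` to its outputs. -/
def transduce (U : Machine) (f : ℕ → ℕ → ℕ) (g : ℕ → List Bool) (hf : Primrec₂ f)
    (hg : Primrec g) : Machine :=
  ofState (fun _ => .inl 0) (transduceNext U f g) (Computable.const _)
    (transduceNext_computable U hf hg)

section Transduce

variable {U : Machine} {f : ℕ → ℕ → ℕ} {g : ℕ → List Bool} {hf : Primrec₂ f} {hg : Primrec g}
  {z : ℕ}

theorem transduce_run_prefix (y : ℕ) {t : ℕ} (ht : t ≤ z) :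
    (transduce U f g hf hg).run y (unary z) t =
      some ⟨Encodable.encode (.inl t : ℕ ⊕ (ℕ × ℕ × List Bool)), unary (z - t), []⟩ := by
  induction t with
  | zero => rfl
  | succ t ih =>
    rw [run, ih (by omega), Option.bind_some, show z - t = (z - (t + 1)) + 1 by omega]
    simp only [transduce, step, ofState_next, transduceNext, unary, List.replicate_succ,
      List.cons_append]

/-- Reading `1ᶻ0` takes `z + 1` steps. From then on each step of `U` is matched by one step; the
bits of `g z` come from the control, so the tape is not touched again. -/
theorem transduce_run_suffix (y : ℕ) (t : ℕ) {s : Config} (h : U.run 0 (g z) t = some s) :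
    (transduce U f g hf hg).run y (unary z) (z + 1 + t) =
      some ⟨Encodable.encode (.inr (z, s.ctrl, s.input) : ℕ ⊕ (ℕ × ℕ × List Bool)), [],
        s.out.map (f z)⟩ := by
  induction t generalizing s with
  | zero =>
    rw [run, Option.some_inj] at h
    subst h
    rw [Nat.add_zero, run, transduce_run_prefix y le_rfl, Option.bind_some]
    simp only [transduce, step, ofState_next, transduceNext, unary, Nat.sub_self,
      List.replicate_zero, List.nil_append, List.map_nil]
  | succ t ih =>
    rw [run, Option.bind_eq_some_iff] at h
    obtain ⟨⟨c, i, o⟩, h1, h2⟩ := h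
    rw [← Nat.add_assoc, run, ih h1, Option.bind_some]
    unfold step at h2
    rcases hn : U.next c with _ | c' | ⟨c0, c1⟩ | ⟨x, c'⟩
    all_goals simp only [hn] at h2
    · cases h2
      simp only [transduce, step, ofState_next, transduceNext, hn, Instr.elim]
    · cases h2
      simp only [transduce, step, ofState_next, transduceNext, hn, Instr.elim]
    · rcases i with _ | ⟨b, i⟩
      · simp at h2
      · cases b <;> cases h2 <;>
          simp only [transduce, step, ofState_next, transduceNext, hn, Instr.elim, transduceRead,
            cond]
    · cases h2
      simp only [transduce, step, ofState_next, transduceNext, hn, Instr.elim, List.map_append,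
        List.map_cons, List.map_nil]

theorem transduce_not_overreads (y : ℕ) (h : ¬ U.Overreads 0 (g z)) :
    ¬ (transduce U f g hf hg).Overreads y (unary z) := by
  rintro ⟨t, ht⟩
  rcases le_or_gt t z with h' | h'
  · rw [transduce_run_prefix y h'] at ht
    simp at ht
  · obtain ⟨u, rfl⟩ := Nat.exists_eq_add_of_le (show z + 1 ≤ t by omega)
    rcases hu : U.run 0 (g z) u with _ | s
    · exact h ⟨u, hu⟩
    · rw [transduce_run_suffix y u hu] at ht
      simp at ht

theorem transduce_emits_iff (y : ℕ) (h : ¬ U.Overreads 0 (g z)) (l : List ℕ) :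
    (transduce U f g hf hg).Emits y (unary z) l ↔
      ∃ l₀, U.Emits 0 (g z) l₀ ∧ l = l₀.map (f z) := by
  constructor
  · rintro ⟨t, s, ht, rfl⟩
    rcases le_or_gt t z with h' | h'
    · rw [transduce_run_prefix y h', Option.some_inj] at ht
      subst ht
      -- While the prefix is being read the output is empty, as it is at time 0 of the simulated
      -- run.
      exact ⟨[], ⟨0, _, rfl, rfl⟩, rfl⟩
    · obtain ⟨u, rfl⟩ := Nat.exists_eq_add_of_le (show z + 1 ≤ t by omega)
      rcases hu : U.run 0 (g z) u with _ | s'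
      · exact absurd ⟨u, hu⟩ h
      · rw [transduce_run_suffix y u hu, Option.some_inj] at ht
        subst ht
        exact ⟨s'.out, ⟨u, s', hu, rfl⟩, rfl⟩
  · rintro ⟨_, ⟨t, s, ht, rfl⟩, rfl⟩
    exact ⟨_, _, transduce_run_suffix y t ht, rfl⟩

end Transduce

end Machine

end QInfo

/-! ### Density matrices as limits of uniform ensembles of elementary pure states. -/

namespace QInfo

open Filter Topology
open scoped Kronecker ComplexOrder

/-! ### Elementary unit vectors are dense -/

theorem sum_norm_sq_eq {ι : Type*} [Fintype ι] (v : ι → ℂ) :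
    ((∑ i, ‖v i‖ ^ 2 : ℝ) : ℂ) = ∑ i, v i * star (v i) := by
  push_cast
  refine Finset.sum_congr rfl fun i _ => ?_
  rw [← Complex.ofReal_pow, ← Complex.normSq_eq_norm_sq]
  exact (Complex.mul_conj _).symm

/-- The reflection of the basis vector `o` in the hyperplane orthogonal to `v`. -/
noncomputable def reflect {ι : Type*} [Fintype ι] [DecidableEq ι] (o : ι) (v : ι → ℂ) : ι → ℂ :=
  fun a => (if a = o then 1 else 0) - 2 * v a * star (v o) / (∑ i, ‖v i‖ ^ 2 : ℝ)

/-- Reflections are unitary. Their formula is rational in the real and imaginary parts of `v`, so it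
yields rational unit vectors without square roots. -/
theorem reflect_norm {ι : Type*} [Fintype ι] [DecidableEq ι] (o : ι) {v : ι → ℂ}
    (hv : ∑ i, ‖v i‖ ^ 2 ≠ 0) : ∑ a, ‖reflect o v a‖ ^ 2 = 1 := by
  have hS := sum_norm_sq_eq v
  set S := ∑ i, ‖v i‖ ^ 2 with hSdef
  have hS0 : (S : ℂ) ≠ 0 := by exact_mod_cast hv
  suffices h : ((∑ a, ‖reflect o v a‖ ^ 2 : ℝ) : ℂ) = 1 by exact_mod_cast h
  rw [sum_norm_sq_eq]
  have h1 : ∀ a, reflect o v a * star (reflect o v a) =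
      (if a = o then 1 - 2 * v a * star (v o) / S - 2 * star (v a) * v o / S else 0) +
        (4 * (v o * star (v o)) / S ^ 2) * (v a * star (v a)) := by
    intro a
    have : star (S : ℂ) = S := Complex.conj_ofReal S
    simp only [reflect, ← hSdef, star_sub, star_div₀, star_mul', star_star, this, star_ofNat]
    split_ifs <;> simp <;> field_simp <;> ring
  simp only [h1, Finset.sum_add_distrib, ← Finset.mul_sum, ← hS]
  rw [Finset.sum_ite_eq' Finset.univ o, if_pos (Finset.mem_univ _)]
  field_simp
  ring

/-- Write `e` for the basis vector at `o`. If `w` is a unit vector with `w o` real, the reflection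
along `e - w` takes `e` to `w`. Multiplying `u` by a phase makes its entry at `o` real without
changing its projector. -/
theorem exists_reflect_eq {ι : Type*} [Fintype ι] [DecidableEq ι] (o : ι) {u : ι → ℂ}
    (hu : ∑ i, ‖u i‖ ^ 2 = 1) : ∃ v : ι → ℂ, ∑ i, ‖v i‖ ^ 2 ≠ 0 ∧
      ∀ a b, reflect o v a * star (reflect o v b) = u a * star (u b) := by
  -- The sign in `-‖u o‖` gives `v = e - w` the squared norm `2 + 2 ‖u o‖`, so `v` is nonzero even
  -- when `u` is `e` itself.
  obtain ⟨c, hc, hco⟩ : ∃ c : ℂ, c * star c = 1 ∧ c * u o = ((-‖u o‖ : ℝ) : ℂ) := by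
    by_cases h : u o = 0
    · exact ⟨1, by simp, by simp [h]⟩
    · have hn : (‖u o‖ : ℂ) ≠ 0 := by simpa using h
      have hm : u o * star (u o) = (‖u o‖ : ℂ) ^ 2 := by
        rw [← Complex.ofReal_pow, ← Complex.normSq_eq_norm_sq]
        exact Complex.mul_conj _
      have hr : star (‖u o‖ : ℂ) = ‖u o‖ := Complex.conj_ofReal _
      refine ⟨-star (u o) / ‖u o‖, ?_, ?_⟩
      · rw [star_div₀, star_neg, star_star, hr, div_mul_div_comm, neg_mul_neg, mul_comm, hm]
        field_simp
      · rw [div_mul_eq_mul_div, neg_mul, mul_comm, hm]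
        push_cast
        field_simp
  have huc : ∑ i, u i * star (u i) = 1 := by rw [← sum_norm_sq_eq, hu]; simp
  set w : ι → ℂ := fun i => c * u i with hw
  have hwo : star (w o) = w o := by
    simp only [hw, hco]; exact Complex.conj_ofReal _
  have hww : ∀ a b, w a * star (w b) = u a * star (u b) := by
    intro a b
    simp only [hw, star_mul']
    linear_combination (u a * star (u b)) * hc
  set v : ι → ℂ := fun i => (if i = o then 1 else 0) - w i with hv
  have hS : ((∑ i, ‖v i‖ ^ 2 : ℝ) : ℂ) = 2 - 2 * w o := by
    rw [sum_norm_sq_eq]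
    have h1 : ∀ i, v i * star (v i) =
        (if i = o then 1 - w i - star (w i) else 0) + u i * star (u i) := by
      intro i
      rw [← hww]
      simp only [hv, star_sub]
      split_ifs
      · simp; ring
      · simp
    simp only [h1, Finset.sum_add_distrib, huc]
    rw [Finset.sum_ite_eq' Finset.univ o, if_pos (Finset.mem_univ _), hwo]
    ring
  have hS2 : ∑ i, ‖v i‖ ^ 2 = 2 + 2 * ‖u o‖ := by
    have h2 : ((∑ i, ‖v i‖ ^ 2 : ℝ) : ℂ) = ((2 + 2 * ‖u o‖ : ℝ) : ℂ) := by
      rw [hS]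
      simp only [hw, hco]
      push_cast
      ring
    exact_mod_cast h2
  have hne : ∑ i, ‖v i‖ ^ 2 ≠ 0 := by
    rw [hS2]
    have := norm_nonneg (u o)
    positivity
  have hrw : ∀ a, reflect o v a = w a := by
    intro a
    have hne' : ((∑ i, ‖v i‖ ^ 2 : ℝ) : ℂ) ≠ 0 := by exact_mod_cast hne
    have hvo : star (v o) = 1 - w o := by simp [hv, hwo]
    rw [reflect, hvo, sub_eq_iff_eq_add, ← sub_eq_iff_eq_add', eq_div_iff hne', hS]
    simp only [hv]
    ring
  exact ⟨v, hne, fun a b => by rw [hrw, hrw, hww]⟩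

theorem denseRange_toComplex : DenseRange GaussRat.toComplex := by
  have h : DenseRange fun p : ℚ × ℚ => Complex.equivRealProdCLM.symm ((p.1 : ℝ), (p.2 : ℝ)) :=
    Complex.equivRealProdCLM.symm.surjective.denseRange.comp
      (Rat.denseRange_cast.prodMap Rat.denseRange_cast) Complex.equivRealProdCLM.symm.continuous
  refine h.mono ?_
  rintro _ ⟨⟨p, q⟩, rfl⟩
  refine ⟨⟨p, q⟩, ?_⟩
  apply Complex.ext <;> simp [GaussRat.toComplex]

theorem denseRange_toVec (n : ℕ) : DenseRange (EVec.toVec (n := n)) :=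
  DenseRange.piMap fun _ => denseRange_toComplex

theorem exists_evec_toVec_eq {n : ℕ} {w : Fin (2 ^ n) → ℂ}
    (h : ∀ i, w i ∈ Set.range GaussRat.toComplex) : ∃ v : EVec n, v.toVec = w := by
  choose v hv using h
  exact ⟨v, funext hv⟩

theorem mem_range_toComplex_iff {z : ℂ} : z ∈ Set.range GaussRat.toComplex ↔ ∃ c, IsCode c z :=
  ⟨fun ⟨g, hg⟩ => ⟨_, g, rfl, hg⟩, fun ⟨_, g, _, hg⟩ => ⟨g, hg⟩⟩

theorem ratCast_mem_range_toComplex (q : ℚ) : (q : ℂ) ∈ Set.range GaussRat.toComplex :=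
  ⟨⟨q, 0⟩, by apply Complex.ext <;> simp [GaussRat.toComplex]⟩

theorem mul_mem_range_toComplex {z w : ℂ} (hz : z ∈ Set.range GaussRat.toComplex)
    (hw : w ∈ Set.range GaussRat.toComplex) : z * w ∈ Set.range GaussRat.toComplex := by
  rw [mem_range_toComplex_iff] at *
  obtain ⟨_, h⟩ := hz
  obtain ⟨_, h'⟩ := hw
  exact ⟨_, h.mul h'⟩

theorem add_mem_range_toComplex {z w : ℂ} (hz : z ∈ Set.range GaussRat.toComplex)
    (hw : w ∈ Set.range GaussRat.toComplex) : z + w ∈ Set.range GaussRat.toComplex := by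
  rw [mem_range_toComplex_iff] at *
  obtain ⟨_, h⟩ := hz
  obtain ⟨_, h'⟩ := hw
  exact ⟨_, h.add h'⟩

theorem star_mem_range_toComplex {z : ℂ} (hz : z ∈ Set.range GaussRat.toComplex) :
    star z ∈ Set.range GaussRat.toComplex := by
  rw [mem_range_toComplex_iff] at *
  obtain ⟨_, h⟩ := hz
  exact ⟨_, h.conj⟩

theorem exists_evec_reflect {n : ℕ} (o : Fin (2 ^ n)) (v : EVec n) :
    ∃ w : EVec n, w.toVec = reflect o v.toVec := by
  apply exists_evec_toVec_eq
  intro a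
  have hq : ∑ i, ‖v.toVec i‖ ^ 2 = ((∑ i, ((v i).re ^ 2 + (v i).im ^ 2) : ℚ) : ℝ) := by
    push_cast
    refine Finset.sum_congr rfl fun i _ => ?_
    rw [← Complex.normSq_eq_norm_sq, Complex.normSq_apply]
    simp only [EVec.toVec, GaussRat.toComplex]
    ring
  have e : reflect o v.toVec a = ((if a = o then 1 else 0 : ℚ) : ℂ) +
      ((-2 * (∑ i, ((v i).re ^ 2 + (v i).im ^ 2))⁻¹ : ℚ) : ℂ) * (v.toVec a * star (v.toVec o)) := by
    rw [reflect, hq]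
    split_ifs <;> push_cast <;> ring
  rw [e]
  exact add_mem_range_toComplex (ratCast_mem_range_toComplex _)
    (mul_mem_range_toComplex (ratCast_mem_range_toComplex _)
      (mul_mem_range_toComplex ⟨_, rfl⟩ (star_mem_range_toComplex ⟨_, rfl⟩)))

/-- Projectors to elementary unit vectors are dense among all projectors to unit vectors. -/
theorem vecMulVec_mem_closure {n : ℕ} {u : Fin (2 ^ n) → ℂ} (hu : ∑ i, ‖u i‖ ^ 2 = 1) :
    Matrix.vecMulVec u (star u) ∈ closure (Set.range fun φ : EPure n =>
      Matrix.vecMulVec φ.1.toVec (star φ.1.toVec)) := by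
  let o : Fin (2 ^ n) := ⟨0, by positivity⟩
  obtain ⟨v, hv, hvu⟩ := exists_reflect_eq o hu
  let F : (Fin (2 ^ n) → ℂ) → QMat n := fun v => Matrix.vecMulVec (reflect o v) (star (reflect o v))
  have hsum : Continuous fun v : Fin (2 ^ n) → ℂ => ∑ i, ‖v i‖ ^ 2 :=
    continuous_finsetSum _ fun i _ => by fun_prop
  -- Continuity holds only where the squared norm of `v` is nonzero. There, the density of rational
  -- vectors passes to the projectors of the reflected basis vector.
  have hF : ContinuousAt F v := by
    have hr : ContinuousAt (reflect o) v := by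
      refine continuousAt_pi.2 fun a => ?_
      refine ContinuousAt.sub continuousAt_const (ContinuousAt.div (by fun_prop) ?_ ?_)
      · exact Complex.continuous_ofReal.continuousAt.comp hsum.continuousAt
      · exact_mod_cast hv
    refine continuousAt_pi.2 fun a => continuousAt_pi.2 fun b => ?_
    exact (continuousAt_pi.1 hr a).mul (continuousAt_pi.1 hr b).star
  have hFv : F v = Matrix.vecMulVec u (star u) := by
    ext a b
    exact hvu a b
  rw [← hFv]
  have hopen : {v : Fin (2 ^ n) → ℂ | ∑ i, ‖v i‖ ^ 2 ≠ 0} ∈ 𝓝 v :=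
    (isOpen_ne_fun hsum continuous_const).mem_nhds hv
  rw [mem_closure_iff_nhds]
  intro t ht
  obtain ⟨_, ⟨φ, rfl⟩, hw1, hw2⟩ := (denseRange_toVec n).inter_nhds_nonempty
    (Filter.inter_mem (hF.preimage_mem_nhds ht) hopen)
  obtain ⟨ψ, hψ⟩ := exists_evec_reflect o φ
  refine ⟨_, hw1, ⟨ψ, ?_⟩, ?_⟩
  · rw [hψ]; exact reflect_norm o hw2
  · simp only [hψ]; rfl

/-! ### Density matrices are limits of uniform ensembles -/

/-- Mean projectors of ensembles of `2 ^ k` elementary unit vectors. -/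
def ensembleMeans (n : ℕ) : Set (QMat n) :=
  {D | ∃ (ι : Type) (_ : Fintype ι) (k : ℕ) (ψ : ι → EPure n), Fintype.card ι = 2 ^ k ∧
    D = ((2 : ℝ) ^ k)⁻¹ • ∑ i, Matrix.vecMulVec (ψ i).1.toVec (star (ψ i).1.toVec)}

/-- The index set `Fin (2 ^ l) × ι × κ` gives ensembles of different sizes a common one: inside each
block every `ψ i` is repeated `2 ^ k'` times, or every `χ i` is repeated `2 ^ k` times. -/
theorem ensembleMeans_dyadic {n : ℕ} {A B : QMat n} (hA : A ∈ ensembleMeans n)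
    (hB : B ∈ ensembleMeans n) {l m : ℕ} (hm : m ≤ 2 ^ l) :
    ((m : ℝ) / 2 ^ l) • A + (1 - (m : ℝ) / 2 ^ l) • B ∈ ensembleMeans n := by
  obtain ⟨ι, _, k, ψ, hk, rfl⟩ := hA
  obtain ⟨κ, _, k', χ, hk', rfl⟩ := hB
  refine ⟨Fin (2 ^ l) × ι × κ, inferInstance, l + (k + k'),
    fun x => if (x.1 : ℕ) < m then ψ x.2.1 else χ x.2.2, ?_, ?_⟩
  · simp [hk, hk', pow_add]
  have hc1 : (Finset.univ.filter fun x : Fin (2 ^ l) => (x : ℕ) < m).card = m := by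
    rw [Fin.card_filter_val_lt]; omega
  have hc2 : (Finset.univ.filter fun x : Fin (2 ^ l) => ¬ (x : ℕ) < m).card = 2 ^ l - m := by
    have := Finset.card_filter_add_card_filter_not (s := (Finset.univ : Finset (Fin (2 ^ l))))
      (fun x => (x : ℕ) < m)
    rw [hc1, Finset.card_univ, Fintype.card_fin] at this
    omega
  set P := ∑ i, Matrix.vecMulVec (ψ i).1.toVec (star (ψ i).1.toVec) with hP
  set Q := ∑ i, Matrix.vecMulVec (χ i).1.toVec (star (χ i).1.toVec) with hQ
  have hin : ∀ x : Fin (2 ^ l), ∑ y : ι × κ,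
      Matrix.vecMulVec (if (x : ℕ) < m then ψ y.1 else χ y.2).1.toVec
        (star (if (x : ℕ) < m then ψ y.1 else χ y.2).1.toVec) =
      if (x : ℕ) < m then (2 ^ k' : ℝ) • P else (2 ^ k : ℝ) • Q := by
    intro x
    rw [Fintype.sum_prod_type]
    split_ifs
    · simp only [Finset.sum_const, Finset.card_univ, hk']
      rw [← Finset.smul_sum, ← hP, ← Nat.cast_smul_eq_nsmul ℝ]
      norm_cast
    · simp only [Finset.sum_const, Finset.card_univ, hk, ← hQ]
      rw [← Nat.cast_smul_eq_nsmul ℝ]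
      norm_cast
  rw [Fintype.sum_prod_type]
  simp only [hin]
  rw [Finset.sum_ite, Finset.sum_const, Finset.sum_const, hc1, hc2,
    ← Nat.cast_smul_eq_nsmul ℝ, ← Nat.cast_smul_eq_nsmul ℝ, Nat.cast_sub hm]
  simp only [smul_add, smul_smul]
  congr 2
  · push_cast [pow_add]; field_simp
  · push_cast [pow_add]; field_simp

theorem convex_closure_ensembleMeans (n : ℕ) : Convex ℝ (closure (ensembleMeans n)) := by
  intro A hA B hB s t hs ht hst
  obtain rfl : t = 1 - s := by linarith
  have hs1 : s ≤ 1 := by linarith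
  have hlim : Tendsto (fun l : ℕ => ((⌊s * (2 : ℝ) ^ l⌋₊ : ℝ) / 2 ^ l)) atTop (𝓝 s) :=
    (tendsto_nat_floor_mul_div_atTop hs).comp
      (tendsto_pow_atTop_atTop_of_one_lt (one_lt_two : (1 : ℝ) < 2))
  have hlim2 : Tendsto (fun l : ℕ => ((⌊s * (2 : ℝ) ^ l⌋₊ : ℝ) / 2 ^ l) • A +
      (1 - (⌊s * (2 : ℝ) ^ l⌋₊ : ℝ) / 2 ^ l) • B) atTop (𝓝 (s • A + (1 - s) • B)) :=
    (hlim.smul_const A).add ((tendsto_const_nhds.sub hlim).smul_const B)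
  refine isClosed_closure.mem_of_tendsto hlim2 (Eventually.of_forall fun l => ?_)
  have hm : ⌊s * (2 : ℝ) ^ l⌋₊ ≤ 2 ^ l := by
    refine Nat.floor_le_of_le ?_
    push_cast
    exact mul_le_of_le_one_left (by positivity) hs1
  have hc : Continuous fun p : QMat n × QMat n =>
      ((⌊s * (2 : ℝ) ^ l⌋₊ : ℝ) / 2 ^ l) • p.1 + (1 - (⌊s * (2 : ℝ) ^ l⌋₊ : ℝ) / 2 ^ l) • p.2 :=
    by fun_prop
  exact map_mem_closure₂ (f := fun A B => ((⌊s * (2 : ℝ) ^ l⌋₊ : ℝ) / 2 ^ l) • A +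
    (1 - (⌊s * (2 : ℝ) ^ l⌋₊ : ℝ) / 2 ^ l) • B) hc hA hB
    fun a ha b hb => ensembleMeans_dyadic ha hb hm

theorem posSemidef_exists_eq {ι : Type*} [Fintype ι] [DecidableEq ι] {A : Matrix ι ι ℂ}
    (hA : A.PosSemidef) : ∃ B : Matrix ι ι ℂ, A = B.conjTranspose * B := by
  open scoped MatrixOrder in
  exact CStarAlgebra.nonneg_iff_eq_star_mul_self.mp hA.nonneg

/-- With `D = B* B`, the rows of `B` write `D` as a sum of matrices of rank at most one, and their
squared norms add up to the trace 1. Hence `D` is a convex combination of projectors, and no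
diagonalization is needed. -/
theorem density_mem_closure_ensembleMeans {n : ℕ} {D : QMat n} (hD : IsDensity D) :
    D ∈ closure (ensembleMeans n) := by
  have hpure : ∀ u : Fin (2 ^ n) → ℂ, ∑ i, ‖u i‖ ^ 2 = 1 →
      Matrix.vecMulVec u (star u) ∈ closure (ensembleMeans n) := by
    intro u hu
    refine closure_mono ?_ (vecMulVec_mem_closure hu)
    rintro _ ⟨φ, rfl⟩
    exact ⟨Unit, inferInstance, 0, fun _ => φ, by simp, by simp⟩
  obtain ⟨B, hB⟩ := posSemidef_exists_eq hD.1
  let lam : Fin (2 ^ n) → ℝ := fun j => ∑ i, ‖star (B j i)‖ ^ 2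
  have hlam : ∀ j, 0 ≤ lam j := fun j => by positivity
  let o : Fin (2 ^ n) := ⟨0, by positivity⟩
  have hex : ∀ j, ∃ P ∈ closure (ensembleMeans n),
      Matrix.vecMulVec (star (B j)) (B j) = lam j • P := by
    intro j
    rcases (hlam j).eq_or_lt with h | h
    -- A zero row has weight 0, so any projector serves.
    · refine ⟨_, hpure (Pi.single o 1) ?_, ?_⟩
      · rw [Finset.sum_eq_single o] <;> simp +contextual
      · have hz : ∀ i, B j i = 0 := by
          intro i
          have := (Finset.sum_eq_zero_iff_of_nonneg (fun i _ => by positivity)).1 h.symm i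
            (Finset.mem_univ i)
          simpa using this
        rw [← h, zero_smul]
        ext a b
        simp [Matrix.vecMulVec_apply, hz]
    · refine ⟨_, hpure (fun i => ((Real.sqrt (lam j))⁻¹ : ℝ) * star (B j i)) ?_, ?_⟩
      · simp only [norm_mul, mul_pow, ← Finset.mul_sum]
        rw [Complex.norm_real, Real.norm_eq_abs, sq_abs, inv_pow, Real.sq_sqrt h.le]
        exact inv_mul_cancel₀ h.ne'
      · ext a b
        have h2 : ((Real.sqrt (lam j))⁻¹ : ℂ) * ((Real.sqrt (lam j))⁻¹ : ℂ) = ((lam j)⁻¹ : ℂ) := by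
          rw [← mul_inv, ← Complex.ofReal_mul, Real.mul_self_sqrt h.le]
        have h3 : (lam j : ℂ) ≠ 0 := by exact_mod_cast h.ne'
        simp only [Matrix.vecMulVec_apply, Matrix.smul_apply, Pi.star_apply, star_mul', star_star,
          Complex.real_smul, Complex.ofReal_inv, star_inv₀]
        rw [show star ((Real.sqrt (lam j) : ℝ) : ℂ) = Real.sqrt (lam j) from Complex.conj_ofReal _]
        calc star (B j a) * B j b = lam j * (lam j : ℂ)⁻¹ * (star (B j a) * B j b) := by
              field_simp
          _ = _ := by rw [← h2]; ring
  choose P hP hPB using hex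
  have hsum : D = ∑ j, lam j • P j := by
    simp only [← hPB]
    ext a b
    rw [hB, Matrix.sum_apply, Matrix.mul_apply]
    rfl
  have hone : ∑ j, lam j = 1 := by
    have h1 : ((∑ j, lam j : ℝ) : ℂ) = D.trace := by
      rw [hB, Matrix.trace]
      simp only [Matrix.diag_apply, Matrix.mul_apply, Matrix.conjTranspose_apply]
      rw [Finset.sum_comm, Complex.ofReal_sum]
      refine Finset.sum_congr rfl fun j _ => ?_
      rw [sum_norm_sq_eq]
      simp
    rw [hD.2] at h1
    exact_mod_cast h1
  rw [hsum]
  exact (convex_closure_ensembleMeans n).sum_mem (fun j _ => hlam j) hone fun j _ => hP j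

/-- This equal mixture of `D` and the maximally mixed state is what the ensemble will approximate:
twice it exceeds `D` by `2⁻ⁿ 1`, a margin that absorbs the error. -/
theorem isDensity_average {n : ℕ} {D : QMat n} (hD : IsDensity D) :
    IsDensity ((1 / 2 : ℝ) • D + (1 / (2 * 2 ^ n) : ℝ) • (1 : QMat n)) := by
  constructor
  · exact (hD.1.smul (by norm_num)).add (Matrix.PosSemidef.one.smul (by positivity))
  · rw [Matrix.trace_add, Matrix.trace_smul, Matrix.trace_smul, hD.2, Matrix.trace_one]
    simp only [Complex.real_smul, Fintype.card_fin]
    push_cast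
    field_simp
    norm_num

/-- Good ensembles exist. -/
theorem exists_defect_le {n : ℕ} {ν : QMat n} (hν : IsDensity ν) :
    ∃ (k : ℕ) (ψ : Fin (2 ^ k) → EVec n), (∀ i, ∑ a, ‖(ψ i).toVec a‖ ^ 2 = 1) ∧
      ∀ a b, ((2 : ℝ) ^ n) ^ 2 * ‖defect ν (fun i => (ψ i).toVec) a b‖ ≤ 1 := by
  have h := density_mem_closure_ensembleMeans (isDensity_average hν)
  set D := (1 / 2 : ℝ) • ν + (1 / (2 * 2 ^ n) : ℝ) • (1 : QMat n) with hD
  -- The leading factor 2 is there because the defect is `-2` times the difference between the mean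
  -- and `D`.
  have hopen : {A : QMat n | ∀ a b, 2 * (((2 : ℝ) ^ n) ^ 2 * ‖A a b - D a b‖) < 1} ∈ 𝓝 D := by
    simp only [Set.ofPred_forall]
    refine (isOpen_iInter_of_finite fun a => isOpen_iInter_of_finite fun b => ?_).mem_nhds ?_
    · have : Continuous fun A : QMat n => A a b := by fun_prop
      exact isOpen_lt (by fun_prop) continuous_const
    · simp
  obtain ⟨A, hA, ι, _, k, ψ, hk, rfl⟩ := mem_closure_iff_nhds.1 h _ hopen
  let e : Fin (2 ^ k) ≃ ι := (Fintype.equivFinOfCardEq hk).symm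
  refine ⟨k, fun i => (ψ (e i)).1, fun i => (ψ (e i)).2, fun a b => ?_⟩
  have hdef : defect ν (fun i => (ψ (e i)).1.toVec) a b =
      -2 * ((((2 : ℝ) ^ k)⁻¹ • ∑ i, Matrix.vecMulVec (ψ i).1.toVec (star (ψ i).1.toVec)) a b
        - D a b) := by
    rw [defect, hD, ← e.sum_comp]
    simp only [Matrix.smul_apply, Matrix.sum_apply, Matrix.add_apply, Matrix.one_apply,
      Matrix.vecMulVec_apply, Complex.real_smul, Pi.star_apply]
    push_cast
    ring
  rw [hdef, norm_mul]
  have := hA a b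
  simp only [norm_neg, Complex.norm_ofNat]
  linarith

theorem exists_goodEns {n : ℕ} {ν : EMat n} (hν : IsDensity ν.toMat) :
    ∃ k l, GoodEns (2 ^ n) ν.code k l := by
  obtain ⟨k, ψ, h⟩ := exists_defect_le hν
  obtain ⟨l, hl⟩ := exists_code_of_ens ψ
  exact ⟨k, l, (goodEns_iff ν ψ l hl).2 h⟩

end QInfo

/-! ### Algorithmic probability as a sum over programs; the Loewner order; the universal matrix. -/

namespace QInfo

open Filter Topology
open scoped Kronecker ComplexOrder ENNReal

/-! ### Algorithmic probability -/

/-- The weight `2⁻¹ ^ ‖p‖` of a program. -/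
noncomputable def weight (p : List Bool) : ℝ≥0∞ := 2⁻¹ ^ p.length

theorem weight_append (p q : List Bool) : weight (p ++ q) = weight p * weight q := by
  simp [weight, pow_add]

theorem ofReal_half_pow (k : ℕ) : ENNReal.ofReal ((2 : ℝ)⁻¹ ^ k) = 2⁻¹ ^ k := by
  rw [ENNReal.ofReal_pow (by norm_num), ENNReal.ofReal_inv_of_pos (by norm_num)]
  norm_num

theorem toReal_weight (p : List Bool) : (weight p).toReal = (2 : ℝ)⁻¹ ^ p.length := by
  simp [weight]

theorem uniquelyDecodable_of_prefixFree {α : Type*} {S : Set (List α)} (h0 : [] ∉ S)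
    (h : ∀ p r, p ∈ S → p ++ r ∈ S → r = []) : InformationTheory.UniquelyDecodable S := by
  intro L₁
  induction L₁ with
  | nil =>
    intro L₂ _ h2 he
    rcases L₂ with _ | ⟨w, L⟩
    · rfl
    · have hw : w = [] := by
        have := congrArg List.length he
        simp at this
        exact List.eq_nil_of_length_eq_zero (by omega)
      exact absurd (hw ▸ h2 w (by simp)) h0
  | cons v L₁ ih =>
    intro L₂ h1 h2 he
    rcases L₂ with _ | ⟨w, L₂⟩
    · have hv : v = [] := by
        have := congrArg List.length he
        simp at this
        exact this.1
      exact absurd (hv ▸ h1 v (by simp)) h0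
    · have hv := h1 v (by simp)
      have hw := h2 w (by simp)
      rw [List.flatten_cons, List.flatten_cons] at he
      have hvw : v = w := by
        rcases List.append_eq_append_iff.1 he with ⟨r, rfl, _⟩ | ⟨r, rfl, _⟩
        · rw [h v r hv hw, List.append_nil]
        · rw [h w r hw hv, List.append_nil]
      subst hvw
      rw [ih L₂ (fun w hw => h1 w (by simp [hw])) (fun w hw => h2 w (by simp [hw]))
        (List.append_cancel_left he)]

/-- The **Kraft inequality** for prefix-free sets of programs. -/
theorem kraft_inequality {S : Set (List Bool)} (h : ∀ p r, p ∈ S → p ++ r ∈ S → r = []) :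
    ∑' p : S, weight p ≤ 1 := by
  rw [ENNReal.tsum_eq_iSup_sum]
  refine iSup_le fun t => ?_
  -- Unique decodability excludes the empty word. A prefix-free set that contains it has no other
  -- element, so this case is treated apart.
  by_cases h0 : [] ∈ S
  · have hS : ∀ p : S, p = ⟨[], h0⟩ := fun p => Subtype.ext (h [] p h0 (by simp))
    calc ∑ p ∈ t, weight p ≤ ∑ p ∈ {⟨[], h0⟩}, weight (p : S) :=
          Finset.sum_le_sum_of_subset fun p _ => by simp [hS p]
      _ = 1 := by simp [weight]
  · classical
    have hk := InformationTheory.kraft_mcmillan_inequality (S := t.image (Subtype.val))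
      (uniquelyDecodable_of_prefixFree (S := ((t.image Subtype.val : Finset (List Bool)) :
        Set (List Bool))) (by simp [h0]) ?_)
    · rw [Finset.sum_image (by simp)] at hk
      have e : ∑ p ∈ t, weight p = ENNReal.ofReal (∑ p ∈ t, (2 : ℝ)⁻¹ ^ (p : List Bool).length) := by
        rw [ENNReal.ofReal_sum_of_nonneg fun _ _ => by positivity]
        simp only [ofReal_half_pow, weight]
      rw [e, ← ENNReal.ofReal_one]
      exact ENNReal.ofReal_le_ofReal (by simpa using hk)
    · simp only [Finset.coe_image, Set.mem_image, Finset.mem_coe, Subtype.exists]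
      rintro p r ⟨p', hp, _, rfl⟩ ⟨p'', hp', _, h'⟩
      exact h p' r hp (h' ▸ hp')

variable {U : Machine}

open Classical in
/-- The universal probability as an extended nonnegative number. -/
noncomputable def probE (U : Machine) (x y : ℕ) : ℝ≥0∞ :=
  ∑' p : List Bool, if U.Outputs y p x then weight p else 0

/-- A sum weighted by probabilities becomes a sum over pairs of a program and its output, so that
later comparisons reduce to injections between sets of such pairs. -/
theorem tsum_probE {α : Type*} (U : Machine) (y : ℕ) (code : α → ℕ) (F : α → ℝ≥0∞) :
    ∑' a, probE U (code a) y * F a =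
      ∑' i : {i : List Bool × α | U.Outputs y i.1 (code i.2)}, weight i.1.1 * F i.1.2 := by
  classical
  rw [tsum_subtype {i : List Bool × α | U.Outputs y i.1 (code i.2)}
    (fun i => weight i.1 * F i.2), ENNReal.tsum_prod', ENNReal.tsum_comm]
  refine tsum_congr fun a => ?_
  rw [probE, ← ENNReal.tsum_mul_right]
  refine tsum_congr fun p => ?_
  simp only [Set.indicator_apply, Set.mem_ofPred_eq, ite_mul, zero_mul]

/-- A program has only one output and codes are injective, so a pair is determined by its program,
and Kraft bounds the sum of the weights. -/
theorem tsum_probE_le_one {α : Type*} (U : Machine) (y : ℕ) {code : α → ℕ}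
    (hcode : Function.Injective code) : ∑' a, probE U (code a) y ≤ 1 := by
  have h := tsum_probE U y code fun _ => 1
  simp only [mul_one] at h
  rw [h]
  let S : Set (List Bool) := {p | ∃ x, U.Outputs y p x}
  refine le_trans ?_ (kraft_inequality (S := S) ?_)
  · let f : {i : List Bool × α | U.Outputs y i.1 (code i.2)} → S := fun i => ⟨i.1.1, _, i.2⟩
    refine ENNReal.tsum_comp_le_tsum_of_injective (f := f) ?_ fun p => weight p
    rintro ⟨⟨p, a⟩, h1⟩ ⟨⟨p', a'⟩, h2⟩ he
    obtain rfl : p = p' := congrArg Subtype.val he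
    have : a = a' := hcode (Machine.Outputs.unique h1 h2)
    subst this
    rfl
  · rintro p r ⟨x, hx⟩ ⟨x', hx'⟩
    exact hx.eq_of_append hx'

theorem probE_le_one (U : Machine) (x y : ℕ) : probE U x y ≤ 1 := by
  simpa using tsum_probE_le_one U y (code := fun _ : Unit => x) (fun _ _ _ => rfl)

theorem toReal_probE (U : Machine) (x y : ℕ) : (probE U x y).toReal = m U x y := by
  classical
  rw [probE, ENNReal.tsum_toReal_eq, m]
  · refine tsum_congr fun p => ?_
    split_ifs <;> simp [toReal_weight]
  · intro p
    split_ifs <;> simp [weight]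

theorem ofReal_m (U : Machine) (x y : ℕ) : ENNReal.ofReal (m U x y) = probE U x y := by
  rw [← toReal_probE, ENNReal.ofReal_toReal (ne_top_of_le_ne_top ENNReal.one_ne_top
    (probE_le_one U x y))]

theorem m_nonneg (U : Machine) (x y : ℕ) : 0 ≤ m U x y := by
  rw [← toReal_probE]; exact ENNReal.toReal_nonneg

theorem summable_m {α : Type*} (U : Machine) (y : ℕ) {code : α → ℕ}
    (hcode : Function.Injective code) : Summable fun a => m U (code a) y := by
  simp only [← toReal_probE]
  exact ENNReal.summable_toReal (ne_top_of_le_ne_top ENNReal.one_ne_top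
    (tsum_probE_le_one U y hcode))

theorem exists_outputs_of_machine (hU : U.IsUniversal) (T : Machine) :
    ∃ r : List Bool, ∀ y p x, T.Outputs y p x → U.Outputs y (r ++ p) x := by
  obtain ⟨r, hr⟩ := hU T
  exact ⟨r, fun y p x h => ((hr y p).2.2 _ _).2 h⟩

theorem exists_outputs (hU : U.IsUniversal) (x : ℕ) : ∃ p, ∀ y, U.Outputs y p x := by
  obtain ⟨r, hr⟩ := exists_outputs_of_machine hU (Machine.output (fun _ => x) (Primrec.const x))
  exact ⟨r ++ [], fun y => hr y _ _ (Machine.output_outputs y)⟩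

theorem exists_outputs_length_eq_K (hU : U.IsUniversal) (x y : ℕ) :
    ∃ p, p.length = K U x y ∧ U.Outputs y p x := by
  obtain ⟨p, hp⟩ := exists_outputs hU x
  exact Nat.sInf_mem (s := {k | ∃ p : List Bool, p.length = k ∧ U.Outputs y p x})
    ⟨_, p, rfl, hp y⟩

theorem m_pos (hU : U.IsUniversal) (x y : ℕ) : 0 < m U x y := by
  classical
  rw [← toReal_probE]
  refine ENNReal.toReal_pos ?_ (ne_top_of_le_ne_top ENNReal.one_ne_top (probE_le_one U x y))
  obtain ⟨p, hp⟩ := exists_outputs hU x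
  have h := ENNReal.le_tsum (f := fun p => if U.Outputs y p x then weight p else 0) p
  rw [if_pos (hp y)] at h
  intro h0
  rw [probE] at h0
  rw [h0] at h
  simp [weight] at h

/-! ### Positive semidefinite matrices -/

section Matrix

variable {ι : Type*} [Fintype ι]

/-- The real part of the quadratic form of a matrix, as a function of the matrix. -/
def quadForm (x : ι → ℂ) : Matrix ι ι ℂ →+ ℝ where
  toFun A := (star x ⬝ᵥ A.mulVec x).re
  map_zero' := by simp
  map_add' A B := by simp [Matrix.add_mulVec]

theorem quadForm_apply (x : ι → ℂ) (A : Matrix ι ι ℂ) :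
    quadForm x A = (star x ⬝ᵥ A.mulVec x).re := rfl

theorem continuous_quadForm (x : ι → ℂ) : Continuous (quadForm x) := by
  change Continuous fun A : Matrix ι ι ℂ => (star x ⬝ᵥ A.mulVec x).re
  fun_prop

theorem quadForm_smul (x : ι → ℂ) (r : ℝ) (A : Matrix ι ι ℂ) :
    quadForm x (r • A) = r * quadForm x A := by
  simp [quadForm_apply, Matrix.smul_mulVec]

theorem posSemidef_of_quadForm_nonneg {A : Matrix ι ι ℂ} (hA : A.IsHermitian)
    (h : ∀ x, 0 ≤ quadForm x A) : A.PosSemidef := by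
  refine Matrix.PosSemidef.of_dotProduct_mulVec_nonneg hA fun x => ?_
  rw [Complex.nonneg_iff]
  refine ⟨h x, ?_⟩
  have := hA.im_star_dotProduct_mulVec_self x
  simpa using this.symm

theorem quadForm_nonneg {A : Matrix ι ι ℂ} (hA : A.PosSemidef) (x : ι → ℂ) :
    0 ≤ quadForm x A := hA.re_dotProduct_nonneg x

theorem quadForm_vecMulVec (x v : ι → ℂ) :
    quadForm x (Matrix.vecMulVec v (star v)) = ‖star v ⬝ᵥ x‖ ^ 2 := by
  have h : star x ⬝ᵥ (Matrix.vecMulVec v (star v)).mulVec x =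
      star (star v ⬝ᵥ x) * (star v ⬝ᵥ x) := by
    rw [Matrix.vecMulVec_mulVec, ← Matrix.star_dotProduct_star, star_star]
    simp [dotProduct_smul, mul_comm]
  rw [quadForm_apply, h, ← Complex.normSq_eq_norm_sq, mul_comm]
  have := Complex.mul_conj (star v ⬝ᵥ x)
  rw [starRingEnd_apply] at this
  rw [this, Complex.ofReal_re]

/-- The real part of the trace of a product, as a function of the first factor. -/
def traceForm (D : Matrix ι ι ℂ) : Matrix ι ι ℂ →+ ℝ where
  toFun A := (A * D).trace.re
  map_zero' := by simp
  map_add' A B := by simp [Matrix.add_mul]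

theorem traceForm_apply (D A : Matrix ι ι ℂ) : traceForm D A = (A * D).trace.re := rfl

theorem continuous_traceForm (D : Matrix ι ι ℂ) : Continuous (traceForm D) := by
  change Continuous fun A : Matrix ι ι ℂ => (A * D).trace.re
  exact Complex.continuous_re.comp ((continuous_id.matrix_mul continuous_const).matrix_trace)

theorem traceForm_smul (D : Matrix ι ι ℂ) (r : ℝ) (A : Matrix ι ι ℂ) :
    traceForm D (r • A) = r * traceForm D A := by
  simp [traceForm_apply]

/-- With `A = B* B`, the trace equals that of the positive semidefinite matrix `B D B*`. -/
theorem traceForm_nonneg [DecidableEq ι] {A D : Matrix ι ι ℂ} (hA : A.PosSemidef)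
    (hD : D.PosSemidef) : 0 ≤ traceForm D A := by
  obtain ⟨B, rfl⟩ := posSemidef_exists_eq hA
  rw [traceForm_apply, Matrix.mul_assoc, Matrix.trace_mul_comm]
  exact (Complex.nonneg_iff.1 (hD.mul_mul_conjTranspose_same B).trace_nonneg).1

theorem traceForm_mono [DecidableEq ι] {A D D' : Matrix ι ι ℂ} (hA : A.PosSemidef)
    (hD : (D' - D).PosSemidef) : traceForm D A ≤ traceForm D' A := by
  have := traceForm_nonneg hA hD
  simp only [traceForm_apply, Matrix.mul_sub, Matrix.trace_sub, Complex.sub_re] at this ⊢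
  linarith

theorem isClosed_posSemidef : IsClosed {A : Matrix ι ι ℂ | A.PosSemidef} := by
  have h : {A : Matrix ι ι ℂ | A.PosSemidef} =
      {A | A.conjTranspose = A} ∩ ⋂ x, {A | 0 ≤ quadForm x A} := by
    ext A
    simp only [Set.mem_ofPred_eq, Set.mem_inter_iff, Set.mem_iInter]
    exact ⟨fun h => ⟨h.1, fun x => h.re_dotProduct_nonneg x⟩,
      fun h => posSemidef_of_quadForm_nonneg h.1 h.2⟩
  rw [h]
  refine (isClosed_eq (by fun_prop) (by fun_prop)).inter (isClosed_iInter fun x => ?_)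
  exact isClosed_le continuous_const (continuous_quadForm x)

end Matrix

/-! ### Tensor products -/

theorem tensor_posSemidef {k n : ℕ} {A : QMat k} {B : QMat n} (hA : A.PosSemidef)
    (hB : B.PosSemidef) : (tensor A B).PosSemidef :=
  (hA.kronecker hB).submatrix _

theorem tensor_trace {k n : ℕ} (A : QMat k) (B : QMat n) :
    (tensor A B).trace = A.trace * B.trace := by
  simp only [Matrix.trace, Matrix.diag_apply]
  rw [← (tensorIdx k n).sum_comp, Fintype.sum_prod_type, Finset.sum_mul_sum]
  simp [tensor_apply']

theorem IsDensity.tensor {k n : ℕ} {A : QMat k} {B : QMat n} (hA : IsDensity A)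
    (hB : IsDensity B) : IsDensity (tensor A B) :=
  ⟨tensor_posSemidef hA.1 hB.1, by rw [tensor_trace, hA.2, hB.2, one_mul]⟩

theorem tensor_sub_left {k n : ℕ} (A A' : QMat k) (B : QMat n) :
    tensor (A - A') B = tensor A B - tensor A' B := by
  ext a b; simp [tensor_apply, sub_mul]

theorem tensor_sub_right {k n : ℕ} (A : QMat k) (B B' : QMat n) :
    tensor A (B - B') = tensor A B - tensor A B' := by
  ext a b; simp [tensor_apply, mul_sub]

theorem tensor_smul_left {k n : ℕ} (r : ℝ) (A : QMat k) (B : QMat n) :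
    tensor (r • A) B = r • tensor A B := by
  ext a b; simp [tensor_apply, mul_assoc]

theorem tensor_smul_right {k n : ℕ} (r : ℝ) (A : QMat k) (B : QMat n) :
    tensor A (r • B) = r • tensor A B := by
  ext a b; simp [tensor_apply, mul_left_comm]

/-- Tensor products are monotone in the Loewner order. -/
theorem tensor_mono {k n : ℕ} {A A' : QMat k} {B B' : QMat n} (hA' : A'.PosSemidef)
    (hB : B.PosSemidef) (h : (A' - A).PosSemidef) (h' : (B' - B).PosSemidef) :
    (tensor A' B' - tensor A B).PosSemidef := by
  have e : tensor A' B' - tensor A B = tensor A' (B' - B) + tensor (A' - A) B := by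
    rw [tensor_sub_left, tensor_sub_right]; abel
  rw [e]
  exact (tensor_posSemidef hA' h').add (tensor_posSemidef h hB)

/-- The tensor product with a fixed right factor. -/
def tensorHom {k n : ℕ} (B : QMat n) : QMat k →+ QMat (k + n) where
  toFun A := tensor A B
  map_zero' := by ext a b; simp [tensor_apply]
  map_add' A A' := by ext a b; simp [tensor_apply, add_mul]

theorem continuous_tensorHom {k n : ℕ} (B : QMat n) :
    Continuous (tensorHom (k := k) B) := by
  refine continuous_pi fun a => continuous_pi fun b => ?_
  change Continuous fun A : QMat k => A ((tensorIdx k n).symm a).1 ((tensorIdx k n).symm b).1 *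
      B ((tensorIdx k n).symm a).2 ((tensorIdx k n).symm b).2
  fun_prop

theorem tensor_vecMulVec {n : ℕ} (v w : Fin (2 ^ n) → ℂ) :
    tensor (Matrix.vecMulVec v (star v)) (Matrix.vecMulVec w (star w)) =
      Matrix.vecMulVec (tensorVec v w) (star (tensorVec v w)) := by
  ext a b
  simp only [tensor_apply, Matrix.vecMulVec_apply, tensorVec, Pi.star_apply, star_mul']
  ring

theorem tensorVec_norm {n : ℕ} {v w : Fin (2 ^ n) → ℂ} (hv : ∑ i, ‖v i‖ ^ 2 = 1)
    (hw : ∑ i, ‖w i‖ ^ 2 = 1) : ∑ i, ‖tensorVec v w i‖ ^ 2 = 1 := by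
  rw [← (tensorIdx n n).sum_comp, Fintype.sum_prod_type]
  simp only [tensorVec, Equiv.symm_apply_apply, norm_mul, mul_pow]
  rw [← Finset.sum_mul_sum, hv, hw, one_mul]

/-! ### The universal matrix -/

theorem norm_le_one_of_unit {ι : Type*} [Fintype ι] {v : ι → ℂ} (hv : ∑ i, ‖v i‖ ^ 2 = 1) (i : ι) :
    ‖v i‖ ≤ 1 := by
  have h : ‖v i‖ ^ 2 ≤ 1 := by
    rw [← hv]
    exact Finset.single_le_sum (f := fun i => ‖v i‖ ^ 2) (fun _ _ => by positivity)
      (Finset.mem_univ i)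
  exact (sq_le_one_iff₀ (norm_nonneg _)).1 h

theorem epure_code_injective (n : ℕ) : Function.Injective fun φ : EPure n => φ.1.code :=
  fun _ _ h => Subtype.ext (EVec.code_injective h)

theorem summable_muTerm (U : Machine) (n : ℕ) : Summable (muTerm U n) := by
  refine Pi.summable.2 fun a => Pi.summable.2 fun b => ?_
  refine Summable.of_norm_bounded (summable_m U n (epure_code_injective n)) fun φ => ?_
  have h1 := norm_le_one_of_unit φ.2 a
  have h2 := norm_le_one_of_unit φ.2 b
  have h3 := m_nonneg U φ.1.code n
  simp only [muTerm, Matrix.smul_apply, Matrix.vecMulVec_apply, norm_smul, norm_mul,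
    Real.norm_eq_abs, abs_of_nonneg h3, Pi.star_apply, norm_star]
  exact mul_le_of_le_one_right h3 (mul_le_one₀ h1 (norm_nonneg _) h2)

theorem muTerm_posSemidef (U : Machine) (n : ℕ) (φ : EPure n) : (muTerm U n φ).PosSemidef :=
  (Matrix.posSemidef_vecMulVec_self_star _).smul (m_nonneg U _ _)

theorem tsum_posSemidef {α ι : Type*} [Fintype ι] {f : α → Matrix ι ι ℂ}
    (h : ∀ a, (f a).PosSemidef) (hs : Summable f) : (∑' a, f a).PosSemidef := by
  refine isClosed_posSemidef.mem_of_tendsto hs.hasSum (Eventually.of_forall fun s => ?_)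
  exact Matrix.posSemidef_sum s fun a _ => h a

theorem mu_posSemidef (U : Machine) (n : ℕ) : (mu U n).PosSemidef :=
  tsum_posSemidef (muTerm_posSemidef U n) (summable_muTerm U n)

/-- A general functional `f` lets one expansion serve the quadratic forms of `μ` and of `μ ⊗ ν`, and
the trace of `μ`. -/
theorem ofReal_map_mu {n : ℕ} (U : Machine) (f : QMat n →+ ℝ) (hf : Continuous f)
    (hsmul : ∀ (r : ℝ) A, f (r • A) = r * f A)
    (hpos : ∀ v : Fin (2 ^ n) → ℂ, 0 ≤ f (Matrix.vecMulVec v (star v))) :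
    ENNReal.ofReal (f (mu U n)) = ∑' i : {i : List Bool × EPure n | U.Outputs n i.1 i.2.1.code},
      weight i.1.1 * ENNReal.ofReal (f (Matrix.vecMulVec i.1.2.1.toVec (star i.1.2.1.toVec))) := by
  have h := (summable_muTerm U n).hasSum.map f hf
  have h0 : ∀ φ, 0 ≤ f (muTerm U n φ) := fun φ => by
    rw [muTerm, hsmul]; exact mul_nonneg (m_nonneg _ _ _) (hpos _)
  rw [mu, ← h.tsum_eq, ENNReal.ofReal_tsum_of_nonneg (f := f ∘ muTerm U n) h0 h.summable]
  simp only [Function.comp_apply, muTerm, hsmul, ENNReal.ofReal_mul (m_nonneg _ _ _), ofReal_m]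
  exact tsum_probE U n (fun φ : EPure n => φ.1.code) _

end QInfo

/-! ### Domination of `μₙ ⊗ ν` by a multiple of `μ₂ₙ`. -/

namespace QInfo

open Filter Topology
open scoped Kronecker ComplexOrder ENNReal

variable {U : Machine}

/-! ### Programs for tensor products of pure states -/

/-- `GoodEns` for a dimension exponent and a matrix coded together, and an ensemble and its size
coded together. -/
def GoodEnsPair (a L : ℕ) : Prop :=
  GoodEns (2 ^ a.unpair.1) a.unpair.2 L.unpair.1 L.unpair.2

theorem primrecRel_goodEnsPair : PrimrecRel GoodEnsPair :=
  primrecPred_goodEns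
    (primrec_pow (Primrec.const 2) (primrec_unpair_fst Primrec.fst))
    (primrec_unpair_snd Primrec.fst) (primrec_unpair_fst Primrec.snd)
    (primrec_unpair_snd Primrec.snd)

theorem primrec_half {α : Type*} [Primcodable α] {f : α → ℕ} (hf : Primrec f) :
    Primrec fun a => f a / 2 := Primrec.nat_div.comp hf (Primrec.const 2)

open Classical in
/-- From programs for `φ` and `ν` and for a choice of a member of an ensemble approximating `ν`,
compute the tensor product of `φ` with this member. -/
noncomputable def tensorMachine (U : Machine) : Machine :=
  -- Each stage receives `pair y (pair o k)` from the one before: `.unpair.1` goes back one stage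
  -- and `.unpair.2.unpair.1` is the latest output. The original auxiliary input is `n + n`, hence
  -- the halving.
  .seq (U.comap (fun y => y / 2) (primrec_half Primrec.id).to_comp)
    (.seq (U.comap (fun a => a.unpair.1 / 2)
        (primrec_half (primrec_unpair_fst Primrec.id)).to_comp)
      (.seq ((Machine.search GoodEnsPair primrecRel_goodEnsPair).comap
          (fun a => Nat.pair (a.unpair.1.unpair.1 / 2) a.unpair.2.unpair.1)
          (Primrec₂.natPair.comp (primrec_half (primrec_unpair_fst (primrec_unpair_fst Primrec.id)))
            (primrec_unpair_fst (primrec_unpair_snd Primrec.id))).to_comp)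
        (.seq (Machine.sampler.comap (fun a => a.unpair.2.unpair.1.unpair.1)
            (primrec_unpair_fst (primrec_unpair_fst (primrec_unpair_snd Primrec.id))).to_comp)
          (.output (fun a => tensorEnsCode (2 ^ (a.unpair.1.unpair.1.unpair.1.unpair.1 / 2))
              a.unpair.1.unpair.1.unpair.1.unpair.2.unpair.1
              a.unpair.1.unpair.2.unpair.1.unpair.2 a.unpair.2.unpair.1)
            (have h := primrec_unpair_fst (primrec_unpair_fst (primrec_unpair_fst Primrec.id))
            primrec_tensorEnsCode
              (primrec_pow (Primrec.const 2) (primrec_half (primrec_unpair_fst h)))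
              (primrec_unpair_fst (primrec_unpair_snd h))
              (primrec_unpair_snd (primrec_unpair_fst
                (primrec_unpair_snd (primrec_unpair_fst Primrec.id))))
              (primrec_unpair_fst (primrec_unpair_snd Primrec.id)))))))

/-- Every elementary density matrix `ν` is approximated by an ensemble such that the tensor products
of an elementary vector `φ` with its members have short programs, relative to programs for `φ` and
`ν`. -/
theorem exists_tensor_programs (hU : U.IsUniversal) :
    ∃ r : List Bool, ∀ (n : ℕ) (ν : EMat n), IsDensity ν.toMat →
      ∃ (k : ℕ) (ψ : Fin (2 ^ k) → EVec n) (bits : Fin (2 ^ k) → List Bool),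
        (∀ i, ∑ a, ‖(ψ i).toVec a‖ ^ 2 = 1) ∧
        (∀ a b, ((2 : ℝ) ^ n) ^ 2 * ‖defect ν.toMat (fun i => (ψ i).toVec) a b‖ ≤ 1) ∧
        (∀ i, (bits i).length = k) ∧ Function.Injective bits ∧
        ∀ (φ : EVec n) (p q : List Bool) (i : Fin (2 ^ k)), U.Outputs n p φ.code →
          U.Outputs n q ν.code → ∃ v : EVec (n + n), v.toVec = tensorVec φ.toVec (ψ i).toVec ∧
            U.Outputs (n + n) (r ++ (p ++ (q ++ bits i))) v.code := by
  classical
  obtain ⟨r, hr⟩ := exists_outputs_of_machine hU (tensorMachine U)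
  refine ⟨r, fun n ν hν => ?_⟩
  have hex : ∃ L, GoodEnsPair (Nat.pair n ν.code) L := by
    obtain ⟨k, l, h⟩ := exists_goodEns hν
    exact ⟨Nat.pair k l, by simpa [GoodEnsPair] using h⟩
  -- `L` is chosen from `n` and `ν` only, so one ensemble serves all `φ` and all programs.
  obtain ⟨L, hL, hsearch⟩ := Machine.search_outputs (hR := primrecRel_goodEnsPair) hex
  obtain ⟨ψ, hψ⟩ := exists_ens_of_code (n := n) L.unpair.1 L.unpair.2
  simp only [GoodEnsPair, Nat.unpair_pair] at hL
  obtain ⟨h1, h2⟩ := (goodEns_iff ν ψ _ hψ).1 hL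
  choose bits hlen hbits using fun i : Fin (2 ^ L.unpair.1) => Machine.sampler_outputs i.2
  refine ⟨L.unpair.1, ψ, bits, h1, h2, hlen, ?_, fun φ p q i hp hq => ?_⟩
  · intro i j hij
    have hj := hbits j
    rw [← hij] at hj
    exact Fin.ext ((hbits i).unique hj)
  · obtain ⟨v, hv, hv'⟩ := exists_tensorEnsCode φ ψ L.unpair.2 hψ i
    refine ⟨v, hv', hr _ _ _ ?_⟩
    have hn : (n + n) / 2 = n := by omega
    -- The search and the final output read no bits; they account for the empty programs.
    have e : p ++ (q ++ bits i) = p ++ (q ++ ([] ++ (bits i ++ []))) := by simp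
    rw [e, tensorMachine]
    refine Machine.seq_outputs (x₁ := φ.code) (Machine.comap_outputs (by rwa [hn]))
      (Machine.seq_outputs (x₁ := ν.code) (Machine.comap_outputs ?_)
        (Machine.seq_outputs (x₁ := L) (Machine.comap_outputs ?_)
          (Machine.seq_outputs (x₁ := i) (Machine.comap_outputs ?_) ?_)))
    · simpa [hn] using hq
    · simpa [hn] using hsearch
    · simpa using hbits i
    · rw [hv]
      convert Machine.output_outputs _ using 1
      simp [hn]

/-! ### The universal matrix dominates tensor products -/

/-- With `N = 2 ^ n`, entries of modulus at most `N⁻²` bound the form by `N⁻² (∑ ‖x a‖)²`, and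
Cauchy–Schwarz bounds this by `N⁻¹ ∑ ‖x a‖²`. -/
theorem defect_quadForm_le {n : ℕ} {D : QMat n}
    (h : ∀ a b, ((2 : ℝ) ^ n) ^ 2 * ‖D a b‖ ≤ 1) (x : Fin (2 ^ n) → ℂ) :
    quadForm x D ≤ (∑ i, ‖x i‖ ^ 2) / 2 ^ n := by
  have hN : (0 : ℝ) < 2 ^ n := by positivity
  have h1 : quadForm x D ≤ ∑ a, ∑ b, ‖x a‖ * (‖D a b‖ * ‖x b‖) := by
    rw [quadForm_apply]
    refine (Complex.re_le_norm _).trans ?_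
    simp only [dotProduct, Matrix.mulVec, Finset.mul_sum]
    refine (norm_sum_le _ _).trans (Finset.sum_le_sum fun a _ => (norm_sum_le _ _).trans
      (Finset.sum_le_sum fun b _ => ?_))
    simp
  have h2 : ∀ a b, ‖x a‖ * (‖D a b‖ * ‖x b‖) ≤ (((2 : ℝ) ^ n) ^ 2)⁻¹ * (‖x a‖ * ‖x b‖) := by
    intro a b
    have : ‖D a b‖ ≤ (((2 : ℝ) ^ n) ^ 2)⁻¹ := by
      rw [← one_div, le_div_iff₀ (by positivity), mul_comm]
      exact h a b
    calc ‖x a‖ * (‖D a b‖ * ‖x b‖) = ‖D a b‖ * (‖x a‖ * ‖x b‖) := by ring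
      _ ≤ _ := mul_le_mul_of_nonneg_right this (by positivity)
  have h3 : (∑ a, ‖x a‖) ^ 2 ≤ 2 ^ n * ∑ a, ‖x a‖ ^ 2 := by
    have := sq_sum_le_card_mul_sum_sq (s := Finset.univ) (f := fun a => ‖x a‖)
    simpa using this
  calc quadForm x D ≤ ∑ a, ∑ b, (((2 : ℝ) ^ n) ^ 2)⁻¹ * (‖x a‖ * ‖x b‖) :=
        h1.trans (Finset.sum_le_sum fun a _ => Finset.sum_le_sum fun b _ => h2 a b)
    _ = (((2 : ℝ) ^ n) ^ 2)⁻¹ * (∑ a, ‖x a‖) ^ 2 := by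
        simp only [← Finset.mul_sum, sq, Finset.sum_mul]
    _ ≤ (((2 : ℝ) ^ n) ^ 2)⁻¹ * (2 ^ n * ∑ a, ‖x a‖ ^ 2) :=
        mul_le_mul_of_nonneg_left h3 (by positivity)
    _ = _ := by field_simp

theorem quadForm_one {ι : Type*} [Fintype ι] [DecidableEq ι] (x : ι → ℂ) :
    quadForm x (1 : Matrix ι ι ℂ) = ∑ i, ‖x i‖ ^ 2 := by
  rw [quadForm_apply, Matrix.one_mulVec, dotProduct_comm]
  have := sum_norm_sq_eq x
  rw [dotProduct]
  simp only [Pi.star_apply]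
  rw [← this, Complex.ofReal_re]

/-- A matrix is dominated by an approximating ensemble. -/
theorem ensemble_sub_posSemidef {n k : ℕ} {ν : QMat n} (hν : ν.PosSemidef)
    {ψ : Fin (2 ^ k) → Fin (2 ^ n) → ℂ}
    (h : ∀ a b, ((2 : ℝ) ^ n) ^ 2 * ‖defect ν ψ a b‖ ≤ 1) :
    (((2 : ℝ) / 2 ^ k) • ∑ i, Matrix.vecMulVec (ψ i) (star (ψ i)) - ν).PosSemidef := by
  set E := ((2 : ℝ) / 2 ^ k) • ∑ i, Matrix.vecMulVec (ψ i) (star (ψ i)) - ν with hE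
  have hS : (((2 : ℝ) / 2 ^ k) • ∑ i, Matrix.vecMulVec (ψ i) (star (ψ i))).PosSemidef :=
    (Matrix.posSemidef_sum _ fun i _ => Matrix.posSemidef_vecMulVec_self_star _).smul
      (by positivity)
  -- The defect is at most `2⁻ⁿ 1` in the Loewner order, so this identity leaves `E ≥ 0`.
  have hdef : E + defect ν ψ = ((2 : ℝ) ^ n)⁻¹ • (1 : QMat n) := by
    ext a b
    simp only [hE, defect, Matrix.add_apply, Matrix.sub_apply, Matrix.smul_apply, Matrix.sum_apply,
      Matrix.vecMulVec_apply, Matrix.one_apply, Complex.real_smul, Pi.star_apply]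
    push_cast
    ring
  refine posSemidef_of_quadForm_nonneg (hS.1.sub hν.1) fun x => ?_
  have h1 := defect_quadForm_le h x
  have h2 := congrArg (quadForm x) hdef
  rw [map_add, quadForm_smul, quadForm_one] at h2
  have : (∑ i, ‖x i‖ ^ 2) / 2 ^ n = ((2 : ℝ) ^ n)⁻¹ * ∑ i, ‖x i‖ ^ 2 := by ring
  linarith

/-- A program `p` for `φ` gives rise to `2 ^ k` programs for the vectors `φ ⊗ ψ i`, each of weight
`2 ^ (-k - K(ν/n) - O(1))` times that of `p`. Together they contribute the mean of the ensemble,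
which dominates `ν / 2`. -/
theorem exists_mu_dominates (hU : U.IsUniversal) :
    ∃ c : ℕ, ∀ (n : ℕ) (ν : EMat n), IsDensity ν.toMat →
      ((2 : ℝ) ^ (K U ν.code n + c) • mu U (n + n) - tensor (mu U n) ν.toMat).PosSemidef := by
  obtain ⟨r, hr⟩ := exists_tensor_programs hU
  -- `r.length` pays for the simulation by `U`, and 1 for the factor 2 by which the mean must be
  -- multiplied to dominate `ν`.
  refine ⟨r.length + 1, fun n ν hν => ?_⟩
  obtain ⟨k, ψ, bits, hunit, hdef, hlen, hinj, hprog⟩ := hr n ν hν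
  obtain ⟨q, hq, hqν⟩ := exists_outputs_length_eq_K hU ν.code n
  have hmu := mu_posSemidef U n
  have hmu2 := mu_posSemidef U (n + n)
  refine posSemidef_of_quadForm_nonneg
    ((hmu2.smul (show (0 : ℝ) ≤ _ by positivity)).1.sub (tensor_posSemidef hmu hν.1).1) fun x => ?_
  rw [map_sub, quadForm_smul, sub_nonneg]
  -- one term
  have hterm : ∀ φ : Fin (2 ^ n) → ℂ, quadForm x (tensor (Matrix.vecMulVec φ (star φ)) ν.toMat) ≤
      2 / 2 ^ k * ∑ i, ‖star (tensorVec φ (ψ i).toVec) ⬝ᵥ x‖ ^ 2 := by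
    intro φ
    have h1 := quadForm_nonneg (tensor_posSemidef (Matrix.posSemidef_vecMulVec_self_star φ)
      (ensemble_sub_posSemidef hν.1 hdef)) x
    have h2 : tensor (Matrix.vecMulVec φ (star φ))
        (∑ i, Matrix.vecMulVec (ψ i).toVec (star (ψ i).toVec)) =
        ∑ i, Matrix.vecMulVec (tensorVec φ (ψ i).toVec) (star (tensorVec φ (ψ i).toVec)) := by
      simp only [← tensor_vecMulVec]
      ext a b
      simp only [tensor_apply, Matrix.sum_apply, Finset.mul_sum]
    rw [tensor_sub_right, map_sub, sub_nonneg, tensor_smul_right, quadForm_smul, h2, map_sum] at h1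
    simpa only [quadForm_vecMulVec] using h1
  rw [← ENNReal.ofReal_le_ofReal_iff (by have := quadForm_nonneg hmu2 x; positivity),
    ENNReal.ofReal_mul (by positivity)]
  have e1 := ofReal_map_mu U ((quadForm x).comp (tensorHom ν.toMat))
    ((continuous_quadForm x).comp (continuous_tensorHom _))
    (fun s A => by
      change quadForm x (tensor (s • A) _) = s * quadForm x (tensor A _)
      rw [tensor_smul_left, quadForm_smul])
    (fun v => quadForm_nonneg (tensor_posSemidef (Matrix.posSemidef_vecMulVec_self_star v) hν.1) x)
  have e2 := ofReal_map_mu U (quadForm x) (continuous_quadForm x) (quadForm_smul x)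
    (fun v => quadForm_nonneg (Matrix.posSemidef_vecMulVec_self_star v) x)
  change ENNReal.ofReal (quadForm x (tensor (mu U n) ν.toMat)) = _ at e1
  rw [e1, e2, ← ENNReal.tsum_mul_left]
  let I := {i : List Bool × EPure n | U.Outputs n i.1 i.2.1.code}
  let J := {i : List Bool × EPure (n + n) | U.Outputs (n + n) i.1 i.2.1.code}
  choose v hv hvout using fun (i : I) (j : Fin (2 ^ k)) => hprog i.1.2.1 i.1.1 q j i.2 hqν
  have hvunit : ∀ i j, ∑ a, ‖(v i j).toVec a‖ ^ 2 = 1 := fun i j => by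
    rw [hv]; exact tensorVec_norm i.1.2.2 (hunit j)
  let F : I × Fin (2 ^ k) → J := fun ij =>
    ⟨(r ++ (ij.1.1.1 ++ (q ++ bits ij.2)), ⟨v ij.1 ij.2, hvunit _ _⟩), hvout ij.1 ij.2⟩
  -- The strings `bits j` all have length `k`, so the end of the program can be split off; then `p`
  -- is determined, and `p` determines `φ`.
  have hF : Function.Injective F := by
    rintro ⟨⟨⟨p, φ⟩, hp⟩, j⟩ ⟨⟨⟨p', φ'⟩, hp'⟩, j'⟩ h
    have h' : r ++ (p ++ (q ++ bits j)) = r ++ (p' ++ (q ++ bits j')) :=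
      congrArg (fun z : J => z.1.1) h
    have h'' := List.append_cancel_left h'
    obtain ⟨rfl, h3⟩ := List.append_inj' h'' (by simp [hlen])
    obtain rfl := hinj (List.append_cancel_left h3)
    obtain rfl : φ = φ' := epure_code_injective n (Machine.Outputs.unique hp hp')
    rfl
  have hle := ENNReal.tsum_comp_le_tsum_of_injective hF fun j : J =>
    ENNReal.ofReal ((2 : ℝ) ^ (K U ν.code n + (r.length + 1))) * (weight j.1.1 *
      ENNReal.ofReal (quadForm x (Matrix.vecMulVec j.1.2.1.toVec (star j.1.2.1.toVec))))
  refine le_trans ?_ hle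
  rw [ENNReal.tsum_prod']
  refine ENNReal.tsum_le_tsum fun i => ?_
  rw [tsum_fintype]
  have hw : ∀ j, ENNReal.ofReal ((2 : ℝ) ^ (K U ν.code n + (r.length + 1))) *
      weight (F (i, j)).1.1 = weight i.1.1 * ENNReal.ofReal (2 / 2 ^ k) := by
    intro j
    change _ * weight (r ++ (i.1.1 ++ (q ++ bits j))) = _
    rw [weight_append, weight_append, weight_append, mul_left_comm (weight r), mul_left_comm]
    congr 1
    simp only [weight, hlen, hq, ← ofReal_half_pow]
    rw [← ENNReal.ofReal_mul (by positivity), ← ENNReal.ofReal_mul (by positivity),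
      ← ENNReal.ofReal_mul (by positivity)]
    congr 1
    simp only [inv_pow, pow_add, pow_one]
    field_simp
  simp only [← mul_assoc, hw]
  rw [← Finset.mul_sum, mul_assoc, ← ENNReal.ofReal_sum_of_nonneg, ← ENNReal.ofReal_mul]
  · refine mul_le_mul_right (ENNReal.ofReal_le_ofReal ?_) _
    refine (hterm i.1.2.1.toVec).trans_eq ?_
    congr 1
    refine Finset.sum_congr rfl fun j _ => ?_
    rw [quadForm_vecMulVec]
    change _ = ‖star (v i j).toVec ⬝ᵥ x‖ ^ 2
    rw [hv]
  · positivity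
  · exact fun j _ => quadForm_nonneg (Matrix.posSemidef_vecMulVec_self_star _) x

end QInfo

/-! ### Contraction of tests: positivity, product form, and programs. -/

namespace QInfo

open Filter Topology
open scoped Kronecker ComplexOrder ENNReal

variable {U : Machine}

/-! ### Partial traces -/

theorem swapIdx_apply {n : ℕ} (a₁ a₂ s₁ s₂ : Fin (2 ^ n)) :
    swapIdx n (tensorIdx n n (a₁, a₂), tensorIdx n n (s₁, s₂)) =
      tensorIdx (n + n) (n + n) (tensorIdx n n (a₁, s₁), tensorIdx n n (a₂, s₂)) := by
  simp [swapIdx]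

/-- The tensor product of matrices on factors 1, 3 and on factors 2, 4. -/
def swapTensor {n : ℕ} (T W : QMat (n + n)) : QMat ((n + n) + (n + n)) :=
  (T ⊗ₖ W).submatrix (swapIdx n).symm (swapIdx n).symm

theorem swapTensor_apply {n : ℕ} (T W : QMat (n + n)) (a b s t : Fin (2 ^ (n + n))) :
    swapTensor T W (swapIdx n (a, s)) (swapIdx n (b, t)) = T a b * W s t := by
  simp [swapTensor]

theorem swapTensor_posSemidef {n : ℕ} {T W : QMat (n + n)} (hT : T.PosSemidef)
    (hW : W.PosSemidef) : (swapTensor T W).PosSemidef := (hT.kronecker hW).submatrix _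

theorem swapTensor_tensor {n : ℕ} (σ ρ ν ξ : QMat n) :
    swapTensor (tensor σ ρ) (tensor ν ξ) = tensor (tensor σ ν) (tensor ρ ξ) := by
  ext u w
  obtain ⟨⟨a, s⟩, rfl⟩ := (swapIdx n).surjective u
  obtain ⟨⟨b, t⟩, rfl⟩ := (swapIdx n).surjective w
  rw [swapTensor_apply]
  obtain ⟨⟨a₁, a₂⟩, rfl⟩ := (tensorIdx n n).surjective a
  obtain ⟨⟨b₁, b₂⟩, rfl⟩ := (tensorIdx n n).surjective b
  obtain ⟨⟨s₁, s₂⟩, rfl⟩ := (tensorIdx n n).surjective s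
  obtain ⟨⟨t₁, t₂⟩, rfl⟩ := (tensorIdx n n).surjective t
  simp only [swapIdx_apply, tensor_apply']
  ring

/-- Contraction is adjoint to inserting `ν` and `ξ` into the second and fourth factors. Positivity,
the test condition and the conserved quantity are all read off from this identity. -/
theorem trace_contract_mul {n : ℕ} (ν ξ : QMat n) (X : QMat ((n + n) + (n + n)))
    (T : QMat (n + n)) :
    (contract ν ξ X * T).trace = (X * swapTensor T (tensor ν ξ)).trace := by
  simp only [Matrix.trace, Matrix.diag_apply, Matrix.mul_apply]
  rw [← (swapIdx n).sum_comp, Fintype.sum_prod_type]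
  refine Finset.sum_congr rfl fun a _ => ?_
  have h : ∀ s, ∑ w, X (swapIdx n (a, s)) w * swapTensor T (tensor ν ξ) w (swapIdx n (a, s)) =
      ∑ b, ∑ t, X (swapIdx n (a, s)) (swapIdx n (b, t)) * (T b a * tensor ν ξ t s) := by
    intro s
    rw [← (swapIdx n).sum_comp, Fintype.sum_prod_type]
    simp only [swapTensor_apply]
  simp only [h]
  rw [Finset.sum_comm]
  refine Finset.sum_congr rfl fun b _ => ?_
  rw [contract, Finset.sum_mul]
  refine Finset.sum_congr rfl fun s _ => ?_
  rw [Finset.sum_mul]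
  exact Finset.sum_congr rfl fun t _ => by ring

/-- The trace against `ν` takes place inside `A` and that against `ξ` inside `B`, so the product
form required of tests survives. -/
theorem contract_tensor {n : ℕ} (ν ξ : QMat n) (A B : QMat (n + n)) :
    ∃ A' B' : QMat n, contract ν ξ (tensor A B) = tensor A' B' := by
  let A' : QMat n := fun i j => ∑ s, ∑ t, A (tensorIdx n n (i, s)) (tensorIdx n n (j, t)) * ν t s
  let B' : QMat n := fun i j => ∑ s, ∑ t, B (tensorIdx n n (i, s)) (tensorIdx n n (j, t)) * ξ t s
  refine ⟨A', B', ?_⟩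
  ext a b
  obtain ⟨⟨a₁, a₂⟩, rfl⟩ := (tensorIdx n n).surjective a
  obtain ⟨⟨b₁, b₂⟩, rfl⟩ := (tensorIdx n n).surjective b
  refine Eq.trans ?_ (tensor_apply' A' B' _ _ _ _).symm
  change ∑ s, ∑ t, _ = (∑ s, ∑ t, _) * ∑ s, ∑ t, _
  rw [← (tensorIdx n n).sum_comp, Fintype.sum_prod_type, Finset.sum_mul_sum]
  refine Finset.sum_congr rfl fun s₁ _ => Finset.sum_congr rfl fun s₂ _ => ?_
  rw [← (tensorIdx n n).sum_comp, Fintype.sum_prod_type, Finset.sum_mul_sum]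
  refine Finset.sum_congr rfl fun t₁ _ => Finset.sum_congr rfl fun t₂ _ => ?_
  rw [swapIdx_apply, swapIdx_apply, tensor_apply', tensor_apply']
  ring

theorem contract_sub {n : ℕ} (ν ξ : QMat n) (X Y : QMat ((n + n) + (n + n))) :
    contract ν ξ (X - Y) = contract ν ξ X - contract ν ξ Y := by
  ext a b
  simp [contract, sub_mul, Finset.sum_sub_distrib]

theorem continuous_contract {n : ℕ} (ν ξ : QMat n) : Continuous (contract ν ξ) := by
  refine continuous_pi fun a => continuous_pi fun b => ?_
  refine continuous_finsetSum _ fun s _ => continuous_finsetSum _ fun t _ => ?_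
  fun_prop

theorem traceForm_vecMulVec {ι : Type*} [Fintype ι] (x : ι → ℂ) (A : Matrix ι ι ℂ) :
    traceForm (Matrix.vecMulVec x (star x)) A = quadForm x A := by
  rw [traceForm_apply, quadForm_apply, Matrix.mul_vecMulVec, Matrix.trace_vecMulVec,
    dotProduct_comm]

/-- By adjointness, the quadratic form at `x` is the trace of `X` against a positive semidefinite
matrix. -/
theorem contract_posSemidef {n : ℕ} {ν ξ : QMat n} (hν : ν.PosSemidef) (hξ : ξ.PosSemidef)
    {X : QMat ((n + n) + (n + n))} (hX : X.PosSemidef) : (contract ν ξ X).PosSemidef := by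
  have hω := tensor_posSemidef hν hξ
  refine posSemidef_of_quadForm_nonneg ?_ fun x => ?_
  · ext a b
    rw [Matrix.conjTranspose_apply, contract, contract]
    simp only [star_sum, star_mul']
    rw [Finset.sum_comm]
    exact Finset.sum_congr rfl fun s _ => Finset.sum_congr rfl fun t _ => by
      rw [hX.1.apply, hω.1.apply]
  · rw [← traceForm_vecMulVec, traceForm_apply, trace_contract_mul]
    exact traceForm_nonneg hX (swapTensor_posSemidef (Matrix.posSemidef_vecMulVec_self_star x) hω)

/-! ### Lower computation -/

theorem Machine.out_prefix {M : Machine} {y t u : ℕ} {p : List Bool} {s s' : Config}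
    (htu : t ≤ u) (h : M.run y p t = some s) (h' : M.run y p u = some s') : s.out <+: s'.out := by
  induction u, htu using Nat.le_induction generalizing s' with
  | base =>
    rw [h, Option.some_inj] at h'
    rw [h']
  | succ u _ ih =>
    rw [Machine.run, Option.bind_eq_some_iff] at h'
    obtain ⟨⟨c, i, o⟩, h1, h2⟩ := h'
    refine (ih h1).trans ?_
    unfold Machine.step at h2
    rcases hn : M.next c with _ | c' | ⟨c0, c1⟩ | ⟨x, c'⟩
    all_goals simp only [hn] at h2
    · cases h2; exact List.prefix_rfl
    · cases h2; exact List.prefix_rfl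
    · rcases i with _ | ⟨b, i⟩
      · simp at h2
      · cases b <;> cases h2 <;> exact List.prefix_rfl
    · cases h2; exact List.prefix_append _ _

theorem Machine.Emits.getElem?_unique {M : Machine} {y k a b : ℕ} {p : List Bool} {l l' : List ℕ}
    (h : M.Emits y p l) (h' : M.Emits y p l') (ha : l[k]? = some a) (hb : l'[k]? = some b) :
    a = b := by
  obtain ⟨t, s, ht, rfl⟩ := h
  obtain ⟨u, s', hu, rfl⟩ := h'
  rcases le_total t u with h | h
  · obtain ⟨r, hr⟩ := Machine.out_prefix h ht hu
    rw [← hr, List.getElem?_append_left (List.getElem?_eq_some_iff.1 ha).1, ha] at hb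
    exact Option.some_inj.1 hb
  · obtain ⟨r, hr⟩ := Machine.out_prefix h hu ht
    rw [← hr, List.getElem?_append_left (List.getElem?_eq_some_iff.1 hb).1, hb] at ha
    exact (Option.some_inj.1 ha).symm

/-- The output tape only grows, so its entry at place `k` is determined, and the repetition clause
applies only if there is no such entry. A program therefore counts for one matrix at most, which
carries the Kraft bound over to `lowerProb`. -/
theorem LowerComputes.unique {n : ℕ} {q : List Bool} {A B : QMat n} (hA : LowerComputes U q A)
    (hB : LowerComputes U q B) : A = B := by
  obtain ⟨_, s, h1, _, _, hs⟩ := hA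
  obtain ⟨_, s', h1', _, _, hs'⟩ := hB
  have key : ∀ k, s k = s' k := by
    intro k
    induction k with
    | zero =>
      rcases h1 0 with ⟨l, hl, hk⟩ | ⟨h0, _⟩
      · rcases h1' 0 with ⟨l', hl', hk'⟩ | ⟨h0, _⟩
        · exact EMat.code_injective (hl.getElem?_unique hl' hk hk')
        · omega
      · omega
    | succ k ih =>
      rcases h1 (k + 1) with ⟨l, hl, hk⟩ | ⟨_, hle, he⟩
      · rcases h1' (k + 1) with ⟨l', hl', hk'⟩ | ⟨_, hle, _⟩
        · exact EMat.code_injective (hl.getElem?_unique hl' hk hk')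
        · have := (List.getElem?_eq_some_iff.1 hk).1
          exact absurd (hle l hl) (by omega)
      · rcases h1' (k + 1) with ⟨l', hl', hk'⟩ | ⟨_, _, he'⟩
        · have := (List.getElem?_eq_some_iff.1 hk').1
          exact absurd (hle l' hl') (by omega)
        · rw [he, he', Nat.add_sub_cancel, ih]
  rw [funext key] at hs
  exact tendsto_nhds_unique hs hs'

theorem LowerComputes.posSemidef {n : ℕ} {q : List Bool} {A : QMat n}
    (hA : LowerComputes U q A) : A.PosSemidef := by
  obtain ⟨_, s, _, h, _, hs⟩ := hA
  exact isClosed_posSemidef.mem_of_tendsto hs (Eventually.of_forall h)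

theorem Machine.output_run {f : ℕ → ℕ} {hf : Primrec f} (y t : ℕ) :
    (Machine.output f hf).run y [] (t + 1) =
      some ⟨Encodable.encode (none : Option ℕ), [], [f y]⟩ := by
  induction t with
  | zero =>
    simp only [Machine.run, Option.bind_some, Machine.step, Machine.output, Machine.ofState_init,
      Machine.ofState_next, List.nil_append]
  | succ t ih =>
    rw [Machine.run, ih, Option.bind_some]
    simp only [Machine.step, Machine.output, Machine.ofState_next]

theorem exists_lowerComputes (hU : U.IsUniversal) {n : ℕ} (A : EMat n)
    (hA : A.toMat.PosSemidef) : ∃ q, LowerComputes U q A.toMat := by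
  obtain ⟨r, hr⟩ := hU (Machine.output (fun _ => A.code) (Primrec.const _))
  obtain ⟨h1, h2, _⟩ := hr 0 []
  refine ⟨r ++ [], ?_, fun _ => A, fun k => ?_, fun _ => hA, fun _ => ?_, tendsto_const_nhds⟩
  · rw [h1]
    rintro ⟨t | t, ht⟩
    · cases ht
    · rw [Machine.output_run] at ht
      cases ht
  -- Only place 0 is ever written; the repetition clause supplies all the others.
  · rcases Nat.eq_zero_or_pos k with rfl | hk
    · exact .inl ⟨[A.code], (h2 _).2 ⟨1, _, Machine.output_run 0 0, rfl⟩, rfl⟩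
    · refine .inr ⟨hk, fun l hl => ?_, rfl⟩
      obtain ⟨t | t, s, ht, rfl⟩ := (h2 _).1 hl
      · cases ht
        simp
      · rw [Machine.output_run] at ht
        cases ht
        exact hk
  · rw [sub_self]
    exact Matrix.PosSemidef.zero

/-! ### The program for a partial trace -/

/-- The parameters of a partial trace in one number. -/
def contractParams (q n ν ξ k : ℕ) : ℕ := Nat.pair q (Nat.pair n (Nat.pair ν (Nat.pair ξ k)))

/-- Apply the partial trace with parameters `z` to the matrix with code `x`. -/
def contractByParams (z x : ℕ) : ℕ :=
  contractCode (2 ^ z.unpair.2.unpair.1) z.unpair.2.unpair.2.unpair.2.unpair.2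
    z.unpair.2.unpair.2.unpair.1 z.unpair.2.unpair.2.unpair.2.unpair.1 x

theorem primrec_contractByParams : Primrec₂ contractByParams := by
  have h1 := primrec_unpair_snd (Primrec.fst (α := ℕ) (β := ℕ))
  have h2 := primrec_unpair_snd h1
  have h3 := primrec_unpair_snd h2
  exact primrec_contractCode (primrec_pow (Primrec.const 2) (primrec_unpair_fst h1))
    (primrec_unpair_snd h3) (primrec_unpair_fst h2) (primrec_unpair_fst h3) Primrec.snd

/-- The program given by the parameters of a partial trace. -/
def paramsProgram (z : ℕ) : List Bool := (Encodable.decode z.unpair.1).getD []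

theorem primrec_paramsProgram : Primrec paramsProgram :=
  Primrec.option_getD.comp (Primrec.decode.comp (primrec_unpair_fst Primrec.id)) (Primrec.const [])

/-- Contraction is linear, positive and continuous, so it maps an increasing sequence with limit `X`
to one with the contracted limit. Unary parameters are harmless: the length of a lower computing
program never counts, only the probability that it is output. -/
theorem exists_contract_program (hU : U.IsUniversal) :
    ∃ r : List Bool, ∀ (n k : ℕ) (ν ξ : EMat n) (q : List Bool) (X : QMat ((n + n) + (n + n))),
      ν.toMat.PosSemidef → ξ.toMat.PosSemidef → LowerComputes U q X →
      LowerComputes U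
        (r ++ Machine.unary (contractParams (Encodable.encode q) n ν.code ξ.code k))
        ((2 : ℝ)⁻¹ ^ k • contract ν.toMat ξ.toMat X) := by
  obtain ⟨r, hr⟩ := hU (Machine.transduce U contractByParams paramsProgram
    primrec_contractByParams primrec_paramsProgram)
  refine ⟨r, fun n k ν ξ q X hν hξ hX => ?_⟩
  obtain ⟨hover, s, h1, h2, h3, h4⟩ := hX
  set z := contractParams (Encodable.encode q) n ν.code ξ.code k with hz
  have hq : paramsProgram z = q := by simp [hz, paramsProgram, contractParams]
  have hf : ∀ x, contractByParams z x = contractCode (2 ^ n) k ν.code ξ.code x := fun x => by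
    simp [hz, contractByParams, contractParams]
  obtain ⟨ho, he, _⟩ := hr 0 (Machine.unary z)
  rw [← hq] at hover
  have he' : ∀ l, U.Emits 0 (r ++ Machine.unary z) l ↔
      ∃ l₀, U.Emits 0 q l₀ ∧ l = l₀.map (contractByParams z) := by
    intro l
    rw [he, Machine.transduce_emits_iff 0 hover, hq]
  choose A hA hAm using exists_contract_emat k ν ξ
  have hAm' : ∀ x, (A x).toMat = (2 : ℝ)⁻¹ ^ k • contract ν.toMat ξ.toMat x.toMat := by
    intro x
    rw [hAm]
    ext a b
    simp
  refine ⟨by rw [ho]; exact Machine.transduce_not_overreads 0 hover, fun j => A (s j),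
    fun j => ?_, fun j => ?_, fun j => ?_, ?_⟩
  · rcases h1 j with ⟨l, hl, hj⟩ | ⟨hj, hle, hs⟩
    · refine .inl ⟨_, (he' _).2 ⟨l, hl, rfl⟩, ?_⟩
      rw [List.getElem?_map, hj, Option.map_some, hf, hA]
    · refine .inr ⟨hj, fun l hl => ?_, congrArg A hs⟩
      obtain ⟨l₀, hl₀, rfl⟩ := (he' _).1 hl
      rw [List.length_map]
      exact hle l₀ hl₀
  · rw [hAm']
    exact (contract_posSemidef hν hξ (h2 j)).smul (by positivity)
  · rw [hAm', hAm', ← smul_sub, ← contract_sub]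
    exact (contract_posSemidef hν hξ (h3 j)).smul (by positivity)
  · simp only [hAm']
    exact (((continuous_contract _ _).tendsto X).comp h4).const_smul _

theorem primrec_unary {α : Type*} [Primcodable α] {f : α → ℕ} (hf : Primrec f) :
    Primrec fun a => Machine.unary (f a) := by
  refine Primrec.list_append.comp ((Primrec.list_map (g := fun _ _ => true)
    (Primrec.list_range.comp hf) (Primrec.const true)).of_eq fun a => ?_) (Primrec.const [false])
  simp

/-- From programs for `q`, `ν` and `ξ`, compute the program `r 1ᶻ0`, where `z` consists of the
parameters of the partial trace scaled according to the lengths of the programs for `ν` and `ξ`. -/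
def contractMachine (U : Machine) (r : List Bool) (c : ℕ) : Machine :=
  .seq (U.comap (fun y => y + y) (Primrec.nat_add.comp Primrec.id Primrec.id).to_comp)
    (.seq (U.comap (fun a => a.unpair.1) (primrec_unpair_fst Primrec.id).to_comp)
      (.seq (U.comap (fun a => a.unpair.1.unpair.1)
          (primrec_unpair_fst (primrec_unpair_fst Primrec.id)).to_comp)
        (.output (fun a => Encodable.encode (r ++ Machine.unary (contractParams
              a.unpair.1.unpair.1.unpair.2.unpair.1 a.unpair.1.unpair.1.unpair.1
              a.unpair.1.unpair.2.unpair.1 a.unpair.2.unpair.1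
              (a.unpair.1.unpair.2.unpair.2 + a.unpair.2.unpair.2 + c))))
          (have h1 := primrec_unpair_fst (Primrec.id (α := ℕ))
          have h2 := primrec_unpair_snd (Primrec.id (α := ℕ))
          Primrec.encode.comp (Primrec.list_append.comp (Primrec.const r) (primrec_unary
            (Primrec₂.natPair.comp
              (primrec_unpair_fst (primrec_unpair_snd (primrec_unpair_fst h1)))
              (Primrec₂.natPair.comp (primrec_unpair_fst (primrec_unpair_fst h1))
                (Primrec₂.natPair.comp (primrec_unpair_fst (primrec_unpair_snd h1))
                  (Primrec₂.natPair.comp (primrec_unpair_fst h2)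
                    (Primrec.nat_add.comp (Primrec.nat_add.comp
                      (primrec_unpair_snd (primrec_unpair_snd h1)) (primrec_unpair_snd h2))
                      (Primrec.const c))))))))))))

/-- The lengths of `p₁` and `p₂` are counted while these programs are read, so the scaling exponent
needs no further bits. -/
theorem exists_contractMachine_program (hU : U.IsUniversal) (r : List Bool) (c : ℕ) :
    ∃ r' : List Bool, ∀ (n q ν ξ : ℕ) (p₀ p₁ p₂ : List Bool), U.Outputs (n + n) p₀ q →
      U.Outputs n p₁ ν → U.Outputs n p₂ ξ → U.Outputs n (r' ++ (p₀ ++ (p₁ ++ p₂)))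
        (Encodable.encode (r ++ Machine.unary
          (contractParams q n ν ξ (p₁.length + p₂.length + c)))) := by
  obtain ⟨r', hr'⟩ := exists_outputs_of_machine hU (contractMachine U r c)
  refine ⟨r', fun n q ν ξ p₀ p₁ p₂ h₀ h₁ h₂ => hr' _ _ _ ?_⟩
  have e : p₀ ++ (p₁ ++ p₂) = p₀ ++ (p₁ ++ (p₂ ++ [])) := by simp
  rw [e, contractMachine]
  refine Machine.seq_outputs (x₁ := q) (Machine.comap_outputs h₀)
    (Machine.seq_outputs (x₁ := ν) (Machine.comap_outputs ?_)
      (Machine.seq_outputs (x₁ := ξ) (Machine.comap_outputs ?_) ?_))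
  · simpa using h₁
  · simpa using h₂
  · convert Machine.output_outputs _ using 1
    simp

end QInfo

/-! ### Convergence and positivity of the universal test, and conservation of information. -/

namespace QInfo

open Filter Topology
open scoped Kronecker ComplexOrder ENNReal

variable {U : Machine}

/-! ### Convergence of the universal test -/

/-- With `X = B* B`, an entry is a sum over the rows of `B` of products of two entries, each product
at most the squared norm of its row; these squared norms add up to the trace. -/
theorem norm_entry_le_trace {ι : Type*} [Fintype ι] [DecidableEq ι] {X : Matrix ι ι ℂ}
    (hX : X.PosSemidef) (a b : ι) : ‖X a b‖ ≤ X.trace.re := by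
  obtain ⟨B, rfl⟩ := posSemidef_exists_eq hX
  have h1 : (B.conjTranspose * B).trace.re = ∑ k, ∑ j, ‖B k j‖ ^ 2 := by
    rw [Finset.sum_comm, Matrix.trace, Complex.re_sum]
    refine Finset.sum_congr rfl fun j _ => ?_
    rw [Matrix.diag_apply, Matrix.mul_apply, Complex.re_sum]
    refine Finset.sum_congr rfl fun k _ => ?_
    rw [Matrix.conjTranspose_apply, Complex.star_def, ← Complex.normSq_eq_conj_mul_self,
      Complex.normSq_eq_norm_sq, Complex.ofReal_re]
  rw [h1, Matrix.mul_apply]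
  refine (norm_sum_le _ _).trans (Finset.sum_le_sum fun k _ => ?_)
  rw [Matrix.conjTranspose_apply, norm_mul, norm_star]
  have ha : ‖B k a‖ ^ 2 ≤ ∑ j, ‖B k j‖ ^ 2 := Finset.single_le_sum (f := fun j => ‖B k j‖ ^ 2) (fun _ _ => by positivity)
    (Finset.mem_univ a)
  have hb : ‖B k b‖ ^ 2 ≤ ∑ j, ‖B k j‖ ^ 2 := Finset.single_le_sum (f := fun j => ‖B k j‖ ^ 2) (fun _ _ => by positivity)
    (Finset.mem_univ b)
  nlinarith [sq_nonneg (‖B k a‖ - ‖B k b‖)]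

/-- The elementary unit matrix. -/
def EMat.one (n : ℕ) : EMat n := fun i j => if i = j then ⟨1, 0⟩ else ⟨0, 0⟩

theorem EMat.toMat_one (n : ℕ) : (EMat.one n).toMat = 1 := by
  ext i j
  simp only [EMat.toMat, EMat.one, Matrix.map_apply, Matrix.one_apply, GaussRat.toComplex]
  split_ifs <;> simp [Complex.ext_iff]

/-- The computational basis. -/
def EPure.basis (n : ℕ) (i : Fin (2 ^ n)) : EPure n :=
  ⟨EMat.one n i, by
    have h : ∀ j, EVec.toVec (EMat.one n i) j = (1 : QMat n) i j := fun j => by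
      rw [← EMat.toMat_one]; rfl
    simp only [h, Matrix.one_apply]
    rw [Finset.sum_eq_single i] <;> simp +contextual [eq_comm]⟩

theorem EPure.basis_toVec (n : ℕ) (i j : Fin (2 ^ n)) :
    (EPure.basis n i).1.toVec j = (1 : QMat n) i j := by
  rw [← EMat.toMat_one]; rfl

theorem EPure.basis_injective (n : ℕ) : Function.Injective (EPure.basis n) := by
  intro i j h
  by_contra hij
  have h1 := EPure.basis_toVec n i i
  rw [h, EPure.basis_toVec, Matrix.one_apply_eq, Matrix.one_apply_ne (Ne.symm hij)] at h1
  exact zero_ne_one h1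

/-- The projectors to the computational basis add up to the identity, and the least of their
finitely many probabilities is positive. -/
theorem exists_le_mu (hU : U.IsUniversal) (n : ℕ) :
    ∃ ε : ℝ, 0 < ε ∧ (mu U n - ε • (1 : QMat n)).PosSemidef := by
  obtain ⟨i₀, h₀⟩ := Finite.exists_min fun i => m U (EPure.basis n i).1.code n
  refine ⟨_, m_pos hU (EPure.basis n i₀).1.code n, ?_⟩
  set ε := m U (EPure.basis n i₀).1.code n with hε
  let s : Finset (EPure n) := Finset.univ.map ⟨_, EPure.basis_injective n⟩
  have h1 := (summable_muTerm U n).sum_add_tsum_compl (s := s)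
  have h2 : ∑ φ ∈ s, muTerm U n φ = ∑ i, muTerm U n (EPure.basis n i) := by
    rw [Finset.sum_map]; rfl
  have h3 : ε • (1 : QMat n) = ∑ i, ε • Matrix.vecMulVec (EPure.basis n i).1.toVec
      (star (EPure.basis n i).1.toVec) := by
    rw [← Finset.smul_sum]
    congr 1
    ext a b
    rw [Matrix.sum_apply]
    simp only [Matrix.vecMulVec_apply, Pi.star_apply, EPure.basis_toVec]
    simp [Matrix.one_apply, apply_ite, eq_comm]
  have h4 : mu U n - ε • (1 : QMat n) =
      ∑ i, (m U (EPure.basis n i).1.code n - ε) • Matrix.vecMulVec (EPure.basis n i).1.toVec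
        (star (EPure.basis n i).1.toVec) +
      ∑' φ : ↑(s : Set (EPure n))ᶜ, muTerm U n φ := by
    rw [mu, ← h1, h2, h3]
    simp only [sub_smul, Finset.sum_sub_distrib, muTerm]
    abel
  rw [h4]
  refine (Matrix.posSemidef_sum _ fun i _ => ?_).add
    (tsum_posSemidef (fun φ => muTerm_posSemidef U n φ) ((summable_muTerm U n).subtype _))
  exact (Matrix.posSemidef_vecMulVec_self_star _).smul (sub_nonneg.2 (h₀ i))

theorem tensor_one_one (k n : ℕ) : tensor (1 : QMat k) (1 : QMat n) = 1 := by
  rw [tensor, Matrix.one_kronecker_one, Matrix.reindex_apply, Matrix.submatrix_one_equiv]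

theorem productTests_posSemidef {n : ℕ} {C D : QMat n} {X : QMat (n + n)}
    (hX : X ∈ productTests U C D) : X.PosSemidef := by
  obtain ⟨_, ⟨q, hq⟩, _⟩ := hX
  exact hq.posSemidef

/-- From `ε 1 ≤ μ` follows `ε² Tr X ≤ Tr X (μ ⊗ μ) ≤ 1`, a bound that is uniform over all tests. -/
theorem exists_trace_productTests_le (hU : U.IsUniversal) (n : ℕ) :
    ∃ C : ℝ, ∀ X ∈ productTests U (mu U n) (mu U n), X.trace.re ≤ C := by
  obtain ⟨ε, hε, h⟩ := exists_le_mu hU n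
  refine ⟨(ε * ε)⁻¹, fun X hX => ?_⟩
  have h1 := traceForm_mono (productTests_posSemidef hX)
    (tensor_mono (mu_posSemidef U n) (Matrix.PosSemidef.one.smul hε.le) h h)
  have h2 : traceForm (tensor (mu U n) (mu U n)) X ≤ 1 := hX.2.2
  rw [tensor_smul_left, tensor_smul_right, tensor_one_one, traceForm_apply] at h1
  simp only [Matrix.mul_smul, Matrix.mul_one, Matrix.trace_smul, Complex.real_smul,
    Complex.re_ofReal_mul] at h1
  rw [inv_eq_one_div, le_div_iff₀ (by positivity)]
  linarith

open Classical in
/-- `lowerProb` as an extended nonnegative real. -/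
noncomputable def lowerProbE (U : Machine) {n : ℕ} (A : QMat n) (y : ℕ) : ℝ≥0∞ :=
  ∑' q : List Bool, if LowerComputes U q A then probE U (Encodable.encode q) y else 0

/-- Product tests together with programs that lower compute them. -/
abbrev TestProg (U : Machine) (n : ℕ) : Type :=
  {a : List Bool × QMat (n + n) |
    LowerComputes U a.1 a.2 ∧ a.2 ∈ productTests U (mu U n) (mu U n)}

/-- The code of the program. -/
def TestProg.code {n : ℕ} (a : TestProg U n) : ℕ := Encodable.encode a.1.1

theorem TestProg.code_injective {n : ℕ} :
    Function.Injective (TestProg.code : TestProg U n → ℕ) := by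
  rintro ⟨⟨q, X⟩, h, hX⟩ ⟨⟨q', X'⟩, h', hX'⟩ he
  obtain rfl : q = q' := Encodable.encode_injective he
  obtain rfl : X = X' := h.unique h'
  rfl

theorem tsum_lowerProbE (U : Machine) (n : ℕ) (F : QMat (n + n) → ℝ≥0∞) :
    ∑' X : productTests U (mu U n) (mu U n), lowerProbE U X.1 n * F X.1 =
      ∑' a : TestProg U n, probE U a.code n * F a.1.2 := by
  classical
  refine Eq.trans ?_ (tsum_subtype {a : List Bool × QMat (n + n) |
    LowerComputes U a.1 a.2 ∧ a.2 ∈ productTests U (mu U n) (mu U n)}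
    (fun a => probE U (Encodable.encode a.1) n * F a.2)).symm
  rw [ENNReal.tsum_prod', ENNReal.tsum_comm, tsum_subtype (productTests U (mu U n) (mu U n))
    fun X => lowerProbE U X n * F X]
  refine tsum_congr fun X => ?_
  by_cases hX : X ∈ productTests U (mu U n) (mu U n)
  · rw [Set.indicator_of_mem hX, lowerProbE, ← ENNReal.tsum_mul_right]
    refine tsum_congr fun q => ?_
    by_cases hq : LowerComputes U q X <;> simp [Set.indicator, hq, hX]
  · simp [Set.indicator, hX]

theorem tsum_lowerProbE_le_one (U : Machine) (n : ℕ) :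
    ∑' X : productTests U (mu U n) (mu U n), lowerProbE U X.1 n ≤ 1 := by
  have h := tsum_lowerProbE U n fun _ => 1
  simp only [mul_one] at h
  rw [h]
  exact tsum_probE_le_one U n TestProg.code_injective

theorem lowerProbE_ne_top (U : Machine) {k : ℕ} (A : QMat k) (y : ℕ) : lowerProbE U A y ≠ ∞ := by
  classical
  refine ne_top_of_le_ne_top ENNReal.one_ne_top
    (le_trans (ENNReal.tsum_le_tsum fun q => ?_)
      (tsum_probE_le_one U y (code := fun q : List Bool => Encodable.encode q)
        Encodable.encode_injective))
  split_ifs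
  · exact le_rfl
  · exact zero_le

theorem toReal_lowerProbE (U : Machine) {k : ℕ} (A : QMat k) (y : ℕ) :
    (lowerProbE U A y).toReal = lowerProb U A y := by
  classical
  rw [lowerProbE, ENNReal.tsum_toReal_eq, lowerProb]
  · refine tsum_congr fun q => ?_
    split_ifs <;> simp [toReal_probE]
  · intro q
    split_ifs
    · exact ne_top_of_le_ne_top ENNReal.one_ne_top (probE_le_one U _ y)
    · exact ENNReal.zero_ne_top

theorem ofReal_lowerProb (U : Machine) {k : ℕ} (A : QMat k) (y : ℕ) :
    ENNReal.ofReal (lowerProb U A y) = lowerProbE U A y := by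
  rw [← toReal_lowerProbE, ENNReal.ofReal_toReal (lowerProbE_ne_top U A y)]

theorem lowerProb_nonneg (U : Machine) {k : ℕ} (A : QMat k) (y : ℕ) : 0 ≤ lowerProb U A y := by
  rw [← toReal_lowerProbE]
  exact ENNReal.toReal_nonneg

theorem summable_testTerm (hU : U.IsUniversal) (n : ℕ) : Summable (testTerm U n) := by
  obtain ⟨C, hC⟩ := exists_trace_productTests_le hU n
  have hs : Summable fun X : productTests U (mu U n) (mu U n) => lowerProb U X.1 n := by
    simp only [← toReal_lowerProbE]
    exact ENNReal.summable_toReal (ne_top_of_le_ne_top ENNReal.one_ne_top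
      (tsum_lowerProbE_le_one U n))
  refine Pi.summable.2 fun a => Pi.summable.2 fun b => ?_
  refine Summable.of_norm_bounded (hs.mul_right C) fun X => ?_
  have h1 := (norm_entry_le_trace (productTests_posSemidef X.2) a b).trans (hC X.1 X.2)
  rw [testTerm, Matrix.smul_apply, norm_smul, Real.norm_of_nonneg (lowerProb_nonneg U _ _)]
  exact mul_le_mul_of_nonneg_left h1 (lowerProb_nonneg U _ _)

/-- The runs of `U` that output a program lower computing a product test. -/
abbrev TestRun (U : Machine) (n : ℕ) : Type :=
  {i : List Bool × TestProg U n | U.Outputs n i.1 i.2.code}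

/-- Both layers of probability are unfolded: an index is a program `p` whose output is a program
that lower computes a test. -/
theorem ofReal_traceForm_universalTest (hU : U.IsUniversal) (n : ℕ) {D : QMat (n + n)}
    (hD : D.PosSemidef) :
    ENNReal.ofReal (traceForm D (universalTest U n)) =
      ∑' i : TestRun U n, weight i.1.1 * ENNReal.ofReal (traceForm D i.1.2.1.2) := by
  have h := (summable_testTerm hU n).hasSum.map (traceForm D) (continuous_traceForm D)
  have hnn : ∀ X : productTests U (mu U n) (mu U n), 0 ≤ traceForm D X.1 := fun X =>
    traceForm_nonneg (productTests_posSemidef X.2) hD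
  have hnn' : ∀ X : productTests U (mu U n) (mu U n), 0 ≤ traceForm D (testTerm U n X) := by
    intro X
    rw [testTerm, traceForm_smul]
    exact mul_nonneg (lowerProb_nonneg U _ _) (hnn X)
  rw [universalTest, ← h.tsum_eq]
  simp only [Function.comp_apply]
  rw [ENNReal.ofReal_tsum_of_nonneg hnn' h.summable,
    ← tsum_probE U n TestProg.code fun a => ENNReal.ofReal (traceForm D a.1.2),
    ← tsum_lowerProbE U n fun X => ENNReal.ofReal (traceForm D X)]
  refine tsum_congr fun X => ?_
  rw [testTerm, traceForm_smul, ENNReal.ofReal_mul (lowerProb_nonneg U _ _),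
    ofReal_lowerProb]

theorem testTrace_eq {n : ℕ} (σ ρ : QMat n) :
    testTrace U σ ρ = traceForm (tensor σ ρ) (universalTest U n) := rfl

/-! ### Positivity -/

theorem trace_mu_le_one (U : Machine) (n : ℕ) : (mu U n).trace.re ≤ 1 := by
  have h := ofReal_map_mu U (traceForm (1 : QMat n)) (continuous_traceForm _) (traceForm_smul _)
    fun v => traceForm_nonneg (Matrix.posSemidef_vecMulVec_self_star v) Matrix.PosSemidef.one
  have h1 : ∀ φ : EPure n, traceForm (1 : QMat n)
      (Matrix.vecMulVec φ.1.toVec (star φ.1.toVec)) = 1 := by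
    intro φ
    rw [traceForm_apply, Matrix.mul_one, Matrix.trace_vecMulVec, dotProduct, Complex.re_sum]
    refine Eq.trans ?_ φ.2
    refine Finset.sum_congr rfl fun i _ => ?_
    rw [Pi.star_apply, Complex.star_def, Complex.mul_conj, Complex.normSq_eq_norm_sq,
      Complex.ofReal_re]
  simp only [h1] at h
  rw [← tsum_probE U n (fun φ : EPure n => φ.1.code) fun _ => ENNReal.ofReal 1] at h
  simp only [ENNReal.ofReal_one, mul_one] at h
  have h2 := tsum_probE_le_one U n (epure_code_injective n)
  rw [← h, traceForm_apply, Matrix.mul_one, ← ENNReal.ofReal_one,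
    ENNReal.ofReal_le_ofReal_iff zero_le_one] at h2
  exact h2

theorem one_mem_productTests (hU : U.IsUniversal) (n : ℕ) :
    ∃ q, LowerComputes U q (1 : QMat (n + n)) ∧
      (1 : QMat (n + n)) ∈ productTests U (mu U n) (mu U n) := by
  obtain ⟨q, hq⟩ := exists_lowerComputes hU (EMat.one (n + n))
    (by rw [EMat.toMat_one]; exact Matrix.PosSemidef.one)
  rw [EMat.toMat_one] at hq
  refine ⟨q, hq, ⟨1, 1, (tensor_one_one n n).symm⟩, ⟨q, hq⟩, ?_⟩
  have h0 := (mu_posSemidef U n).trace_nonneg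
  have h1 := trace_mu_le_one U n
  rw [Complex.nonneg_iff] at h0
  rw [Matrix.one_mul, tensor_trace, Complex.mul_re, ← h0.2]
  nlinarith [h0.1]

/-- The identity is a test because `μ` has trace at most 1, and its trace against a product of
density matrices is 1. The term of one run producing it is already positive. -/
theorem testTrace_pos (hU : U.IsUniversal) {n : ℕ} {σ ρ : QMat n} (hσ : IsDensity σ)
    (hρ : IsDensity ρ) : 0 < testTrace U σ ρ := by
  obtain ⟨q, hq, hX⟩ := one_mem_productTests hU n
  obtain ⟨p, hp⟩ := exists_outputs hU (Encodable.encode q)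
  let i : TestRun U n := ⟨(p, ⟨(q, 1), hq, hX⟩), hp n⟩
  rw [← ENNReal.ofReal_pos, testTrace_eq,
    ofReal_traceForm_universalTest hU n (tensor_posSemidef hσ.1 hρ.1)]
  refine lt_of_lt_of_le ?_ (ENNReal.le_tsum i)
  have h1 : traceForm (tensor σ ρ) (1 : QMat (n + n)) = 1 := by
    rw [traceForm_apply, Matrix.one_mul, (hσ.tensor hρ).2, Complex.one_re]
  change 0 < weight p * ENNReal.ofReal (traceForm (tensor σ ρ) (1 : QMat (n + n)))
  rw [h1, ENNReal.ofReal_one, mul_one, weight]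
  exact pos_iff_ne_zero.2 (by simp)

/-! ### Conservation -/

theorem tensor_smul_mem {n : ℕ} (r : ℝ) {X : QMat (n + n)} (h : ∃ A B : QMat n, X = tensor A B) :
    ∃ A B : QMat n, r • X = tensor A B := by
  obtain ⟨A, B, rfl⟩ := h
  exact ⟨r • A, B, (tensor_smul_left r A B).symm⟩

/-- By adjointness the trace against `μₙ ⊗ μₙ` is that of `X` against `(μₙ ⊗ ν) ⊗ (μₙ ⊗ ξ)`, and
domination in both factors bounds it by `2 ^ (k + l)`. -/
theorem contract_mem_productTests {n k l : ℕ} {ν ξ : QMat n}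
    (hξ : ξ.PosSemidef)
    (hk : ((2 : ℝ) ^ k • mu U (n + n) - tensor (mu U n) ν).PosSemidef)
    (hl : ((2 : ℝ) ^ l • mu U (n + n) - tensor (mu U n) ξ).PosSemidef)
    {X : QMat ((n + n) + (n + n))} (hX : X ∈ productTests U (mu U (n + n)) (mu U (n + n)))
    (hc : LowerComputable U ((2 : ℝ)⁻¹ ^ (k + l) • contract ν ξ X)) :
    (2 : ℝ)⁻¹ ^ (k + l) • contract ν ξ X ∈ productTests U (mu U n) (mu U n) := by
  have hXp := productTests_posSemidef hX
  obtain ⟨⟨A, B, rfl⟩, _, ht⟩ := hX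
  refine ⟨tensor_smul_mem _ (contract_tensor ν ξ A B), hc, ?_⟩
  have h1 := traceForm_mono hXp (tensor_mono ((mu_posSemidef U (n + n)).smul (by positivity))
    (tensor_posSemidef (mu_posSemidef U n) hξ) hk hl)
  rw [← swapTensor_tensor, traceForm_apply, ← trace_contract_mul, tensor_smul_left,
    tensor_smul_right] at h1
  simp only [traceForm_apply, Matrix.mul_smul, Matrix.trace_smul, Complex.real_smul,
    Complex.re_ofReal_mul] at h1
  rw [Matrix.smul_mul, Matrix.trace_smul, Complex.real_smul, Complex.re_ofReal_mul, inv_pow,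
    inv_mul_le_iff₀ (by positivity), mul_one]
  refine h1.trans ?_
  have h2 : (2 : ℝ) ^ (k + l) = 2 ^ k * 2 ^ l := pow_add 2 k l
  rw [h2, ← mul_assoc]
  exact mul_le_of_le_one_right (by positivity) ht

/-- Runs that produce tests on the large system are sent injectively to runs that produce their
scaled contractions. The lengths of `p₁` and `p₂` enter once through the scaling `S` and once
through the longer program. -/
theorem exists_testTrace_tensor_le (hU : U.IsUniversal) :
    ∃ c : ℕ, ∀ (n : ℕ) (σ ρ : QMat n) (ν ξ : EMat n),
      IsDensity σ → IsDensity ρ → IsDensity ν.toMat → IsDensity ξ.toMat →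
        testTrace U (tensor σ ν.toMat) (tensor ρ ξ.toMat) ≤
          2 ^ (2 * K U ν.code n + 2 * K U ξ.code n + c) * testTrace U σ ρ := by
  obtain ⟨c, hc⟩ := exists_mu_dominates hU
  obtain ⟨r, hr⟩ := exists_contract_program hU
  obtain ⟨r', hr'⟩ := exists_contractMachine_program hU r (2 * c)
  -- `r'.length` pays for the simulation by `U`, and `2 * c` for the two uses of domination.
  refine ⟨r'.length + 2 * c, fun n σ ρ ν ξ hσ hρ hν hξ => ?_⟩
  obtain ⟨p₁, hp₁, ho₁⟩ := exists_outputs_length_eq_K hU ν.code n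
  obtain ⟨p₂, hp₂, ho₂⟩ := exists_outputs_length_eq_K hU ξ.code n
  set k := K U ν.code n
  set l := K U ξ.code n
  have hkl : k + c + (l + c) = p₁.length + p₂.length + 2 * c := by omega
  have hω := tensor_posSemidef hσ.1 hρ.1
  have hω₂ := tensor_posSemidef (hσ.tensor hν).1 (hρ.tensor hξ).1
  let S : ℝ := (2 : ℝ)⁻¹ ^ (p₁.length + p₂.length + 2 * c)
  let e : TestRun U (n + n) → TestRun U n := fun i =>
    ⟨(r' ++ (i.1.1 ++ (p₁ ++ p₂)), ⟨(r ++ Machine.unary (contractParams i.1.2.code n ν.code ξ.code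
        (p₁.length + p₂.length + 2 * c)), S • contract ν.toMat ξ.toMat i.1.2.1.2),
        hr n _ ν ξ _ _ hν.1 hξ.1 i.1.2.2.1, by
          have h := contract_mem_productTests hξ.1 (hc n ν hν) (hc n ξ hξ) i.1.2.2.2
          rw [hkl] at h
          exact h ⟨_, hr n _ ν ξ _ _ hν.1 hξ.1 i.1.2.2.1⟩⟩),
      hr' n _ _ _ _ _ _ i.2 ho₁ ho₂⟩
  have he : Function.Injective e := by
    rintro ⟨⟨p, a⟩, h⟩ ⟨⟨p', a'⟩, h'⟩ hee
    have h1 : r' ++ (p ++ (p₁ ++ p₂)) = r' ++ (p' ++ (p₁ ++ p₂)) :=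
      congrArg (fun i : TestRun U n => i.1.1) hee
    obtain rfl : p = p' := List.append_cancel_right (List.append_cancel_left h1)
    obtain rfl : a = a' := TestProg.code_injective (Machine.Outputs.unique h h')
    rfl
  have hle : ENNReal.ofReal (testTrace U (tensor σ ν.toMat) (tensor ρ ξ.toMat)) ≤
      ENNReal.ofReal (2 ^ (2 * k + 2 * l + (r'.length + 2 * c)) * testTrace U σ ρ) := by
    rw [ENNReal.ofReal_mul (by positivity), testTrace_eq, testTrace_eq,
      ofReal_traceForm_universalTest hU _ hω, ofReal_traceForm_universalTest hU _ hω₂,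
      ← ENNReal.tsum_mul_left]
    refine le_trans (ENNReal.tsum_le_tsum fun i => ?_) (ENNReal.tsum_comp_le_tsum_of_injective he _)
    have h1 : traceForm (tensor σ ρ) (e i).1.2.1.2 =
        S * traceForm (tensor (tensor σ ν.toMat) (tensor ρ ξ.toMat)) i.1.2.1.2 := by
      change traceForm _ (S • contract ν.toMat ξ.toMat i.1.2.1.2) = _
      rw [traceForm_smul, traceForm_apply, trace_contract_mul, swapTensor_tensor, traceForm_apply]
    have h2 : weight (e i).1.1 = weight r' * (weight i.1.1 * (weight p₁ * weight p₂)) := by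
      rw [← weight_append, ← weight_append, ← weight_append]
    rw [h1, h2, ENNReal.ofReal_mul (by positivity)]
    -- The prefactor exactly compensates the weights of `r'`, `p₁`, `p₂` and the scaling `S`, so
    -- corresponding terms are equal and only the injection loses anything.
    have h3 : ENNReal.ofReal (2 ^ (2 * k + 2 * l + (r'.length + 2 * c))) *
        (weight r' * (weight p₁ * weight p₂) * ENNReal.ofReal S) = 1 := by
      have h4 : weight r' * (weight p₁ * weight p₂) * ENNReal.ofReal S =
          ENNReal.ofReal ((2 : ℝ)⁻¹ ^ (2 * k + 2 * l + (r'.length + 2 * c))) := by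
        rw [ofReal_half_pow, ofReal_half_pow, ← weight_append, ← weight_append, weight, ← pow_add]
        congr 1
        simp only [List.length_append]
        omega
      rw [h4, ← ENNReal.ofReal_mul (by positivity), ← mul_pow]
      norm_num
    calc _ = 1 * (weight i.1.1 * ENNReal.ofReal (traceForm (tensor (tensor σ ν.toMat)
          (tensor ρ ξ.toMat)) i.1.2.1.2)) := (one_mul _).symm
      _ ≤ _ := by
        rw [← h3]
        exact le_of_eq (by ring)
  exact (ENNReal.ofReal_le_ofReal_iff (mul_nonneg (by positivity) (testTrace_pos hU hσ hρ).le)).1 hle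

end QInfo

open QInfo
theorem theorem11 (U : Machine) (hU : U.IsUniversal) :
    (∀ n : ℕ, Summable (muTerm U n) ∧ Summable (testTerm U n)) ∧
    (∀ (n : ℕ) (σ ρ : QMat n), IsDensity σ → IsDensity ρ → 0 < testTrace U σ ρ) ∧
    ∃ c : ℝ, ∀ (n : ℕ) (σ ρ : QMat n) (ν ξ : EMat n),
      IsDensity σ → IsDensity ρ → IsDensity ν.toMat → IsDensity ξ.toMat →
        info U (tensor σ ν.toMat) (tensor ρ ξ.toMat) ≤
          info U σ ρ + 2 * (K U ν.code n : ℝ) + 2 * (K U ξ.code n : ℝ) + c := by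
  refine ⟨fun n => ⟨summable_muTerm U n, summable_testTerm hU n⟩,
    fun n σ ρ hσ hρ => testTrace_pos hU hσ hρ, ?_⟩
  obtain ⟨c, hc⟩ := exists_testTrace_tensor_le hU
  refine ⟨c, fun n σ ρ ν ξ hσ hρ hν hξ => ?_⟩
  have h := Real.logb_le_logb_of_le one_lt_two (testTrace_pos hU (hσ.tensor hν) (hρ.tensor hξ))
    (hc n σ ρ ν ξ hσ hρ hν hξ)
  rw [Real.logb_mul (by positivity) (testTrace_pos hU hσ hρ).ne', Real.logb_pow,
    Real.logb_self_eq_one one_lt_two] at h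
  push_cast at h
  simp only [info]
  linarith
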